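/- Theorem (estimate on a chain: without boundary conditions). Setting. For $D\subset\mathbb R^n$ open and bounded and a ball $B\subset D$, say that $D$ is star shaped with respect to $B$ if the convex hull of $B\cup\{y\}$ is contained in $D$ for every $y\in D$. Let $\Omega\subset\mathbb R^n$ be contractible and suppose that $\Omega=\bigcup_{i=1}^N\Omega_i$, $N\ge 1$, where: each $\Omega_i$ is a bounded domain that is star shaped with respect to a ball $B_i\subset\Omega_i$; $\Omega_i\cap\Omega_j=\emptyset$ whenever $|i-j|>1$; for $1\le i\le N-1$ the overlap $\Omega_{i+1/2}=\Omega_i\cap\Omega_{i+1}$ is star shaped with respect to a ball $B_{i+1/2}\subset\Omega_{i+1/2}$ (in particular it is not empty); and there are smooth functions $\phi_i$ on $\Omega$, $1\le i\le N$, with $0\le\phi_i\le 1$, $\phi_i=0$ in $\Omega\setminus\Omega_i$, $\sum_{i}\phi_i=1$, and for every multiindex $\alpha$ $$\sup_{\Omega}|\partial^\alpha\phi_i|\le \frac{C_{\alpha,i}}{d_i^{|\alpha|}},$$ where $d_i$ is the minimum of the diameters of those of the two overlaps $\Omega_{i-1/2},\Omega_{i+1/2}$ that exist (if $N=1$ there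 is no overlap and the condition only concerns $\phi_1\equiv1$). Constants. For $1\le j\le n$ and $V\ge 1$ let $$\kappa_j(V)=\begin{cases}1,& 2j>n,\\ 1+V^{\frac{n-2j}{2(n-j)}}(\log V)^{\frac{n}{2(n-j)}},& 2j\in\{n-1,n\},\\ 1+V^{\frac{n-2j}{2(n-j)}}(\log V)^{\frac{n}{2(n-j-1)}},& 2j\le n-2.\end{cases}$$ Let $\mathbb T=\{1,\dots,N\}\cup\{\frac32,\dots,N-\frac12\}$. For a number $c>0$ and $\ell\in\{1,\dots,n\}$ put $$C_{\mathbb T}=\max_{t\in\mathbb T}\ c\,\frac{\operatorname{diam}\Omega_t}{\operatorname{diam}B_t}\,\max\Big\{\kappa_\ell\Big(\frac{|\Omega_t|}{|B_t|}\Big),\kappa_{\max(\ell-1,1)}\Big(\frac{|\Omega_t|}{|B_t|}\Big)\Big\},$$ $$D_{\mathbb T}=\max_{t\in\mathbb T}\operatorname{diam}\Omega_t,\qquad d_{\mathbb T}=\min_{t\in\mathbb T}\operatorname{diam}\Omega_t,\qquad C_S=\max\{C_{\alpha,i}:|\alpha|\le2,\ 1\le i\le N-1\}$$ ($C_S=0$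 if $N=1$), and $C_P=\max_{t\in\mathbb T}K_t$, where $K_t$ is the smallest constant with $\|f\|_{L^2(\Omega_t)}\le K_t\operatorname{diam}(\Omega_t)\,|f|_{H^1(\Omega_t)}$ for all $f\in H^1(\Omega_t)$ with $\int_{\Omega_t}f=0$. Norms of forms are taken coefficientwise: for $u=\sum_I u_I\,dx_I$, $\|u\|_{L^2}^2=\sum_I\|u_I\|_{L^2}^2$ and $|u|_{H^1}^2=\sum_I|u_I|_{H^1}^2$; exterior derivatives are understood in the weak sense. Claim. For all $n\ge1$ and $\ell\in\{1,\dots,n\}$ there is a number $c>0$, depending only on $n$ and $\ell$, such that for every $N$, every $\Omega$ with a decomposition as above, and every $u\in L^2(\Omega,\Lambda^\ell)$ with $du=0$, there is $v\in H^1(\Omega,\Lambda^{\ell-1})$ with $dv=u$ and $$|v|_{H^1(\Omega,\Lambda^{\ell-1})}\le C\,\|u\|_{L^2(\Omega,\Lambda^\ell)},\qquad C=2C_{\mathbb T}\begin{cases}\sqrt{1+32\,C_S^2\Big(\dfrac{C_{\mathbb T}C_PD_{\mathbb T}}{d_{\mathbb T}}+1\Big)^4},&\ell\ge2,\\[2mm]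 1,&\ell=1.\end{cases}$$ In particular $C$ depends on $N$ only through $C_{\mathbb T},C_P,D_{\mathbb T},d_{\mathbb T},C_S$. -/

import Mathlib

open MeasureTheory Set
open scoped ContDiff

/-- The Euclidean space `ℝⁿ`. -/
abbrev Eucl (n : ℕ) : Type := EuclideanSpace ℝ (Fin n)

/-- The space `Λ^k` of exterior `k`-forms on `ℝⁿ`. -/
abbrev Forms (n k : ℕ) : Type := Eucl n [⋀^Fin k]→L[ℝ] ℝ

/-- The standard basis vector `e_j` of `ℝⁿ`. -/
noncomputable def stdVec {n : ℕ} (j : Fin n) : Eucl n := EuclideanSpace.single j 1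

/-- Smooth functions with compact support in the open set `Ω`. -/
def IsTestFun {n : ℕ} (Ω : Set (Eucl n)) (ψ : Eucl n → ℝ) : Prop :=
  ContDiff ℝ ∞ ψ ∧ HasCompactSupport ψ ∧ tsupport ψ ⊆ Ω

/-! ### Scalar Sobolev functions -/

/-- `g` is the weak partial derivative `∂_j f` in `Ω`. -/
def HasWeakPartial {n : ℕ} (Ω : Set (Eucl n)) (j : Fin n) (f g : Eucl n → ℝ) : Prop :=
  ∀ ψ : Eucl n → ℝ, IsTestFun Ω ψ →
    ∫ x in Ω, g x * ψ x = - ∫ x in Ω, f x * fderiv ℝ ψ x (stdVec j)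

/-- `f ∈ L²(Ω)`. -/
def MemL2 {n : ℕ} (Ω : Set (Eucl n)) (f : Eucl n → ℝ) : Prop :=
  MemLp f 2 (volume.restrict Ω)

/-- `f ∈ H¹(Ω)`. -/
def MemH1 {n : ℕ} (Ω : Set (Eucl n)) (f : Eucl n → ℝ) : Prop :=
  MemL2 Ω f ∧ ∀ j : Fin n, ∃ g : Eucl n → ℝ, MemL2 Ω g ∧ HasWeakPartial Ω j f g

open Classical in
/-- The weak partial derivative `∂_j f ∈ L²(Ω)` (unique up to a null set if it exists). -/
noncomputable def weakPartial {n : ℕ} (Ω : Set (Eucl n)) (j : Fin n) (f : Eucl n → ℝ) :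
    Eucl n → ℝ :=
  if h : ∃ g : Eucl n → ℝ, MemL2 Ω g ∧ HasWeakPartial Ω j f g then h.choose else 0

/-- `‖f‖²_{L²(Ω)}`. -/
noncomputable def l2NormSq {n : ℕ} (Ω : Set (Eucl n)) (f : Eucl n → ℝ) : ℝ :=
  ∫ x in Ω, f x ^ 2

/-- `|f|²_{H¹(Ω)}`, the squared `H¹`-seminorm. -/
noncomputable def h1SemiSq {n : ℕ} (Ω : Set (Eucl n)) (f : Eucl n → ℝ) : ℝ :=
  ∑ j : Fin n, l2NormSq Ω (weakPartial Ω j f)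

/-! ### Differential forms with coefficients in `L²` and `H¹` -/

/-- The coefficient `u_I` of the form `u = ∑_I u_I dx_I`. -/
noncomputable def coeff {n k : ℕ} (u : Eucl n → Forms n k) (I : Fin k → Fin n) : Eucl n → ℝ :=
  fun x => u x (fun q => stdVec (I q))

open Classical in
/-- The ordered `k`-tuples `i₁ < ⋯ < i_k` of indices. -/
noncomputable def incrTuples (n k : ℕ) : Finset (Fin k → Fin n) :=
  Finset.univ.filter (fun I => StrictMono I)

/-- `u ∈ L²(Ω, Λ^k)`. -/
def FormMemL2 {n k : ℕ} (Ω : Set (Eucl n)) (u : Eucl n → Forms n k) : Prop :=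
  ∀ I ∈ incrTuples n k, MemL2 Ω (coeff u I)

/-- `u ∈ H¹(Ω, Λ^k)`. -/
def FormMemH1 {n k : ℕ} (Ω : Set (Eucl n)) (u : Eucl n → Forms n k) : Prop :=
  ∀ I ∈ incrTuples n k, MemH1 Ω (coeff u I)

/-- `‖u‖_{L²(Ω, Λ^k)}`. -/
noncomputable def formL2Norm {n k : ℕ} (Ω : Set (Eucl n)) (u : Eucl n → Forms n k) : ℝ :=
  √(∑ I ∈ incrTuples n k, l2NormSq Ω (coeff u I))

/-- `|u|_{H¹(Ω, Λ^k)}`. -/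
noncomputable def formH1Semi {n k : ℕ} (Ω : Set (Eucl n)) (u : Eucl n → Forms n k) : ℝ :=
  √(∑ I ∈ incrTuples n k, h1SemiSq Ω (coeff u I))

/-- `dv = w` weakly in `Ω`. In terms of coefficients the exterior derivative is
`(dv)_J = ∑_p (-1)^p ∂_{J p} v_{J ∖ p}`, where `J ∖ p` is the ordered tuple `J` without its
`p`-th entry; this identity is required in the sense of distributions. -/
def HasWeakExtDeriv {n k : ℕ} (Ω : Set (Eucl n)) (v : Eucl n → Forms n k)
    (w : Eucl n → Forms n (k + 1)) : Prop :=
  ∀ J ∈ incrTuples n (k + 1), ∀ ψ : Eucl n → ℝ, IsTestFun Ω ψ →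
    ∫ x in Ω, coeff w J x * ψ x =
      - ∑ p : Fin (k + 1), (-1 : ℝ) ^ (p : ℕ) *
          ∫ x in Ω, coeff v (fun q => J (p.succAbove q)) x * fderiv ℝ ψ x (stdVec (J p))

/-- `du = 0` weakly in `Ω`. -/
def WeaklyClosed {n k : ℕ} (Ω : Set (Eucl n)) (u : Eucl n → Forms n k) : Prop :=
  HasWeakExtDeriv Ω u 0

/-! ### Chains of star shaped domains -/

/-- `D` is a bounded domain that is star shaped with respect to the ball `B = B(z, r) ⊆ D`: the
convex hull of `B ∪ {y}` is contained in `D` for every `y ∈ D`. -/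
structure StarShapedBall {n : ℕ} (D : Set (Eucl n)) (z : Eucl n) (r : ℝ) : Prop where
  isOpen : IsOpen D
  isBounded : Bornology.IsBounded D
  radius_pos : 0 < r
  ball_subset : Metric.ball z r ⊆ D
  hull_subset : ∀ y ∈ D, convexHull ℝ (Metric.ball z r ∪ {y}) ⊆ D

/-- The classical partial derivative `∂^α f`, where `α` is a multiindex: the iterated derivative
of order `|α|`, evaluated at `α i` copies of `e_i` for each `i`. -/
noncomputable def multiDeriv {n : ℕ} (α : Fin n → ℕ) (f : Eucl n → ℝ) (x : Eucl n) : ℝ :=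
  iteratedFDeriv ℝ (∑ i, α i) f x (fun q => stdVec (finSigmaFinEquiv.symm q).1)

/-- The overlap of two consecutive pieces. -/
def overlap {n m : ℕ} (piece : Fin (m + 1) → Set (Eucl n)) (j : Fin m) : Set (Eucl n) :=
  piece j.castSucc ∩ piece j.succ

/-- The family of all the pieces and all the overlaps. -/
def chainDom {n m : ℕ} (piece : Fin (m + 1) → Set (Eucl n)) : Fin (m + 1) ⊕ Fin m → Set (Eucl n)
  | Sum.inl i => piece i
  | Sum.inr j => overlap piece j

/-- The number `d_i`: the smallest diameter of the overlaps of the `i`-th piece with its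
neighbours (there is one such overlap if `i` is an end of the chain, and two otherwise). -/
noncomputable def overlapDiam {n m : ℕ} (piece : Fin (m + 1) → Set (Eucl n)) (i : Fin (m + 1)) :
    ℝ :=
  sInf ((fun j : Fin m => Metric.diam (overlap piece j)) '' {j | j.castSucc = i ∨ j.succ = i})

/-- A decomposition of the contractible set `Ω` into a chain of `N = m + 1` star shaped domains
with star shaped overlaps, together with a controlled partition of unity. The balls are
`B_t = B(center t, radius t)`. -/
structure StarChain {n : ℕ} (Ω : Set (Eucl n)) (m : ℕ) where
  contractible : ContractibleSpace Ω
  piece : Fin (m + 1) → Set (Eucl n)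
  iUnion_piece : Ω = ⋃ i, piece i
  center : Fin (m + 1) ⊕ Fin m → Eucl n
  radius : Fin (m + 1) ⊕ Fin m → ℝ
  starShaped : ∀ t, StarShapedBall (chainDom piece t) (center t) (radius t)
  disjoint : ∀ i j : Fin (m + 1), (i : ℕ) + 1 < (j : ℕ) → piece i ∩ piece j = ∅
  φ : Fin (m + 1) → Eucl n → ℝ
  φ_smooth : ∀ i, ContDiffOn ℝ ∞ (φ i) Ω
  φ_mem : ∀ i, ∀ x ∈ Ω, 0 ≤ φ i x ∧ φ i x ≤ 1
  φ_zero : ∀ i, ∀ x ∈ Ω \ piece i, φ i x = 0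
  φ_sum : ∀ x ∈ Ω, ∑ i, φ i x = 1
  /-- the constants `C_{α, i}` -/
  bnd : (Fin n → ℕ) → Fin (m + 1) → ℝ
  φ_deriv : ∀ (i : Fin (m + 1)) (α : Fin n → ℕ), ∀ x ∈ Ω,
    |multiDeriv α (φ i) x| ≤ bnd α i / overlapDiam piece i ^ (∑ q, α q)

/-! ### The constants -/

/-- The factor `κ` in the estimate of the Poincaré operator in degree `ℓ` on a domain `D` that is
star shaped with respect to a ball `B`, as a function of `V = |D| / |B|`. -/
noncomputable def kappa (n ℓ : ℕ) (V : ℝ) : ℝ :=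
  if n < 2 * ℓ then 1
  else if n ≤ 2 * ℓ + 1 then
    1 + V ^ (((n : ℝ) - 2 * ℓ) / (2 * ((n : ℝ) - ℓ))) *
      Real.log V ^ ((n : ℝ) / (2 * ((n : ℝ) - ℓ)))
  else
    1 + V ^ (((n : ℝ) - 2 * ℓ) / (2 * ((n : ℝ) - ℓ))) *
      Real.log V ^ ((n : ℝ) / (2 * ((n : ℝ) - ℓ - 1)))

/-- The constant `c (diam D / diam B) κ` in the estimate of the Poincaré operator in degree `ℓ` on
a domain `D` that is star shaped with respect to the ball `B = B(z, r)`. -/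
noncomputable def starConst {n : ℕ} (c : ℝ) (ℓ : ℕ) (D : Set (Eucl n)) (z : Eucl n) (r : ℝ) : ℝ :=
  c * (Metric.diam D / Metric.diam (Metric.ball z r)) *
    kappa n ℓ (volume.real D / volume.real (Metric.ball z r))

/-- The best constant `K` in the Poincaré inequality `‖f‖_{L²(D)} ≤ K diam(D) |f|_{H¹(D)}` for
functions `f ∈ H¹(D)` with mean value zero. -/
noncomputable def poincareConst {n : ℕ} (D : Set (Eucl n)) : ℝ :=
  sInf {K : ℝ | 0 ≤ K ∧ ∀ f : Eucl n → ℝ, MemH1 D f → ∫ x in D, f x = 0 →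
    √(l2NormSq D f) ≤ K * Metric.diam D * √(h1SemiSq D f)}

namespace StarChain

variable {n m : ℕ} {Ω : Set (Eucl n)}

/-- The constant `C_𝕋` for forms of degree `ℓ`: the largest of the constants of the Poincaré
operators on the pieces and the overlaps, in the degrees `ℓ` and (if `ℓ ≥ 2`) `ℓ - 1`. -/
noncomputable def CT (S : StarChain Ω m) (c : ℝ) (ℓ : ℕ) : ℝ :=
  ⨆ t, max (starConst c ℓ (chainDom S.piece t) (S.center t) (S.radius t))
    (starConst c (max (ℓ - 1) 1) (chainDom S.piece t) (S.center t) (S.radius t))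

/-- The constant `C_P`, the largest Poincaré constant of the pieces and the overlaps. -/
noncomputable def CP (S : StarChain Ω m) : ℝ := ⨆ t, poincareConst (chainDom S.piece t)

/-- `D_𝕋`, the largest diameter of the pieces and the overlaps. -/
noncomputable def DT (S : StarChain Ω m) : ℝ := ⨆ t, Metric.diam (chainDom S.piece t)

/-- `d_𝕋`, the smallest diameter of the pieces and the overlaps. -/
noncomputable def dT (S : StarChain Ω m) : ℝ := ⨅ t, Metric.diam (chainDom S.piece t)

/-- `C_S = max {C_{α, i} : |α| ≤ 2, 1 ≤ i ≤ N - 1}` (with value `0` if `N = 1`). -/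
noncomputable def CS (S : StarChain Ω m) : ℝ :=
  ⨆ p : {α : Fin n → ℕ // ∑ q, α q ≤ 2} × Fin m, S.bnd p.1.1 p.2.castSucc

end StarChain

/-! The theorem is first proved on one star shaped domain and then globalized along the chain.

Local step. Let θ be a bump of integral one in the ball of a star shaped domain D. Averaging the
Poincaré homotopy along the segments from a to x with the weight θ(a) gives an operator R with dRu =
u for closed u. In the coordinates y = (1-t)a + tx, z = x - a, a change of variables of determinant
one, the transpose of R sends a test function ψ to the functions ∫₀¹ t^(ℓ-1) ∫ z_i θ(y - tz) ψ(y +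
(1-t)z) dz dt, which is `rayOp`. The analysis takes place on this transpose: it acts on smooth
functions, and star shapedness keeps the supports inside D. Potentials and their gradients are
recovered by the Riesz theorem (`exists_memL2_adjoint`). The homotopy formula
`hasWeakExtDeriv_of_dual` rests on an integration by parts in z and on a continuity equation: the
t-derivative of the segment density is minus the divergence of its flux.

The H¹ bound is the L² boundedness of ψ ↦ Rᵗ∂_jψ (`exists_bogovskii_estimate`). For t ≤ 1/2 the
derivative is moved to θ, and two applications of Cauchy–Schwarz bound the resulting form at time t
by a multiple of √min(t^(-n), |D|/|B|); integration against t^(ℓ-1) produces κ_ℓ. For t ≥ 1/2 the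
Fourier transform of the density factors as θ̂((1-t)ξ) ψ̂(tξ). The factor |ξ| of the derivative is
absorbed because ∫ |ξ| (1 + ρ(1-t)|ξ|)^(-2) dt ≤ 1/ρ uniformly in ξ. The same flux with exponent
zero gives the Poincaré inequality for functions.

Global step. Let V_i be local potentials of u on the pieces, with constants subtracted such that V_s
- V_(s+1) has mean zero on the s-th overlap. This difference is closed there, so it is dW_s with W_s
of mean zero. Let Φ_s = φ_1 + ... + φ_s. Then Φ_s = φ_s on the s-th overlap, and off the overlap Φ_s
is 0 or 1, extremal values, so dΦ_s = 0. The global potential is v = Σ φ_i V_i + Σ dΦ_s ∧ W_s. On an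
overlap the gluing produces dΦ_s ∧ (V_s - V_(s+1)), and the correction contributes -dΦ_s ∧ dW_s,
which cancels it. The products are extended by zero across the boundaries of pieces and overlaps by
`HasWeakGrad.extend_mul`, a truncation argument.

The norm of v is controlled by applying Poincaré to V_s - V_(s+1) and to W_s. No point lies in more
than two pieces and the overlaps are disjoint, so N does not enter. If ℓ = 1, the difference V_s -
V_(s+1) has zero gradient and zero mean, hence vanishes, and no correction is needed. -/

open scoped ENNReal

/-! ### Differentiation under the integral sign -/

section Parametric

variable {E W : Type*} [NormedAddCommGroup E] [NormedSpace ℝ E] [FiniteDimensional ℝ E]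
  [NormedAddCommGroup W] [NormedSpace ℝ W]
  [MeasurableSpace W] [BorelSpace W] {μ : Measure W}

/-- The weight `c` is merely integrable. The derivative of `F` is bounded on the product of a closed
unit ball around `y₀` with the compact set `K`, and this bound times the modulus of `c` is the
dominating function. -/
theorem hasFDerivAt_setIntegral_mul {K : Set W} (hK : IsCompact K) {c : W → ℝ}
    (hc : IntegrableOn c K μ) {F : E → W → ℝ}
    (hF : ContDiff ℝ ∞ (Function.uncurry F)) (y₀ : E) :
    (∀ e, IntegrableOn (fun w => c w * fderiv ℝ (fun y => F y w) y₀ e) K μ) ∧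
    HasFDerivAt (fun y => ∫ w in K, c w * F y w ∂μ)
      (∫ w in K, c w • fderiv ℝ (fun y => F y w) y₀ ∂μ) y₀ ∧
    ∀ e, (∫ w in K, c w • fderiv ℝ (fun y => F y w) y₀ ∂μ) e =
      ∫ w in K, c w * fderiv ℝ (fun y => F y w) y₀ e ∂μ := by
  have hfd : ∀ y w, fderiv ℝ (fun y => F y w) y =
      (fderiv ℝ (Function.uncurry F) (y, w)).comp (ContinuousLinearMap.inl ℝ E W) := by
    intro y w
    have h1 : HasFDerivAt (Function.uncurry F) (fderiv ℝ (Function.uncurry F) (y, w)) (y, w) :=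
      (hF.differentiable (by simp)).differentiableAt.hasFDerivAt
    exact (h1.comp (f := fun e => (e, w)) y (hasFDerivAt_prodMk_left y w)).fderiv
  have hcont : Continuous fun q : E × W => fderiv ℝ (fun y => F y q.2) q.1 := by
    simp only [hfd]
    exact (hF.continuous_fderiv (by simp)).clm_comp continuous_const
  have hKm : MeasurableSet K := hK.isClosed.measurableSet
  obtain ⟨C, hC⟩ := ((isCompact_closedBall y₀ 1).prod hK).exists_bound_of_continuousOn
    hcont.continuousOn
  have hmeas : ∀ y, AEStronglyMeasurable (fun w => c w • fderiv ℝ (fun y => F y w) y)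
      (μ.restrict K) := fun y =>
    hc.1.smul (hcont.comp (Continuous.prodMk_right y)).aestronglyMeasurable
  have hint : IntegrableOn (fun w => c w • fderiv ℝ (fun y => F y w) y₀) K μ := by
    refine Integrable.mono' (hc.norm.mul_const C) (hmeas y₀) ?_
    filter_upwards [ae_restrict_mem hKm] with w hw
    rw [norm_smul]
    exact mul_le_mul_of_nonneg_left (hC (y₀, w) ⟨by simp, hw⟩) (norm_nonneg _)
  refine ⟨fun e => ?_, ?_, fun e => ?_⟩
  · exact hint.apply_continuousLinearMap e
  · refine hasFDerivAt_integral_of_dominated_of_fderiv_le (s := Metric.ball y₀ 1)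
      (bound := fun w => ‖c w‖ * C) (F' := fun y w => c w • fderiv ℝ (fun y => F y w) y)
      (Metric.ball_mem_nhds y₀ one_pos) ?_ ?_ (hmeas y₀) ?_ (hc.norm.mul_const C) ?_
    · exact Filter.Eventually.of_forall fun y =>
        hc.1.mul (hF.continuous.comp (Continuous.prodMk_right y)).aestronglyMeasurable
    · exact IntegrableOn.mul_continuousOn hc
        (hF.continuous.comp (Continuous.prodMk_right y₀)).continuousOn hK
    · filter_upwards [ae_restrict_mem hKm] with w hw y hy
      rw [norm_smul]
      exact mul_le_mul_of_nonneg_left (hC (y, w) ⟨Metric.ball_subset_closedBall hy, hw⟩)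
        (norm_nonneg _)
    · filter_upwards with w y _
      have h2 : Differentiable ℝ fun y => F y w :=
        (hF.comp (contDiff_id.prodMk contDiff_const)).differentiable (by simp)
      exact h2.differentiableAt.hasFDerivAt.const_mul (c w)
  · rw [ContinuousLinearMap.integral_apply hint]
    rfl

theorem contDiff_setIntegral_mul {K : Set W} (hK : IsCompact K) {c : W → ℝ}
    (hc : IntegrableOn c K μ) {F : E → W → ℝ}
    (hF : ContDiff ℝ ∞ (Function.uncurry F)) :
    ContDiff ℝ ∞ (fun y => ∫ w in K, c w * F y w ∂μ) := by
  -- The induction is over all `F` at once, because a directional derivative of the integral is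
  -- again such an integral with another smooth `F`.
  have key : ∀ m : ℕ, ∀ F : E → W → ℝ, ContDiff ℝ ∞ (Function.uncurry F) →
      ContDiff ℝ m (fun y => ∫ w in K, c w * F y w ∂μ) := by
    intro m
    induction m with
    | zero =>
      intro F hF
      rw [Nat.cast_zero, contDiff_zero, continuous_iff_continuousAt]
      exact fun y => (hasFDerivAt_setIntegral_mul hK hc hF y).2.1.continuousAt
    | succ m ih =>
      intro F hF
      have h := hasFDerivAt_setIntegral_mul (μ := μ) hK hc hF
      push_cast
      rw [contDiff_succ_iff_fderiv_apply]
      refine ⟨fun y => (h y).2.1.differentiableAt, by simp, fun e => ?_⟩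
      have h3 : (fun y => fderiv ℝ (fun y => ∫ w in K, c w * F y w ∂μ) y e) =
          fun y => ∫ w in K, c w * fderiv ℝ (fun y => F y w) y e ∂μ := by
        ext y
        rw [(h y).2.1.fderiv, (h y).2.2]
      rw [h3]
      refine ih (fun y w => fderiv ℝ (fun y => F y w) y e) ?_
      have hfd : (Function.uncurry fun y w => fderiv ℝ (fun y => F y w) y e) =
          fun q : E × W => fderiv ℝ (Function.uncurry F) q (e, 0) := by
        ext ⟨y, w⟩
        have h1 : HasFDerivAt (Function.uncurry F) (fderiv ℝ (Function.uncurry F) (y, w)) (y, w) :=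
          (hF.differentiable (by simp)).differentiableAt.hasFDerivAt
        have := (h1.comp (f := fun e => (e, w)) y (hasFDerivAt_prodMk_left y w)).fderiv
        simp only [Function.uncurry]
        change fderiv ℝ (Function.uncurry F ∘ fun y => (y, w)) y e = _
        rw [this]
        simp
      rw [hfd]
      exact (hF.fderiv_right (m := ∞) (by simp)).clm_apply contDiff_const
  exact contDiff_infty.2 fun m => key m F hF

end Parametric

/-! ### Test functions -/

section TestFun

variable {n : ℕ} {Ω Ω' : Set (Eucl n)} {ψ : Eucl n → ℝ}

theorem IsTestFun.mono (h : IsTestFun Ω ψ) (hs : Ω ⊆ Ω') : IsTestFun Ω' ψ :=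
  ⟨h.1, h.2.1, h.2.2.trans hs⟩

theorem IsTestFun.univ (h : IsTestFun Ω ψ) : IsTestFun Set.univ ψ := h.mono (subset_univ _)

theorem IsTestFun.continuous (h : IsTestFun Ω ψ) : Continuous ψ := h.1.continuous

theorem IsTestFun.differentiable (h : IsTestFun Ω ψ) : Differentiable ℝ ψ :=
  h.1.differentiable (by simp)

theorem IsTestFun.fderiv (h : IsTestFun Ω ψ) (e : Eucl n) :
    IsTestFun Ω (fun x => fderiv ℝ ψ x e) := by
  refine ⟨(h.1.fderiv_right (m := ∞) (by simp)).clm_apply contDiff_const,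
    h.2.1.fderiv_apply ℝ e, (closure_minimal (fun x hx => ?_) (isClosed_tsupport ψ)).trans h.2.2⟩
  by_contra h0
  exact hx (by simp [image_eq_zero_of_notMem_tsupport fun h' => h0 (tsupport_fderiv_subset ℝ h')])

theorem support_fderiv_apply_subset (ψ : Eucl n → ℝ) (e : Eucl n) :
    Function.support (fun x => fderiv ℝ ψ x e) ⊆ tsupport ψ := by
  intro x hx
  by_contra h0
  exact hx (by simp [image_eq_zero_of_notMem_tsupport fun h' => h0 (tsupport_fderiv_subset ℝ h')])

theorem IsTestFun.eq_zero (h : IsTestFun Ω ψ) {x : Eucl n} (hx : x ∉ Ω) : ψ x = 0 :=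
  image_eq_zero_of_notMem_tsupport fun h' => hx (h.2.2 h')

theorem IsTestFun.memLp (h : IsTestFun Ω ψ) (p : ENNReal) (μ : Measure (Eucl n))
    [IsFiniteMeasureOnCompacts μ] : MemLp ψ p μ :=
  h.continuous.memLp_of_hasCompactSupport h.2.1

theorem IsTestFun.exists_radius (h : IsTestFun Ω ψ) :
    ∃ R : ℝ, 0 < R ∧ ∀ x ∈ tsupport ψ, ‖x‖ ≤ R := by
  obtain ⟨R, hR⟩ := h.2.1.isCompact.isBounded.exists_norm_le
  exact ⟨max R 1, by positivity, fun x hx => (hR x hx).trans (le_max_left _ _)⟩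

theorem IsTestFun.add {χ : Eucl n → ℝ} (h : IsTestFun Ω ψ) (h' : IsTestFun Ω χ) :
    IsTestFun Ω (fun x => ψ x + χ x) :=
  ⟨h.1.add h'.1, h.2.1.add h'.2.1, (tsupport_add ψ χ).trans (union_subset h.2.2 h'.2.2)⟩

theorem IsTestFun.const_mul (h : IsTestFun Ω ψ) (c : ℝ) : IsTestFun Ω (fun x => c * ψ x) :=
  ⟨contDiff_const.mul h.1, h.2.1.mul_left, (tsupport_mul_subset_right).trans h.2.2⟩

theorem IsTestFun.mul_contDiff (h : IsTestFun Ω ψ) {a : Eucl n → ℝ} (ha : ContDiff ℝ ∞ a) :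
    IsTestFun Ω (fun x => a x * ψ x) :=
  ⟨ha.mul h.1, h.2.1.mul_left, (tsupport_mul_subset_right).trans h.2.2⟩

/-- A product of a function that is smooth in the open set `Ω` and a test function. -/
theorem IsTestFun.mul_contDiffOn (h : IsTestFun Ω ψ) (hΩ : IsOpen Ω) {a : Eucl n → ℝ}
    (ha : ContDiffOn ℝ ∞ a Ω) : IsTestFun Ω (fun x => a x * ψ x) := by
  refine ⟨?_, h.2.1.mul_left, (tsupport_mul_subset_right).trans h.2.2⟩
  rw [contDiff_iff_contDiffAt]
  intro x
  by_cases hx : x ∈ tsupport ψ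
  · exact (ha.contDiffAt (hΩ.mem_nhds (h.2.2 hx))).mul h.1.contDiffAt
  · have h0 : (fun x => a x * ψ x) =ᶠ[nhds x] fun _ => 0 := by
      filter_upwards [(isClosed_tsupport ψ).isOpen_compl.mem_nhds hx] with y hy
      rw [image_eq_zero_of_notMem_tsupport hy, mul_zero]
    exact contDiffAt_const.congr_of_eventuallyEq h0

end TestFun

/-! ### Averages over the segments through a point -/

section RayInt

variable {n : ℕ}

/-- The integral of `p(z) a(y - tz) b(y + (1 - t)z)` over `z`: the segments of direction `z` for
which `y` divides the segment from `y - tz` to `y + (1 - t)z` in the ratio `t : 1 - t`. -/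
noncomputable def rayInt (p a b : Eucl n → ℝ) (t : ℝ) (y : Eucl n) : ℝ :=
  ∫ z, p z * (a (y - t • z) * b (y + (1 - t) • z))

variable {p a b : Eucl n → ℝ}

/-- The vector `z` is the difference of the two arguments, and for `t` in the unit interval `y` is a
convex combination of them, so compactness of the two supports bounds both. Quantifying over `a'`
and `b'` lets one radius serve the derivatives of `a` and `b` as well. -/
theorem exists_radius_ray (ha : IsTestFun univ a) (hb : IsTestFun univ b) :
    ∃ R : ℝ, 0 < R ∧ ∀ a' b' : Eucl n → ℝ, Function.support a' ⊆ tsupport a →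
      Function.support b' ⊆ tsupport b → ∀ (t : ℝ) (y z : Eucl n),
      a' (y - t • z) * b' (y + (1 - t) • z) ≠ 0 →
        ‖z‖ ≤ R ∧ (t ∈ Icc (0 : ℝ) 1 → ‖y‖ ≤ R) := by
  obtain ⟨R, hR, hR'⟩ := ha.exists_radius
  obtain ⟨R₁, hR₁, hR₁'⟩ := hb.exists_radius
  refine ⟨2 * max R R₁, by positivity, fun a' b' ha' hb' t y z h => ?_⟩
  have h1 : ‖y - t • z‖ ≤ max R R₁ :=
    (hR' _ (ha' (left_ne_zero_of_mul h))).trans (le_max_left _ _)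
  have h2 : ‖y + (1 - t) • z‖ ≤ max R R₁ :=
    (hR₁' _ (hb' (right_ne_zero_of_mul h))).trans (le_max_right _ _)
  refine ⟨?_, fun ht => ?_⟩
  · calc ‖z‖ = ‖(y + (1 - t) • z) - (y - t • z)‖ := by congr 1; module
      _ ≤ _ := norm_sub_le _ _
      _ ≤ 2 * max R R₁ := by linarith
  · calc ‖y‖ = ‖(1 - t) • (y - t • z) + t • (y + (1 - t) • z)‖ := by congr 1; module
      _ ≤ (1 - t) * ‖y - t • z‖ + t * ‖y + (1 - t) • z‖ := by
        refine (norm_add_le _ _).trans (le_of_eq ?_)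
        rw [norm_smul, norm_smul, Real.norm_of_nonneg ht.1,
          Real.norm_of_nonneg (sub_nonneg.2 ht.2)]
      _ ≤ (1 - t) * max R R₁ + t * max R R₁ :=
        add_le_add (mul_le_mul_of_nonneg_left h1 (sub_nonneg.2 ht.2))
          (mul_le_mul_of_nonneg_left h2 ht.1)
      _ ≤ 2 * max R R₁ := by nlinarith [le_max_left R R₁]

theorem integrable_ray (hp : Continuous p) (ha : IsTestFun univ a) (hb : IsTestFun univ b)
    (t : ℝ) (y : Eucl n) :
    Integrable fun z => p z * (a (y - t • z) * b (y + (1 - t) • z)) := by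
  obtain ⟨R, -, hR⟩ := exists_radius_ray ha hb
  refine Continuous.integrable_of_hasCompactSupport ?_ ?_
  · have := ha.continuous
    have := hb.continuous
    fun_prop
  · refine HasCompactSupport.intro (isCompact_closedBall (0 : Eucl n) R) fun z hz => ?_
    by_contra h0
    exact hz (mem_closedBall_zero_iff.2 (hR a b (subset_tsupport a) (subset_tsupport b) t y z
      (right_ne_zero_of_mul h0)).1)

theorem exists_rayInt_eq_setIntegral (ha : IsTestFun univ a) (hb : IsTestFun univ b) :
    ∃ R : ℝ, ∀ (p a' b' : Eucl n → ℝ), Function.support a' ⊆ tsupport a →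
      Function.support b' ⊆ tsupport b → ∀ (t : ℝ) (y : Eucl n), rayInt p a' b' t y =
      ∫ z in Metric.closedBall 0 R, p z * (a' (y - t • z) * b' (y + (1 - t) • z)) := by
  obtain ⟨R, -, hR⟩ := exists_radius_ray ha hb
  refine ⟨R, fun p a' b' ha' hb' t y =>
    (setIntegral_eq_integral_of_forall_compl_eq_zero fun z hz => ?_).symm⟩
  by_contra h0
  exact hz (mem_closedBall_zero_iff.2 (hR a' b' ha' hb' t y z (right_ne_zero_of_mul h0)).1)

theorem contDiff_rayInt (hp : Continuous p) (ha : IsTestFun univ a) (hb : IsTestFun univ b) :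
    ContDiff ℝ ∞ fun q : ℝ × Eucl n => rayInt p a b q.1 q.2 := by
  obtain ⟨R, hR⟩ := exists_rayInt_eq_setIntegral ha hb
  simp only [hR p a b (subset_tsupport a) (subset_tsupport b)]
  refine contDiff_setIntegral_mul (F := fun (q : ℝ × Eucl n) z =>
    a (q.2 - q.1 • z) * b (q.2 + (1 - q.1) • z)) (isCompact_closedBall _ _)
    (hp.continuousOn.integrableOn_compact (isCompact_closedBall _ _)) ?_
  have h1 := ha.1
  have h2 := hb.1
  unfold Function.uncurry
  fun_prop

theorem fderiv_rayInt (hp : Continuous p) (ha : IsTestFun univ a) (hb : IsTestFun univ b)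
    (t : ℝ) (y e : Eucl n) :
    fderiv ℝ (fun y => rayInt p a b t y) y e =
      rayInt p (fun x => fderiv ℝ a x e) b t y + rayInt p a (fun x => fderiv ℝ b x e) t y := by
  obtain ⟨R, hR⟩ := exists_rayInt_eq_setIntegral ha hb
  have hF : ContDiff ℝ ∞ (Function.uncurry fun (y : Eucl n) z =>
      a (y - t • z) * b (y + (1 - t) • z)) := by
    have h1 := ha.1
    have h2 := hb.1
    unfold Function.uncurry
    fun_prop
  have h := hasFDerivAt_setIntegral_mul (μ := volume) (isCompact_closedBall (0 : Eucl n) R)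
    (hp.continuousOn.integrableOn_compact (isCompact_closedBall _ _)) hF y
  simp only [hR p a b (subset_tsupport a) (subset_tsupport b) t]
  rw [h.2.1.fderiv, h.2.2, hR p _ b (support_fderiv_apply_subset a e) (subset_tsupport b),
    hR p a _ (subset_tsupport a) (support_fderiv_apply_subset b e), ← integral_add
    (integrable_ray hp (ha.fderiv e) hb t y).integrableOn
    (integrable_ray hp ha (hb.fderiv e) t y).integrableOn]
  refine integral_congr_ae (Filter.Eventually.of_forall fun z => ?_)
  have h1 : HasFDerivAt (fun y => a (y - t • z)) ((fderiv ℝ a (y - t • z)).comp (.id ℝ _)) y :=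
    (ha.differentiable _).hasFDerivAt.comp y ((hasFDerivAt_id y).sub_const (t • z))
  have h2 : HasFDerivAt (fun y => b (y + (1 - t) • z)) ((fderiv ℝ b (y + (1 - t) • z)).comp (.id ℝ _)) y :=
    (hb.differentiable _).hasFDerivAt.comp y ((hasFDerivAt_id y).add_const ((1 - t) • z))
  simp only [(h1.fun_mul h2).fderiv]
  simp
  ring

theorem clm_eq_sum (L : Eucl n →L[ℝ] ℝ) (z : Eucl n) : L z = ∑ k, z k * L (stdVec k) := by
  conv_lhs => rw [← (EuclideanSpace.basisFun (Fin n) ℝ).sum_repr z]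
  simp [stdVec]

/-- This is a continuity equation. With weight one, `rayInt` is the density at time `t` of a mass
that moves along straight segments with velocity `z`. The right side is minus the divergence in `y`
of the flux, whose components carry the weights `z k`. -/
theorem hasDerivAt_rayInt (ha : IsTestFun univ a) (hb : IsTestFun univ b)
    (t : ℝ) (y : Eucl n) :
    HasDerivAt (fun t => rayInt (fun _ => 1) a b t y)
      (-∑ k, (rayInt (fun z => z k) (fun x => fderiv ℝ a x (stdVec k)) b t y +
        rayInt (fun z => z k) a (fun x => fderiv ℝ b x (stdVec k)) t y)) t := by
  obtain ⟨R, hR⟩ := exists_rayInt_eq_setIntegral ha hb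
  have hF : ContDiff ℝ ∞ (Function.uncurry fun (t : ℝ) (z : Eucl n) =>
      a (y - t • z) * b (y + (1 - t) • z)) := by
    have h1 := ha.1
    have h2 := hb.1
    unfold Function.uncurry
    fun_prop
  have h := hasFDerivAt_setIntegral_mul (μ := volume) (isCompact_closedBall (0 : Eucl n) R)
    (c := fun _ => (1 : ℝ))
    (continuous_const.continuousOn.integrableOn_compact (isCompact_closedBall _ _)) hF t
  simp only [hR _ a b (subset_tsupport a) (subset_tsupport b)]
  have hk : ∀ k : Fin n, Continuous fun z : Eucl n => z k := fun k => by fun_prop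
  have h3 := h.2.1.hasDerivAt
  rw [h.2.2] at h3
  convert h3 using 1
  have hs : ∀ k : Fin n, rayInt (fun z => z k) (fun x => fderiv ℝ a x (stdVec k)) b t y +
      rayInt (fun z => z k) a (fun x => fderiv ℝ b x (stdVec k)) t y =
      ∫ z in Metric.closedBall 0 R, (z k * (fderiv ℝ a (y - t • z) (stdVec k) *
        b (y + (1 - t) • z)) + z k * (a (y - t • z) *
          fderiv ℝ b (y + (1 - t) • z) (stdVec k))) := by
    intro k
    rw [hR _ _ b (support_fderiv_apply_subset a (stdVec k)) (subset_tsupport b),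
      hR _ a _ (subset_tsupport a) (support_fderiv_apply_subset b (stdVec k))]
    exact (integral_add (integrable_ray (hk k) (ha.fderiv (stdVec k)) hb t y).integrableOn
      (integrable_ray (hk k) ha (hb.fderiv (stdVec k)) t y).integrableOn).symm
  simp only [hs]
  rw [← integral_finsetSum, ← integral_neg]
  · refine integral_congr_ae (Filter.Eventually.of_forall fun z => ?_)
    have h1 : HasDerivAt (fun t : ℝ => a (y - t • z)) (fderiv ℝ a (y - t • z) (-z)) t := by
      refine (ha.differentiable _).hasFDerivAt.comp_hasDerivAt t ?_
      simpa using ((hasDerivAt_id t).smul_const z).const_sub y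
    have h2 : HasDerivAt (fun t : ℝ => b (y + (1 - t) • z))
        (fderiv ℝ b (y + (1 - t) • z) (-z)) t := by
      refine (hb.differentiable _).hasFDerivAt.comp_hasDerivAt t ?_
      simpa using (((hasDerivAt_id t).const_sub 1).smul_const z).const_add y
    simp only [fderiv_apply_one_eq_deriv, (h1.fun_mul h2).deriv]
    rw [map_neg, map_neg, clm_eq_sum (fderiv ℝ a _) z, clm_eq_sum (fderiv ℝ b _) z]
    simp only [Finset.sum_add_distrib, ← mul_assoc, Finset.mul_sum, Finset.sum_mul, one_mul,
      neg_mul, mul_neg, neg_add]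
    congr 2
    refine Finset.sum_congr rfl fun k _ => by ring
  · intro k _
    exact ((integrable_ray (hk k) (ha.fderiv (stdVec k)) hb t y).add
      (integrable_ray (hk k) ha (hb.fderiv (stdVec k)) t y)).integrableOn

/-- Integration by parts in the direction variable of `rayInt`. -/
theorem rayInt_by_parts (hp : ContDiff ℝ ∞ p) (ha : IsTestFun univ a) (hb : IsTestFun univ b)
    (t : ℝ) (y e : Eucl n) :
    rayInt (fun z => fderiv ℝ p z e) a b t y - t * rayInt p (fun x => fderiv ℝ a x e) b t y +
      (1 - t) * rayInt p a (fun x => fderiv ℝ b x e) t y = 0 := by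
  have hp' : Continuous fun z => fderiv ℝ p z e :=
    (hp.continuous_fderiv (by simp)).clm_apply continuous_const
  have i1 := integrable_ray hp' ha hb t y
  have i2 := (integrable_ray hp.continuous (ha.fderiv e) hb t y).const_mul t
  have i3 := (integrable_ray hp.continuous ha (hb.fderiv e) t y).const_mul (1 - t)
  set h : Eucl n → ℝ := fun z => p z * (a (y - t • z) * b (y + (1 - t) • z)) with hh
  have hd : ∀ z, fderiv ℝ h z e =
      fderiv ℝ p z e * (a (y - t • z) * b (y + (1 - t) • z)) -
      t * (p z * (fderiv ℝ a (y - t • z) e * b (y + (1 - t) • z))) +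
      (1 - t) * (p z * (a (y - t • z) * fderiv ℝ b (y + (1 - t) • z) e)) := by
    intro z
    have h1 : HasFDerivAt (fun z => a (y - t • z))
        ((fderiv ℝ a (y - t • z)).comp (-(t • ContinuousLinearMap.id ℝ (Eucl n)))) z :=
      (ha.differentiable _).hasFDerivAt.comp z
        (((hasFDerivAt_id z).fun_const_smul t).const_sub y)
    have h2 : HasFDerivAt (fun z => b (y + (1 - t) • z))
        ((fderiv ℝ b (y + (1 - t) • z)).comp ((1 - t) • ContinuousLinearMap.id ℝ (Eucl n))) z :=
      (hb.differentiable _).hasFDerivAt.comp z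
        (((hasFDerivAt_id z).fun_const_smul (1 - t)).const_add y)
    have h3 := ((hp.differentiable (by simp)) z).hasFDerivAt.fun_mul (h1.fun_mul h2)
    rw [hh, h3.fderiv]
    simp
    ring
  have hint : ∫ z, fderiv ℝ h z e = 0 := by
    have := integral_mul_fderiv_eq_neg_fderiv_mul_of_integrable (μ := (volume : Measure (Eucl n)))
      (f := fun _ => (1 : ℝ)) (g := h) (v := e) (by simp) ?_ ?_ (by fun_prop) ?_
    · simpa using this
    · simp only [one_mul, hd]
      exact (i1.sub i2).add i3
    · simpa using integrable_ray hp.continuous ha hb t y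
    · have := ha.differentiable
      have := hb.differentiable
      have := hp.differentiable (by simp)
      fun_prop
  simp only [hd] at hint
  have hint' := (integral_add (i1.sub i2) i3).symm.trans hint
  rw [integral_sub' i1 i2, integral_const_mul, integral_const_mul] at hint'
  exact hint'

end RayInt

/-! ### The transposed homotopy operator: support and identities -/

section RayOp

variable {n : ℕ} {p a b : Eucl n → ℝ} {c : ℝ → ℝ} {S : Set ℝ}

/-- The superposition `∫_S c(t) rayInt p a b t y dt`. -/
noncomputable def rayOp (c : ℝ → ℝ) (S : Set ℝ) (p a b : Eucl n → ℝ) (y : Eucl n) : ℝ :=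
  ∫ t in S, c t * rayInt p a b t y

theorem continuous_rayInt (hp : Continuous p) (ha : IsTestFun univ a) (hb : IsTestFun univ b) :
    Continuous fun q : ℝ × Eucl n => rayInt p a b q.1 q.2 :=
  (contDiff_rayInt hp ha hb).continuous

theorem integrableOn_rayInt (hS : IsCompact S) (hc : IntegrableOn c S)
    (hp : Continuous p) (ha : IsTestFun univ a) (hb : IsTestFun univ b) (y : Eucl n) :
    IntegrableOn (fun t => c t * rayInt p a b t y) S :=
  hc.mul_continuousOn
    ((continuous_rayInt hp ha hb).comp (Continuous.prodMk_left y)).continuousOn hS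

theorem contDiff_rayOp (hS : IsCompact S) (hc : IntegrableOn c S)
    (hp : Continuous p) (ha : IsTestFun univ a) (hb : IsTestFun univ b) :
    ContDiff ℝ ∞ (rayOp c S p a b) :=
  contDiff_setIntegral_mul (F := fun y t => rayInt p a b t y) hS hc
    ((contDiff_rayInt hp ha hb).comp (contDiff_snd.prodMk contDiff_fst))

theorem fderiv_rayOp (hS : IsCompact S) (hc : IntegrableOn c S)
    (hp : Continuous p) (ha : IsTestFun univ a) (hb : IsTestFun univ b) (y e : Eucl n) :
    fderiv ℝ (rayOp c S p a b) y e =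
      rayOp c S p (fun x => fderiv ℝ a x e) b y + rayOp c S p a (fun x => fderiv ℝ b x e) y := by
  have h := hasFDerivAt_setIntegral_mul (F := fun y t => rayInt p a b t y) hS hc
    ((contDiff_rayInt hp ha hb).comp (contDiff_snd.prodMk contDiff_fst)) y
  have h' : rayOp c S p a b = fun y => ∫ t in S, c t * rayInt p a b t y := rfl
  rw [h', h.2.1.fderiv, h.2.2, rayOp, rayOp, ← integral_add
    (integrableOn_rayInt hS hc hp (ha.fderiv e) hb y)
    (integrableOn_rayInt hS hc hp ha (hb.fderiv e) y)]
  simp only [fderiv_rayInt hp ha hb, mul_add]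

theorem rayInt_eq_zero {t : ℝ} {y : Eucl n} (ht : t ∈ Icc (0 : ℝ) 1)
    (h : ∀ x ∈ tsupport a, ∀ x' ∈ tsupport b, y ∉ segment ℝ x x') : rayInt p a b t y = 0 := by
  refine integral_eq_zero_of_ae (Filter.Eventually.of_forall fun z => ?_)
  by_contra h0
  have h0' := right_ne_zero_of_mul h0
  refine h _ (subset_tsupport a (left_ne_zero_of_mul h0')) _
    (subset_tsupport b (right_ne_zero_of_mul h0')) ?_
  exact ⟨1 - t, t, sub_nonneg.2 ht.2, ht.1, by ring, by module⟩

/-- The support lies in the union of all segments between the two supports. This union is the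
continuous image of a compact set, hence closed. -/
theorem isTestFun_rayOp {Ω : Set (Eucl n)} (hS : IsCompact S) (hS' : S ⊆ Icc 0 1)
    (hc : IntegrableOn c S) (hp : Continuous p) (ha : IsTestFun univ a) (hb : IsTestFun univ b)
    (h : ∀ x ∈ tsupport a, ∀ x' ∈ tsupport b, segment ℝ x x' ⊆ Ω) :
    IsTestFun Ω (rayOp c S p a b) := by
  set K : Set (Eucl n) := (fun q : ℝ × Eucl n × Eucl n => (1 - q.1) • q.2.1 + q.1 • q.2.2) ''
    (Icc (0 : ℝ) 1 ×ˢ (tsupport a ×ˢ tsupport b)) with hK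
  have hKc : IsCompact K :=
    (isCompact_Icc.prod (ha.2.1.isCompact.prod hb.2.1.isCompact)).image (by fun_prop)
  have hmem : ∀ y, y ∈ K ↔ ∃ x ∈ tsupport a, ∃ x' ∈ tsupport b, y ∈ segment ℝ x x' := by
    intro y
    constructor
    · rintro ⟨⟨t, x, x'⟩, ⟨ht, hx, hx'⟩, rfl⟩
      exact ⟨x, hx, x', hx', 1 - t, t, sub_nonneg.2 ht.2, ht.1, by ring, rfl⟩
    · rintro ⟨x, hx, x', hx', s, t, hs, ht, hst, rfl⟩
      exact ⟨⟨t, x, x'⟩, ⟨⟨ht, by linarith⟩, hx, hx'⟩, by simp [← hst]⟩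
  have h0 : ∀ y, y ∉ K → rayOp c S p a b y = 0 := by
    intro y hy
    refine setIntegral_eq_zero_of_forall_eq_zero fun t ht => ?_
    rw [rayInt_eq_zero (hS' ht), mul_zero]
    exact fun x hx x' hx' hs => hy ((hmem y).2 ⟨x, hx, x', hx', hs⟩)
  refine ⟨contDiff_rayOp hS hc hp ha hb, HasCompactSupport.intro hKc h0, ?_⟩
  refine (closure_minimal (fun y hy => ?_) hKc.isClosed).trans (fun y hy => ?_ : K ⊆ Ω)
  · by_contra hy'
    exact hy (h0 y hy')
  · obtain ⟨x, hx, x', hx', hs⟩ := (hmem y).1 hy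
    exact h x hx x' hx' hs

theorem fderiv_coord (k : Fin n) (z e : Eucl n) : fderiv ℝ (fun z : Eucl n => z k) z e = e k := by
  have : (fun z : Eucl n => z k) = (EuclideanSpace.proj k : Eucl n →L[ℝ] ℝ) := rfl
  rw [this, ContinuousLinearMap.fderiv]
  rfl

theorem stdVec_apply (j k : Fin n) : (stdVec j : Eucl n) k = if k = j then 1 else 0 := by
  simp [stdVec, PiLp.single_apply]

theorem continuous_coord (k : Fin n) : Continuous fun z : Eucl n => z k := by fun_prop

theorem contDiff_coord (k : Fin n) : ContDiff ℝ ∞ fun z : Eucl n => z k := by fun_prop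

/-- Integration by parts in `z` with the weight `z k`, whose derivative is a Kronecker delta. The
factor `1 - t` stays on the left because it degenerates at `t = 1`. -/
theorem rayInt_coord_fderiv_right (ha : IsTestFun univ a) (hb : IsTestFun univ b)
    (t : ℝ) (y : Eucl n) (j k : Fin n) :
    (1 - t) * rayInt (fun z => z k) a (fun x => fderiv ℝ b x (stdVec j)) t y =
      t * rayInt (fun z => z k) (fun x => fderiv ℝ a x (stdVec j)) b t y -
        (if k = j then 1 else 0) * rayInt (fun _ => 1) a b t y := by
  have h := rayInt_by_parts (contDiff_coord k) ha hb t y (stdVec j)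
  have h1 : rayInt (fun z => fderiv ℝ (fun z : Eucl n => z k) z (stdVec j)) a b t y =
      (if k = j then 1 else 0) * rayInt (fun _ => 1) a b t y := by
    simp only [fderiv_coord, stdVec_apply, rayInt]
    rw [← integral_const_mul]
    simp
  rw [h1] at h
  linarith

/-- Adding `t` times the term with the derivative of `b` to both sides of the previous identity
removes the factor `1 - t`: on the right the derivatives of `a` and `b` then combine to a derivative
in `y`. -/
theorem rayOp_coord_fderiv_right (hS : IsCompact S) (hc : IntegrableOn c S)
    (ha : IsTestFun univ a) (hb : IsTestFun univ b) (y : Eucl n) (j k : Fin n) :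
    rayOp c S (fun z => z k) a (fun x => fderiv ℝ b x (stdVec j)) y =
      fderiv ℝ (rayOp (fun t => t * c t) S (fun z => z k) a b) y (stdVec j) -
        (if k = j then 1 else 0) * rayOp c S (fun _ => 1) a b y := by
  have hc' : IntegrableOn (fun t => t * c t) S := hc.continuousOn_mul continuousOn_id hS
  have hk := continuous_coord k
  rw [fderiv_rayOp hS hc' hk ha hb]
  simp only [rayOp]
  rw [← integral_const_mul, ← integral_add
    (integrableOn_rayInt hS hc' hk (ha.fderiv _) hb y)
    (integrableOn_rayInt hS hc' hk ha (hb.fderiv _) y), ← integral_sub]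
  · refine integral_congr_ae (Filter.Eventually.of_forall fun t => ?_)
    have := rayInt_coord_fderiv_right ha hb t y j k
    simp only
    linear_combination c t * this
  · exact (integrableOn_rayInt hS hc' hk (ha.fderiv _) hb y).add
      (integrableOn_rayInt hS hc' hk ha (hb.fderiv _) y)
  · exact (integrableOn_rayInt hS hc continuous_const ha hb y).const_mul _

theorem rayInt_zero_left (a b : Eucl n → ℝ) (y : Eucl n) :
    rayInt (fun _ => 1) a b 0 y = a y * ∫ x, b x := by
  simp [rayInt, integral_const_mul, integral_add_left_eq_self]

theorem rayInt_one_left (a b : Eucl n → ℝ) (y : Eucl n) :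
    rayInt (fun _ => 1) a b 1 y = (∫ x, a x) * b y := by
  simp [rayInt, integral_mul_const, integral_sub_left_eq_self]

/-- The continuity equation is multiplied by `t ^ l` and integrated over the unit interval. The
endpoint `t = 1` contributes the term with `b`. The endpoint `t = 0` survives only for `l = 0`,
which is recorded by `0 ^ l`; in that case the truncated exponent `l - 1` is multiplied by zero. -/
theorem sum_fderiv_rayOp (ha : IsTestFun univ a) (hb : IsTestFun univ b) (l : ℕ) (y : Eucl n) :
    ∑ k, fderiv ℝ (rayOp (fun t => t ^ l) (Icc 0 1) (fun z => z k) a b) y (stdVec k) =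
      l * rayOp (fun t => t ^ (l - 1)) (Icc 0 1) (fun _ => 1) a b y - (∫ x, a x) * b y +
        0 ^ l * (a y * ∫ x, b x) := by
  have hc : ∀ l : ℕ, IntegrableOn (fun t : ℝ => t ^ l) (Icc 0 1) := fun l =>
    (continuous_pow l).continuousOn.integrableOn_compact isCompact_Icc
  have hS : IsCompact (Icc (0 : ℝ) 1) := isCompact_Icc
  have hd : ∀ t : ℝ, HasDerivAt (fun t => t ^ l * rayInt (fun _ => 1) a b t y)
      (l * t ^ (l - 1) * rayInt (fun _ => 1) a b t y + t ^ l *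
      (-∑ k, (rayInt (fun z => z k) (fun x => fderiv ℝ a x (stdVec k)) b t y +
        rayInt (fun z => z k) a (fun x => fderiv ℝ b x (stdVec k)) t y))) t :=
    fun t => (hasDerivAt_pow l t).mul (hasDerivAt_rayInt ha hb t y)
  have hcr : ∀ {p a b : Eucl n → ℝ}, Continuous p → IsTestFun univ a → IsTestFun univ b →
      Continuous fun t => rayInt p a b t y := fun hp ha hb =>
    (continuous_rayInt hp ha hb).comp (Continuous.prodMk_left y)
  have hcr1 := hcr continuous_const ha hb (p := fun _ => 1)
  have hcr2 := fun k : Fin n => hcr (continuous_coord k) (ha.fderiv (stdVec k)) hb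
  have hcr3 := fun k : Fin n => hcr (continuous_coord k) ha (hb.fderiv (stdVec k))
  have hF := intervalIntegral.integral_eq_sub_of_hasDerivAt (a := 0) (b := 1)
    (fun t _ => hd t) (Continuous.intervalIntegrable (by fun_prop) _ _)
  rw [intervalIntegral.integral_of_le zero_le_one, ← integral_Icc_eq_integral_Ioc,
    rayInt_zero_left, rayInt_one_left, one_pow, one_mul] at hF
  have i1 : IntegrableOn (fun t => l * t ^ (l - 1) * rayInt (fun _ => 1) a b t y)
      (Icc (0 : ℝ) 1) := by
    refine Continuous.integrableOn_Icc ?_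
    fun_prop
  have i2 : IntegrableOn (fun t => t ^ l *
      (-∑ k, (rayInt (fun z => z k) (fun x => fderiv ℝ a x (stdVec k)) b t y +
        rayInt (fun z => z k) a (fun x => fderiv ℝ b x (stdVec k)) t y))) (Icc (0 : ℝ) 1) := by
    refine Continuous.integrableOn_Icc ?_
    fun_prop
  rw [integral_add i1 i2] at hF
  have e1 : ∫ t in Icc (0 : ℝ) 1, l * t ^ (l - 1) * rayInt (fun _ => 1) a b t y =
      l * rayOp (fun t => t ^ (l - 1)) (Icc 0 1) (fun _ => 1) a b y := by
    rw [rayOp, ← integral_const_mul]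
    simp only [mul_assoc]
  have e2 : ∫ t in Icc (0 : ℝ) 1, t ^ l *
      (-∑ k, (rayInt (fun z => z k) (fun x => fderiv ℝ a x (stdVec k)) b t y +
        rayInt (fun z => z k) a (fun x => fderiv ℝ b x (stdVec k)) t y)) =
      -∑ k, fderiv ℝ (rayOp (fun t => t ^ l) (Icc 0 1) (fun z => z k) a b) y (stdVec k) := by
    simp only [fun k : Fin n => fderiv_rayOp hS (hc l) (continuous_coord k) ha hb y (stdVec k),
      rayOp, mul_neg, Finset.mul_sum]
    rw [integral_neg, integral_finsetSum]
    · congr 1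
      refine Finset.sum_congr rfl fun k _ => ?_
      rw [← integral_add (integrableOn_rayInt hS (hc l) (continuous_coord k) (ha.fderiv _) hb y)
        (integrableOn_rayInt hS (hc l) (continuous_coord k) ha (hb.fderiv _) y)]
      simp only [mul_add]
    · intro k _
      refine Continuous.integrableOn_Icc ?_
      have := hcr2 k
      have := hcr3 k
      fun_prop
  rw [e1, e2] at hF
  linarith

end RayOp

/-! ### Cauchy–Schwarz inequalities with a weight -/

section CauchySchwarz

variable {X : Type*} [MeasurableSpace X] {μ : Measure X}

theorem sq_lintegral_mul_le {f g : X → ℝ≥0∞} (hf : AEMeasurable f μ) (hg : AEMeasurable g μ) :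
    (∫⁻ x, f x * g x ∂μ) ^ 2 ≤ (∫⁻ x, f x ^ 2 ∂μ) * ∫⁻ x, g x ^ 2 ∂μ := by
  have h := ENNReal.lintegral_mul_le_Lp_mul_Lq μ (p := 2) (q := 2)
    (Real.holderConjugate_iff.2 ⟨by norm_num, by norm_num⟩) hf hg
  simp only [Pi.mul_apply, ENNReal.rpow_two] at h
  calc _ ≤ ((∫⁻ x, f x ^ 2 ∂μ) ^ (1 / 2 : ℝ) * (∫⁻ x, g x ^ 2 ∂μ) ^ (1 / 2 : ℝ)) ^ 2 :=
        pow_le_pow_left' h 2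
    _ = _ := by
      rw [mul_pow, ← ENNReal.rpow_natCast, ← ENNReal.rpow_natCast, ← ENNReal.rpow_mul,
        ← ENNReal.rpow_mul]
      norm_num

theorem sq_lintegral_mul_mul_le {f g w : X → ℝ≥0∞} (hf : Measurable f) (hg : Measurable g)
    (hw : Measurable w) :
    (∫⁻ x, f x * g x * w x ∂μ) ^ 2 ≤
      (∫⁻ x, f x ^ 2 * w x ∂μ) * ∫⁻ x, g x ^ 2 * w x ∂μ := by
  have h := sq_lintegral_mul_le (μ := μ.withDensity w) hf.aemeasurable hg.aemeasurable
  have e := fun {k : X → ℝ≥0∞} (hk : Measurable k) =>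
    lintegral_withDensity_eq_lintegral_mul μ hw hk
  have e' : ∫⁻ x, f x * g x ∂μ.withDensity w = ∫⁻ x, (w * fun x => f x * g x) x ∂μ :=
    e (hf.mul hg)
  simp only [e', e (hf.pow_const 2), e (hg.pow_const 2)] at h
  simpa [mul_comm] using h

end CauchySchwarz

/-! ### Two bounds of the trilinear form on segments -/

section RayLIntegral

variable {n : ℕ}

theorem lintegral_comp_smul_Eucl (f : Eucl n → ℝ≥0∞) {c : ℝ} (hc : 0 < c) :
    ∫⁻ x, f (c • x) = ENNReal.ofReal (c ^ n)⁻¹ * ∫⁻ x, f x := by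
  have h := lintegral_map_equiv (μ := (volume : Measure (Eucl n))) f
    (Homeomorph.smulOfNeZero c hc.ne' : Eucl n ≃ₜ Eucl n).toMeasurableEquiv
  have h2 := Measure.map_addHaar_smul (volume : Measure (Eucl n)) hc.ne'
  rw [finrank_euclideanSpace_fin, abs_of_nonneg (by positivity)] at h2
  have h3 : (⇑(Homeomorph.smulOfNeZero c hc.ne' : Eucl n ≃ₜ Eucl n).toMeasurableEquiv) =
    (fun x => c • x) := rfl
  rw [h3, h2, lintegral_smul_measure] at h
  simpa using h.symm

/-- The trilinear form that corresponds to `rayInt`. -/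
noncomputable def rayForm (f α β : Eucl n → ℝ≥0∞) (t : ℝ) : ℝ≥0∞ :=
  ∫⁻ y, ∫⁻ z, f y * (α (y - t • z) * β (y + (1 - t) • z))

variable {f α β : Eucl n → ℝ≥0∞} {t : ℝ}

/-- The substitution has determinant one; it is carried out as translations in one variable at a
time. -/
theorem lintegral_shear (hα : Measurable α) (hβ : Measurable β) (t : ℝ) :
    ∫⁻ y, ∫⁻ z, α (y - t • z) * β (y + (1 - t) • z) = (∫⁻ x, α x) * ∫⁻ x, β x := by
  rw [lintegral_lintegral_swap (by fun_prop)]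
  have h1 : ∀ z : Eucl n, ∫⁻ y, α (y - t • z) * β (y + (1 - t) • z) =
      ∫⁻ y, α y * β (z + y) := by
    intro z
    rw [← lintegral_add_right_eq_self _ (t • z)]
    refine lintegral_congr fun y => ?_
    congr 2 <;> module
  simp only [h1]
  rw [lintegral_lintegral_swap (by fun_prop)]
  have h2 : ∀ y : Eucl n, ∫⁻ z, α y * β (z + y) = α y * ∫⁻ z, β z := by
    intro y
    rw [lintegral_const_mul _ (by fun_prop), lintegral_add_right_eq_self]
  simp only [h2]
  rw [lintegral_mul_const _ hα]

/-- Cauchy–Schwarz with the weight `α (y - t • z)` separates `f` from `β`. For fixed `y` the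
integral of the weight over `z` is the mass of `α` times `t ^ (-n)`; the other factor is handled by
the shear. -/
theorem rayForm_sq_le (hf : Measurable f) (hα : Measurable α) (hβ : Measurable β) (ht : 0 < t) :
    rayForm f α β t ^ 2 ≤ ENNReal.ofReal (t ^ n)⁻¹ * (∫⁻ x, α x) ^ 2 *
      ((∫⁻ x, f x ^ 2) * ∫⁻ x, β x ^ 2) := by
  have h := sq_lintegral_mul_mul_le (μ := (volume : Measure (Eucl n × Eucl n)))
    (f := fun q => f q.1) (g := fun q => β (q.1 + (1 - t) • q.2)) (w := fun q => α (q.1 - t • q.2))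
    (by fun_prop) (by fun_prop) (by fun_prop)
  have e0 : rayForm f α β t =
      ∫⁻ q : Eucl n × Eucl n, f q.1 * β (q.1 + (1 - t) • q.2) * α (q.1 - t • q.2) := by
    rw [rayForm, Measure.volume_eq_prod, lintegral_prod _ (by fun_prop)]
    refine lintegral_congr fun y => lintegral_congr fun z => ?_
    ring
  have e1 : ∫⁻ q : Eucl n × Eucl n, f q.1 ^ 2 * α (q.1 - t • q.2) =
      ENNReal.ofReal (t ^ n)⁻¹ * (∫⁻ x, α x) * ∫⁻ x, f x ^ 2 := by
    rw [Measure.volume_eq_prod, lintegral_prod _ (by fun_prop), ← lintegral_const_mul _ (by fun_prop)]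
    refine lintegral_congr fun y => ?_
    dsimp only
    rw [lintegral_const_mul _ (by fun_prop), lintegral_comp_smul_Eucl (fun z => α (y - z)) ht,
      lintegral_sub_left_eq_self]
    ring
  have e2 : ∫⁻ q : Eucl n × Eucl n, β (q.1 + (1 - t) • q.2) ^ 2 * α (q.1 - t • q.2) =
      (∫⁻ x, α x) * ∫⁻ x, β x ^ 2 := by
    rw [Measure.volume_eq_prod, lintegral_prod _ (by fun_prop),
      ← lintegral_shear hα (hβ.pow_const 2) t]
    refine lintegral_congr fun y => lintegral_congr fun z => ?_
    ring
  rw [e0]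
  refine h.trans (le_of_eq ?_)
  rw [e1, e2]
  ring

/-- Here `f` is separated from the product of `α` and `β`. The indicator of `D` makes the integral
over `z` finite. In contrast to the previous bound, this one does not blow up as `t` tends to zero.
-/
theorem rayForm_sq_le_of_support (hf : Measurable f) (hα : Measurable α) (hβ : Measurable β)
    {D : Set (Eucl n)} (hD : MeasurableSet D) (hβD : ∀ x ∉ D, β x = 0) (ht : t < 1) :
    rayForm f α β t ^ 2 ≤ ENNReal.ofReal ((1 - t) ^ n)⁻¹ * volume D * (∫⁻ x, α x ^ 2) *
      ((∫⁻ x, f x ^ 2) * ∫⁻ x, β x ^ 2) := by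
  have hm : Measurable (D.indicator (1 : Eucl n → ℝ≥0∞)) := measurable_one.indicator hD
  have h := sq_lintegral_mul_le (μ := (volume : Measure (Eucl n × Eucl n)))
    (f := fun q => f q.1 * D.indicator 1 (q.1 + (1 - t) • q.2))
    (g := fun q => α (q.1 - t • q.2) * β (q.1 + (1 - t) • q.2))
    (by fun_prop) (by fun_prop)
  have e0 : rayForm f α β t = ∫⁻ q : Eucl n × Eucl n,
      (f q.1 * D.indicator 1 (q.1 + (1 - t) • q.2)) *
        (α (q.1 - t • q.2) * β (q.1 + (1 - t) • q.2)) := by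
    rw [rayForm, Measure.volume_eq_prod, lintegral_prod _ (by fun_prop)]
    refine lintegral_congr fun y => lintegral_congr fun z => ?_
    by_cases hx : y + (1 - t) • z ∈ D
    · simp [hx]
    · simp [hβD _ hx]
  have e1 : ∫⁻ q : Eucl n × Eucl n, (f q.1 * D.indicator 1 (q.1 + (1 - t) • q.2)) ^ 2 =
      ENNReal.ofReal ((1 - t) ^ n)⁻¹ * volume D * ∫⁻ x, f x ^ 2 := by
    rw [Measure.volume_eq_prod, lintegral_prod _ (by fun_prop), ← lintegral_const_mul _ (by fun_prop)]
    refine lintegral_congr fun y => ?_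
    have h1 : ∀ x, (D.indicator (1 : Eucl n → ℝ≥0∞) x) ^ 2 = D.indicator 1 x := by
      intro x
      by_cases hx : x ∈ D <;> simp [hx]
    simp only [mul_pow, h1]
    rw [lintegral_const_mul _ (by fun_prop),
      lintegral_comp_smul_Eucl (fun z => D.indicator 1 (y + z)) (sub_pos.2 ht),
      lintegral_add_left_eq_self, lintegral_indicator_one hD]
    ring
  have e2 : ∫⁻ q : Eucl n × Eucl n, (α (q.1 - t • q.2) * β (q.1 + (1 - t) • q.2)) ^ 2 =
      (∫⁻ x, α x ^ 2) * ∫⁻ x, β x ^ 2 := by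
    rw [Measure.volume_eq_prod, lintegral_prod _ (by fun_prop),
      ← lintegral_shear (hα.pow_const 2) (hβ.pow_const 2) t]
    simp only [mul_pow]
  rw [e0]
  refine h.trans (le_of_eq ?_)
  rw [e1, e2]
  ring

end RayLIntegral

/-! ### The Fourier transform of the segment density -/

section Fourier

open scoped FourierTransform RealInnerProductSpace
open Complex (I exp)

variable {n : ℕ} {a b : Eucl n → ℝ}

/-- The Fourier transform of a real function. -/
noncomputable def realFourier (f : Eucl n → ℝ) : Eucl n → ℂ := 𝓕 (fun x => (f x : ℂ))

/-- A real test function as a complex Schwartz function. -/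
noncomputable def IsTestFun.toSchwartz {Ω : Set (Eucl n)} (ha : IsTestFun Ω a) :
    SchwartzMap (Eucl n) ℂ :=
  HasCompactSupport.toSchwartzMap (f := fun x => (a x : ℂ))
    (ha.2.1.comp_left (g := fun r : ℝ => (r : ℂ)) Complex.ofReal_zero)
    (Complex.ofRealCLM.contDiff.comp ha.1)

theorem IsTestFun.coe_fourier_toSchwartz {Ω : Set (Eucl n)} (ha : IsTestFun Ω a) :
    ((𝓕 ha.toSchwartz : SchwartzMap (Eucl n) ℂ) : Eucl n → ℂ) = realFourier a := rfl

theorem continuous_realFourier (ha : IsTestFun univ a) : Continuous (realFourier a) := by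
  rw [← ha.coe_fourier_toSchwartz]
  exact (𝓕 ha.toSchwartz : SchwartzMap (Eucl n) ℂ).continuous

theorem realFourier_eq (f : Eucl n → ℝ) (ξ : Eucl n) :
    realFourier f ξ = ∫ x, exp (((-2 * Real.pi * ⟪x, ξ⟫ : ℝ) : ℂ) * I) * (f x : ℂ) := by
  simp [realFourier, Real.fourier_eq', smul_eq_mul]

theorem realFourier_fderiv (ha : IsTestFun univ a) (e ξ : Eucl n) :
    realFourier (fun x => fderiv ℝ a x e) ξ = 2 * Real.pi * I * ⟪ξ, e⟫ * realFourier a ξ := by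
  have h : (ha.fderiv e).toSchwartz = LineDeriv.lineDerivOp e ha.toSchwartz := by
    ext x
    rw [SchwartzMap.lineDerivOp_apply_eq_fderiv]
    have h2 : HasFDerivAt (fun x => (a x : ℂ)) (Complex.ofRealCLM.comp (fderiv ℝ a x)) x :=
      Complex.ofRealCLM.hasFDerivAt.comp x (ha.differentiable x).hasFDerivAt
    change ((fderiv ℝ a x e : ℝ) : ℂ) = fderiv ℝ (fun x => (a x : ℂ)) x e
    rw [h2.fderiv]
    rfl
  rw [← (ha.fderiv e).coe_fourier_toSchwartz, h, SchwartzMap.fourier_lineDerivOp_eq,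
    ← ha.coe_fourier_toSchwartz]
  have : (inner ℝ · e : Eucl n → ℝ).HasTemperateGrowth := ((innerSL ℝ).flip e).hasTemperateGrowth
  simp [SchwartzMap.smulLeftCLM_apply_apply this]
  ring

theorem integral_mul_eq_fourier (ha : IsTestFun univ a) (hb : IsTestFun univ b) :
    ((∫ x, a x * b x : ℝ) : ℂ) =
      ∫ ξ, (starRingEnd ℂ) (realFourier a ξ) * realFourier b ξ := by
  have h := SchwartzMap.integral_inner_fourier_fourier ha.toSchwartz hb.toSchwartz
  simp only [RCLike.inner_apply', ha.coe_fourier_toSchwartz, hb.coe_fourier_toSchwartz] at h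
  rw [h, ← integral_complex_ofReal]
  refine integral_congr_ae (Filter.Eventually.of_forall fun x => ?_)
  change ((a x * b x : ℝ) : ℂ) = (starRingEnd ℂ) (a x : ℂ) * (b x : ℂ)
  simp

theorem integral_norm_sq_realFourier (ha : IsTestFun univ a) :
    ∫ ξ, ‖realFourier a ξ‖ ^ 2 = ∫ x, a x ^ 2 := by
  have h := SchwartzMap.integral_norm_sq_fourier ha.toSchwartz
  rw [ha.coe_fourier_toSchwartz] at h
  rw [h]
  refine integral_congr_ae (Filter.Eventually.of_forall fun x => ?_)
  change ‖(a x : ℂ)‖ ^ 2 = a x ^ 2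
  simp

/-- In the independent variables x = y - tz and x' = y + (1-t)z one has y = (1-t)x + tx', so the
character at `y` is the product of a character in x and a character in x'. -/
theorem realFourier_rayInt (ha : IsTestFun univ a) (hb : IsTestFun univ b) {t : ℝ}
    (ht : t ∈ Icc (0 : ℝ) 1) (ξ : Eucl n) :
    realFourier (rayInt (fun _ => 1) a b t) ξ =
      realFourier a ((1 - t) • ξ) * realFourier b (t • ξ) := by
  obtain ⟨R, hR, hR'⟩ := exists_radius_ray ha hb
  have ca := ha.continuous
  have cb := hb.continuous
  set e : Eucl n → Eucl n → ℂ := fun x ξ => exp (((-2 * Real.pi * ⟪x, ξ⟫ : ℝ) : ℂ) * I) with he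
  have hec : ∀ ξ, Continuous fun x => e x ξ := fun ξ => by
    rw [he]
    fun_prop
  have hadd : ∀ x x' ξ, e (x + x') ξ = e x ξ * e x' ξ := fun x x' ξ => by
    rw [he]
    simp only [inner_add_left, ← Complex.exp_add]
    congr 1
    push_cast
    ring
  have hsm : ∀ (s : ℝ) x ξ, e (s • x) ξ = e x (s • ξ) := fun s x ξ => by
    rw [he]
    simp only [real_inner_smul_left, real_inner_smul_right]
  have hint : ∀ (c : Eucl n → Eucl n → ℂ) (s : ℝ), s ∈ Icc (0 : ℝ) 1 →
      Continuous (Function.uncurry c) →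
      Integrable (Function.uncurry fun (y z : Eucl n) =>
        c y z * ((a (y - s • z) * b (y + (1 - s) • z) : ℝ) : ℂ)) := by
    intro c s hs hc
    refine Continuous.integrable_of_hasCompactSupport ?_ ?_
    · unfold Function.uncurry at hc ⊢
      fun_prop
    · refine HasCompactSupport.intro
        ((isCompact_closedBall (0 : Eucl n) R).prod (isCompact_closedBall (0 : Eucl n) R)) ?_
      rintro ⟨y, z⟩ hq
      by_contra h0
      have h1 : a (y - s • z) * b (y + (1 - s) • z) ≠ 0 := by
        simpa [Function.uncurry] using right_ne_zero_of_mul h0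
      have h2 := hR' a b (subset_tsupport a) (subset_tsupport b) s y z h1
      exact hq ⟨mem_closedBall_zero_iff.2 (h2.2 hs), mem_closedBall_zero_iff.2 h2.1⟩
  calc realFourier (rayInt (fun _ => 1) a b t) ξ
      = ∫ y, ∫ z, e y ξ * ((a (y - t • z) * b (y + (1 - t) • z) : ℝ) : ℂ) := by
        rw [realFourier_eq]
        refine integral_congr_ae (Filter.Eventually.of_forall fun y => ?_)
        simp only [rayInt, one_mul]
        rw [← integral_complex_ofReal, ← integral_const_mul]
    _ = ∫ z, ∫ y, e y ξ * ((a (y - t • z) * b (y + (1 - t) • z) : ℝ) : ℂ) := by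
        refine integral_integral_swap (hint (fun y _ => e y ξ) t ht ?_)
        exact (hec ξ).comp continuous_fst
    _ = ∫ z, ∫ y, e (y + t • z) ξ * ((a y * b (z + y) : ℝ) : ℂ) := by
        congr 1
        ext z
        rw [← integral_add_right_eq_self _ (t • z)]
        congr 1
        ext y
        congr 4 <;> module
    _ = ∫ y, ∫ z, e (y + t • z) ξ * ((a y * b (z + y) : ℝ) : ℂ) := by
        refine (integral_integral_swap ?_).symm
        -- The translated integrand is an instance of `hint` with `s = 0` and another phase.
        have := hint (fun y z => e (y + t • z) ξ) 0 (by simp) ?_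
        · change Integrable _ (volume : Measure (Eucl n × Eucl n))
          simpa [add_comm] using this
        · have := hec ξ
          unfold Function.uncurry
          fun_prop
    _ = ∫ y, ∫ z, (e y ((1 - t) • ξ) * (a y : ℂ)) * (e z (t • ξ) * (b z : ℂ)) := by
        congr 1
        ext y
        rw [← integral_sub_right_eq_self _ y]
        congr 1
        ext z
        rw [← hsm, ← hsm, sub_add_cancel, show y + t • (z - y) = (1 - t) • y + t • z by module,
          hadd]
        push_cast
        ring
    _ = realFourier a ((1 - t) • ξ) * realFourier b (t • ξ) := by
        simp only [realFourier_eq]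
        simp only [integral_const_mul, integral_mul_const]
        rfl

end Fourier

/-! ### The part of the operator with t in [1/2, 1] -/

section NearEstimate

open Complex (I)

variable {n : ℕ} {a b g : Eucl n → ℝ}

theorem lintegral_enorm_sq_eq_ofReal {X F : Type*} [MeasurableSpace X] [NormedAddCommGroup F]
    {μ : Measure X} {f : X → F} (hf : MemLp f 2 μ) :
    ∫⁻ x, ‖f x‖ₑ ^ 2 ∂μ = ENNReal.ofReal (∫ x, ‖f x‖ ^ 2 ∂μ) := by
  rw [ofReal_integral_eq_lintegral_ofReal (hf.integrable_norm_pow (by norm_num))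
    (Filter.Eventually.of_forall fun x => by positivity)]
  refine lintegral_congr fun x => ?_
  rw [ENNReal.ofReal_pow (norm_nonneg _), ofReal_norm]

theorem lintegral_enorm_sq_realFourier (ha : IsTestFun univ a) :
    ∫⁻ ξ, ‖realFourier a ξ‖ₑ ^ 2 = ENNReal.ofReal (∫ x, a x ^ 2) := by
  rw [lintegral_enorm_sq_eq_ofReal, integral_norm_sq_realFourier ha]
  rw [← ha.coe_fourier_toSchwartz]
  exact SchwartzMap.memLp _ _ _

theorem integral_mul_rayOp {c : ℝ → ℝ} {S : Set ℝ} {p : Eucl n → ℝ} (hS : IsCompact S)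
    (hc : IntegrableOn c S) (hp : Continuous p) (ha : IsTestFun univ a) (hb : IsTestFun univ b)
    {ν : Measure (Eucl n)} [IsFiniteMeasureOnCompacts ν] [SFinite ν]
    (hg : Integrable g ν) (hgs : HasCompactSupport g) :
    ∫ y, g y * rayOp c S p a b y ∂ν = ∫ t in S, c t * (∫ y, g y * rayInt p a b t y ∂ν) := by
  have hr := continuous_rayInt hp ha hb
  obtain ⟨C, hC⟩ := (hS.prod hgs.isCompact).exists_bound_of_continuousOn hr.continuousOn
  have hint : Integrable (Function.uncurry fun (t : ℝ) y => c t * (g y * rayInt p a b t y))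
      ((volume.restrict S).prod ν) := by
    refine Integrable.mono' ((hc.mul_prod hg).norm.const_mul C) ?_ ?_
    · exact (hc.1.comp_fst).mul ((hg.1.comp_snd).mul hr.aestronglyMeasurable)
    · have h1 : ∀ᵐ q ∂((volume.restrict S).prod ν), q.1 ∈ S :=
        Measure.ae_prod_iff_ae_ae (hS.measurableSet.preimage measurable_fst) |>.2
          ((ae_restrict_mem hS.measurableSet).mono fun t ht => Filter.Eventually.of_forall
            fun _ => ht)
      filter_upwards [h1] with q hq
      by_cases hy : q.2 ∈ tsupport g
      · have := hC q ⟨hq, hy⟩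
        simp only [Function.uncurry, norm_mul]
        nlinarith [norm_nonneg (c q.1), norm_nonneg (g q.2), mul_nonneg (norm_nonneg (c q.1))
          (norm_nonneg (g q.2))]
      · simp [Function.uncurry, image_eq_zero_of_notMem_tsupport hy]
  calc ∫ y, g y * rayOp c S p a b y ∂ν
      = ∫ y, (∫ t in S, c t * (g y * rayInt p a b t y)) ∂ν := by
        refine integral_congr_ae (Filter.Eventually.of_forall fun y => ?_)
        simp only [rayOp]
        rw [← integral_const_mul]
        congr 1
        ext t
        ring
    _ = ∫ t in S, (∫ y, c t * (g y * rayInt p a b t y) ∂ν) := (integral_integral_swap hint).symm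
    _ = _ := by simp only [integral_const_mul]

/-- The weight in the frequency domain that bounds the symbol of the near part. -/
noncomputable def nearWeight (M ρ : ℝ) (t : ℝ) (ξ : Eucl n) : ℝ :=
  ‖ξ‖ * (M / (1 + ρ * ((1 - t) * ‖ξ‖)) ^ 2)

theorem continuous_nearWeight {M ρ : ℝ} (hρ : 0 < ρ) :
    ContinuousOn (fun q : ℝ × Eucl n => nearWeight M ρ q.1 q.2) (Iic 1 ×ˢ univ) := by
  unfold nearWeight
  refine ContinuousOn.mul (by fun_prop) (ContinuousOn.div (by fun_prop) (by fun_prop) ?_)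
  rintro ⟨t, ξ⟩ ⟨ht, -⟩
  have : 0 ≤ ρ * ((1 - t) * ‖ξ‖) :=
    mul_nonneg hρ.le (mul_nonneg (sub_nonneg.2 ht) (norm_nonneg _))
  positivity

theorem nearWeight_nonneg {M ρ t : ℝ} (hM : 0 ≤ M) (ξ : Eucl n) : 0 ≤ nearWeight M ρ t ξ := by
  unfold nearWeight
  positivity

theorem measurable_nearWeight (M ρ : ℝ) :
    Measurable (fun q : ℝ × Eucl n => nearWeight M ρ q.1 q.2) := by
  unfold nearWeight
  fun_prop

/-- Dilating by `t ≥ 1/2` costs a factor two in the norm of `ξ` and only increases the other factor.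
-/
theorem nearWeight_le {M ρ t : ℝ} (hM : 0 ≤ M) (hρ : 0 < ρ) (ht : t ∈ Icc (1 / 2 : ℝ) 1)
    (ξ : Eucl n) : nearWeight M ρ t ξ ≤ 2 * nearWeight M ρ t (t • ξ) := by
  obtain ⟨h1, h2⟩ := ht
  have ht0 : 0 ≤ t := by linarith
  unfold nearWeight
  rw [norm_smul, Real.norm_of_nonneg ht0]
  have h3 : 0 ≤ ρ * ((1 - t) * (t * ‖ξ‖)) := by
    have := sub_nonneg.2 h2
    positivity
  have h4 : ρ * ((1 - t) * (t * ‖ξ‖)) ≤ ρ * ((1 - t) * ‖ξ‖) := by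
    have := sub_nonneg.2 h2
    gcongr
    nlinarith [norm_nonneg ξ]
  have h5 : M / (1 + ρ * ((1 - t) * ‖ξ‖)) ^ 2 ≤ M / (1 + ρ * ((1 - t) * (t * ‖ξ‖))) ^ 2 := by
    gcongr
  have h6 : ‖ξ‖ ≤ 2 * (t * ‖ξ‖) := by nlinarith [norm_nonneg ξ]
  calc ‖ξ‖ * (M / (1 + ρ * ((1 - t) * ‖ξ‖)) ^ 2)
      ≤ (2 * (t * ‖ξ‖)) * (M / (1 + ρ * ((1 - t) * (t * ‖ξ‖))) ^ 2) :=
        mul_le_mul h6 h5 (by positivity) (by positivity)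
    _ = _ := by ring

/-- At `t = 1` the weight grows linearly in `ξ`, but its integral over `t` is bounded uniformly in
`ξ`: the antiderivative is (M/ρ)(1 + ρ(1-t)‖ξ‖)⁻¹. This is how the derivative on the second factor
is absorbed. -/
theorem lintegral_nearWeight_le {M ρ : ℝ} (hM : 0 ≤ M) (hρ : 0 < ρ) (ξ : Eucl n) :
    ∫⁻ t in Icc (1 / 2 : ℝ) 1, ENNReal.ofReal (nearWeight M ρ t ξ) ≤ ENNReal.ofReal (M / ρ) := by
  have hcont : ContinuousOn (fun t => nearWeight M ρ t ξ) (Icc (1 / 2 : ℝ) 1) :=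
    ContinuousOn.comp (g := fun q : ℝ × Eucl n => nearWeight M ρ q.1 q.2)
      (f := fun t : ℝ => (t, ξ)) (continuous_nearWeight hρ)
      (Continuous.prodMk_left ξ).continuousOn fun t ht => ⟨ht.2, mem_univ _⟩
  rw [← ofReal_integral_eq_lintegral_ofReal (hcont.integrableOn_compact isCompact_Icc)
    (Filter.Eventually.of_forall fun t => nearWeight_nonneg hM ξ)]
  refine ENNReal.ofReal_le_ofReal ?_
  rw [integral_Icc_eq_integral_Ioc, ← intervalIntegral.integral_of_le (by norm_num)]
  have hd : ∀ t ∈ uIcc (1 / 2 : ℝ) 1, HasDerivAt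
      (fun t => M / ρ * (1 + ρ * ((1 - t) * ‖ξ‖))⁻¹) (nearWeight M ρ t ξ) t := by
    intro t ht
    rw [uIcc_of_le (by norm_num)] at ht
    have h0 : 0 ≤ ρ * ((1 - t) * ‖ξ‖) :=
      mul_nonneg hρ.le (mul_nonneg (sub_nonneg.2 ht.2) (norm_nonneg _))
    have h1 : HasDerivAt (fun t => 1 + ρ * ((1 - t) * ‖ξ‖)) (ρ * (-1 * ‖ξ‖)) t :=
      ((((hasDerivAt_id t).const_sub 1).mul_const ‖ξ‖).const_mul ρ).const_add 1
    have h2 := (h1.fun_inv (by positivity)).const_mul (M / ρ)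
    refine h2.congr_deriv ?_
    unfold nearWeight
    field_simp
  rw [intervalIntegral.integral_eq_sub_of_hasDerivAt hd
    (hcont.intervalIntegrable_of_Icc (by norm_num))]
  have h3 : 0 ≤ M / ρ := by positivity
  have h4 : 0 ≤ M / ρ * (1 + ρ * ((1 - 1 / 2) * ‖ξ‖))⁻¹ := by positivity
  simp only [sub_self, zero_mul, mul_zero, add_zero, inv_one, mul_one]
  linarith

/-- By Plancherel the pairing is moved to the frequency side, where the derivative becomes a factor
of modulus at most 2π‖ξ‖ and the decay of the transform of `a` provides the rest of the weight. -/
theorem enorm_integral_mul_rayInt_fderiv_le (ha : IsTestFun univ a) (hb : IsTestFun univ b)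
    (hg : IsTestFun univ g) {M ρ : ℝ}
    (hM : ∀ ξ, ‖realFourier a ξ‖ ≤ M / (1 + ρ * ‖ξ‖) ^ 2) {e : Eucl n} (he : ‖e‖ ≤ 1) {t : ℝ}
    (ht : t ∈ Icc (1 / 2 : ℝ) 1) :
    ‖∫ y, g y * rayInt (fun _ => 1) a (fun x => fderiv ℝ b x e) t y‖ₑ ≤
      ENNReal.ofReal (2 * Real.pi) * ∫⁻ ξ, ‖realFourier g ξ‖ₑ * ‖realFourier b (t • ξ)‖ₑ *
        ENNReal.ofReal (nearWeight M ρ t ξ) := by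
  have ht' : t ∈ Icc (0 : ℝ) 1 := ⟨by linarith [ht.1], ht.2⟩
  have hM0 : 0 ≤ M := by simpa using (norm_nonneg _).trans (hM 0)
  have hr : IsTestFun univ (rayInt (fun _ => 1) a (fun x => fderiv ℝ b x e) t) := by
    obtain ⟨R, hR, hR'⟩ := exists_radius_ray ha (hb.fderiv e)
    refine ⟨(contDiff_rayInt continuous_const ha (hb.fderiv e)).comp
      (contDiff_const.prodMk contDiff_id), ?_, subset_univ _⟩
    refine HasCompactSupport.intro (isCompact_closedBall (0 : Eucl n) R) fun y hy => ?_
    refine integral_eq_zero_of_ae (Filter.Eventually.of_forall fun z => ?_)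
    by_contra h0
    exact hy (mem_closedBall_zero_iff.2 ((hR' a _ (subset_tsupport a) (subset_tsupport _) t y z
      (right_ne_zero_of_mul h0)).2 ht'))
  have h1 := integral_mul_eq_fourier hg hr
  have h2 : ‖∫ y, g y * rayInt (fun _ => 1) a (fun x => fderiv ℝ b x e) t y‖ₑ =
      ‖((∫ y, g y * rayInt (fun _ => 1) a (fun x => fderiv ℝ b x e) t y : ℝ) : ℂ)‖ₑ := by
    rw [← ofReal_norm, ← ofReal_norm, Complex.norm_real]
  rw [h2, h1]
  refine (enorm_integral_le_lintegral_enorm _).trans ?_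
  rw [← lintegral_const_mul' _ _ (by finiteness)]
  refine lintegral_mono fun ξ => ?_
  rw [realFourier_rayInt ha (hb.fderiv e) ht', realFourier_fderiv hb]
  simp only [← ofReal_norm, norm_mul, RCLike.norm_conj, Complex.norm_I, Complex.norm_real,
    Complex.norm_ofNat, Real.norm_of_nonneg Real.pi_pos.le]
  rw [← ENNReal.ofReal_mul (norm_nonneg _), ← ENNReal.ofReal_mul (by positivity),
    ← ENNReal.ofReal_mul (by positivity)]
  refine ENNReal.ofReal_le_ofReal ?_
  have h3 : ‖inner ℝ (t • ξ) e‖ ≤ ‖ξ‖ := by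
    refine (norm_inner_le_norm _ _).trans ?_
    rw [norm_smul, Real.norm_of_nonneg ht'.1]
    calc t * ‖ξ‖ * ‖e‖ ≤ 1 * ‖ξ‖ * 1 := by
          gcongr
          exact ht.2
      _ = ‖ξ‖ := by ring
  have h4 : ‖realFourier a ((1 - t) • ξ)‖ ≤ M / (1 + ρ * ((1 - t) * ‖ξ‖)) ^ 2 := by
    have := hM ((1 - t) • ξ)
    rwa [norm_smul, Real.norm_of_nonneg (sub_nonneg.2 ht.2)] at this
  unfold nearWeight
  calc ‖realFourier g ξ‖ * (‖realFourier a ((1 - t) • ξ)‖ *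
        (2 * Real.pi * 1 * ‖inner ℝ (t • ξ) e‖ * ‖realFourier b (t • ξ)‖))
      ≤ ‖realFourier g ξ‖ * ((M / (1 + ρ * ((1 - t) * ‖ξ‖)) ^ 2) *
        (2 * Real.pi * 1 * ‖ξ‖ * ‖realFourier b (t • ξ)‖)) := by
        gcongr
    _ = _ := by ring

/-- Cauchy–Schwarz in both variables with the weight `w`. The factor with `G` uses `hK` directly.
For the factor with `B` the weight is first compared with its value at `t • ξ`, and then `t • ξ` is
substituted, at the total cost 2 · 2ⁿ. -/
theorem sq_lintegral_dilation_le {G B : Eucl n → ℝ≥0∞} (hG : Measurable G) (hB : Measurable B)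
    {w : ℝ → Eucl n → ℝ≥0∞} (hw : Measurable (Function.uncurry w)) {K : ℝ≥0∞}
    (hK : ∀ ξ, ∫⁻ t in Icc (1 / 2 : ℝ) 1, w t ξ ≤ K)
    (hle : ∀ t ∈ Icc (1 / 2 : ℝ) 1, ∀ ξ, w t ξ ≤ 2 * w t (t • ξ)) :
    (∫⁻ t in Icc (1 / 2 : ℝ) 1, ∫⁻ ξ, G ξ * B (t • ξ) * w t ξ) ^ 2 ≤
      (K * ∫⁻ ξ, G ξ ^ 2) * (2 ^ (n + 1) * K * ∫⁻ ξ, B ξ ^ 2) := by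
  have hw1 : ∀ ξ, Measurable fun t => w t ξ := fun ξ => hw.comp measurable_prodMk_right
  have hw2 : ∀ t, Measurable fun ξ => w t ξ := fun t => hw.comp measurable_prodMk_left
  have hw3 : Measurable fun q : ℝ × Eucl n => w q.1 q.2 := hw
  have h := sq_lintegral_mul_mul_le
    (μ := (volume.restrict (Icc (1 / 2 : ℝ) 1)).prod (volume : Measure (Eucl n)))
    (f := fun q => G q.2) (g := fun q => B (q.1 • q.2)) (by fun_prop) (by fun_prop) hw3
  have key : ∀ G : Eucl n → ℝ≥0∞, Measurable G →
      ∫⁻ t in Icc (1 / 2 : ℝ) 1, ∫⁻ ξ, G ξ ^ 2 * w t ξ ≤ K * ∫⁻ ξ, G ξ ^ 2 := by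
    intro G hG
    have hm : Measurable fun q : ℝ × Eucl n => G q.2 ^ 2 * w q.1 q.2 :=
      ((hG.comp measurable_snd).pow_const 2).mul hw3
    rw [lintegral_lintegral_swap hm.aemeasurable, ← lintegral_const_mul _ (hG.pow_const 2)]
    refine lintegral_mono fun ξ => ?_
    rw [lintegral_const_mul _ (hw1 ξ), mul_comm]
    exact mul_le_mul_left (hK ξ) _
  rw [lintegral_prod _ (by fun_prop), lintegral_prod _ (by fun_prop),
    lintegral_prod _ (by fun_prop)] at h
  refine h.trans (mul_le_mul' (key G hG) ?_)
  calc ∫⁻ t in Icc (1 / 2 : ℝ) 1, ∫⁻ ξ, B (t • ξ) ^ 2 * w t ξ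
      ≤ ∫⁻ t in Icc (1 / 2 : ℝ) 1, 2 ^ (n + 1) * ∫⁻ ξ, B ξ ^ 2 * w t ξ := by
        refine setLIntegral_mono' measurableSet_Icc fun t ht => ?_
        have ht0 : 0 < t := by linarith [ht.1]
        calc ∫⁻ ξ, B (t • ξ) ^ 2 * w t ξ
            ≤ ∫⁻ ξ, 2 * (B (t • ξ) ^ 2 * w t (t • ξ)) := by
              refine lintegral_mono fun ξ => ?_
              calc _ ≤ B (t • ξ) ^ 2 * (2 * w t (t • ξ)) := mul_le_mul_right (hle t ht ξ) _
                _ = _ := by ring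
          _ = 2 * (ENNReal.ofReal (t ^ n)⁻¹ * ∫⁻ ξ, B ξ ^ 2 * w t ξ) := by
              rw [lintegral_const_mul' _ _ (by finiteness),
                lintegral_comp_smul_Eucl (fun ξ => B ξ ^ 2 * w t ξ) ht0]
          _ ≤ 2 * (2 ^ n * ∫⁻ ξ, B ξ ^ 2 * w t ξ) := by
              have h7 : ENNReal.ofReal (t ^ n)⁻¹ ≤ 2 ^ n := by
                calc ENNReal.ofReal (t ^ n)⁻¹ ≤ ENNReal.ofReal (2 ^ n) := by
                      refine ENNReal.ofReal_le_ofReal ?_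
                      rw [← inv_pow]
                      refine pow_le_pow_left₀ (by positivity) ?_ n
                      rw [inv_le_comm₀ ht0 (by norm_num)]
                      linarith [ht.1]
                  _ = 2 ^ n := by
                      rw [ENNReal.ofReal_pow (by norm_num), ENNReal.ofReal_ofNat]
              exact mul_le_mul_right (mul_le_mul_left h7 _) _
          _ = _ := by ring
    _ = 2 ^ (n + 1) * ∫⁻ t in Icc (1 / 2 : ℝ) 1, ∫⁻ ξ, B ξ ^ 2 * w t ξ := by
        rw [lintegral_const_mul' _ _ (by finiteness)]
    _ ≤ _ := by
        rw [mul_assoc]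
        exact mul_le_mul_right (key B hB) _

/-- The function `W` is paired with itself. The bound of the pairing has the form w² ≤ C w ∫ b²,
where w is the squared norm of `W`, and one factor w is divided out. -/
theorem integral_rayOp_fderiv_sq_le (ha : IsTestFun univ a) (hb : IsTestFun univ b) {M ρ : ℝ}
    (hρ : 0 < ρ) (hM : ∀ ξ, ‖realFourier a ξ‖ ≤ M / (1 + ρ * ‖ξ‖) ^ 2) {c : ℝ → ℝ}
    (hc : IntegrableOn c (Icc (1 / 2) 1)) {A : ℝ} (hA : ∀ t ∈ Icc (1 / 2 : ℝ) 1, |c t| ≤ A)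
    {e : Eucl n} (he : ‖e‖ ≤ 1) :
    ∫ y, rayOp c (Icc (1 / 2) 1) (fun _ => 1) a (fun x => fderiv ℝ b x e) y ^ 2 ≤
      2 ^ (n + 1) * (A * (2 * Real.pi) * (M / ρ)) ^ 2 * ∫ x, b x ^ 2 := by
  have hM0 : 0 ≤ M := by simpa using (norm_nonneg _).trans (hM 0)
  have hA0 : 0 ≤ A := (abs_nonneg _).trans (hA 1 (by norm_num))
  set W := rayOp c (Icc (1 / 2) 1) (fun _ => 1) a (fun x => fderiv ℝ b x e) with hW
  have hWt : IsTestFun univ W := isTestFun_rayOp isCompact_Icc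
    (Icc_subset_Icc_left (by norm_num)) hc continuous_const ha (hb.fderiv e)
    fun _ _ _ _ => subset_univ _
  have h1 : ∫ y, W y ^ 2 = ∫ t in Icc (1 / 2 : ℝ) 1, c t *
      ∫ y, W y * rayInt (fun _ => 1) a (fun x => fderiv ℝ b x e) t y := by
    rw [← integral_mul_rayOp isCompact_Icc hc continuous_const ha (hb.fderiv e)
      (hWt.continuous.integrable_of_hasCompactSupport hWt.2.1) hWt.2.1]
    simp only [← hW, sq]
  have h2 : ENNReal.ofReal (∫ y, W y ^ 2) ≤ ENNReal.ofReal (A * (2 * Real.pi)) *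
      ∫⁻ t in Icc (1 / 2 : ℝ) 1, ∫⁻ ξ, ‖realFourier W ξ‖ₑ * ‖realFourier b (t • ξ)‖ₑ *
        ENNReal.ofReal (nearWeight M ρ t ξ) := by
    have h3 : ENNReal.ofReal (∫ y, W y ^ 2) = ‖∫ y, W y ^ 2‖ₑ := by
      rw [← ofReal_norm, Real.norm_of_nonneg (integral_nonneg fun y => sq_nonneg _)]
    rw [h3, h1]
    refine (enorm_integral_le_lintegral_enorm _).trans ?_
    rw [← lintegral_const_mul' _ _ (by finiteness)]
    refine setLIntegral_mono' measurableSet_Icc fun t ht => ?_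
    rw [enorm_mul, ENNReal.ofReal_mul hA0, mul_assoc]
    refine mul_le_mul' ?_ (enorm_integral_mul_rayInt_fderiv_le ha hb hWt hM he ht)
    rw [← ofReal_norm]
    exact ENNReal.ofReal_le_ofReal (hA t ht)
  have h3 := sq_lintegral_dilation_le (G := fun ξ => ‖realFourier W ξ‖ₑ)
    (B := fun ξ => ‖realFourier b ξ‖ₑ) (continuous_realFourier hWt).enorm.measurable
    (continuous_realFourier hb).enorm.measurable
    (w := fun t ξ => ENNReal.ofReal (nearWeight M ρ t ξ))
    (measurable_nearWeight M ρ).ennreal_ofReal (lintegral_nearWeight_le hM0 hρ)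
    (fun t ht ξ => by
      have := ENNReal.ofReal_le_ofReal (nearWeight_le hM0 hρ ht ξ)
      rwa [ENNReal.ofReal_mul (by norm_num), ENNReal.ofReal_ofNat] at this)
  rw [lintegral_enorm_sq_realFourier hWt, lintegral_enorm_sq_realFourier hb] at h3
  have h4 := (pow_le_pow_left' h2 2).trans_eq (mul_pow _ _ 2)
  have h5 := h4.trans (mul_le_mul_right h3 _)
  set w := ∫ y, W y ^ 2 with hw
  have hw0 : 0 ≤ w := integral_nonneg fun y => sq_nonneg _
  have hβ0 : 0 ≤ ∫ x, b x ^ 2 := integral_nonneg fun y => sq_nonneg _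
  have h6 : w ^ 2 ≤ (A * (2 * Real.pi)) ^ 2 * ((M / ρ * w) *
      (2 ^ (n + 1) * (M / ρ) * ∫ x, b x ^ 2)) := by
    have e2 : (2 : ℝ≥0∞) ^ (n + 1) = ENNReal.ofReal (2 ^ (n + 1)) := by
      rw [ENNReal.ofReal_pow (by norm_num), ENNReal.ofReal_ofNat]
    have hMρ : 0 ≤ M / ρ := by positivity
    rw [e2, ← ENNReal.ofReal_pow hw0, ← ENNReal.ofReal_pow (by positivity),
      ← ENNReal.ofReal_mul hMρ, ← ENNReal.ofReal_mul (by positivity),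
      ← ENNReal.ofReal_mul (by positivity), ← ENNReal.ofReal_mul (by positivity),
      ← ENNReal.ofReal_mul (by positivity)] at h5
    exact (ENNReal.ofReal_le_ofReal_iff (by positivity)).1 h5
  rcases hw0.eq_or_lt with h0 | h0
  · rw [← h0]
    positivity
  · refine le_of_mul_le_mul_left ?_ h0
    nlinarith [h6]

end NearEstimate

/-! ### The integral in t that produces the factor κ -/

section Kappa

theorem one_le_kappa {n l : ℕ} {V : ℝ} (hV : 1 ≤ V) : 1 ≤ kappa n l V := by
  have hl : 0 ≤ Real.log V := Real.log_nonneg hV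
  have hV0 : 0 ≤ V := by linarith
  unfold kappa
  split_ifs <;> simp <;> positivity

theorem lintegral_rpow_Ioc_le {e : ℝ} (he : -1 < e) :
    ∫⁻ t in Ioc (0 : ℝ) (1 / 2), ENNReal.ofReal (t ^ e) ≤ ENNReal.ofReal (1 / (e + 1)) := by
  have hI : IntervalIntegrable (fun t : ℝ => t ^ e) volume 0 1 :=
    intervalIntegral.intervalIntegrable_rpow' he
  rw [intervalIntegrable_iff_integrableOn_Ioc_of_le zero_le_one] at hI
  calc _ ≤ ∫⁻ t in Ioc (0 : ℝ) 1, ENNReal.ofReal (t ^ e) :=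
        lintegral_mono_set (Ioc_subset_Ioc_right (by norm_num))
    _ = ENNReal.ofReal (∫ t in Ioc (0 : ℝ) 1, t ^ e) := by
        rw [ofReal_integral_eq_lintegral_ofReal hI]
        filter_upwards [ae_restrict_mem measurableSet_Ioc] with t ht
        exact Real.rpow_nonneg ht.1.le _
    _ ≤ _ := by
        refine ENNReal.ofReal_le_ofReal ?_
        rw [← intervalIntegral.integral_of_le zero_le_one, integral_rpow (Or.inl he)]
        rw [Real.one_rpow, Real.zero_rpow (by linarith), sub_zero]

/-- The minimum is at most the geometric mean of its entries with exponents `1 - μ` and `μ`. The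
parameter `μ` trades the singularity in `t` for a power of `V`. -/
theorem pow_mul_sqrt_min_le {n l : ℕ} (hl : 1 ≤ l) {V t μ : ℝ} (hV : 1 ≤ V) (ht : 0 < t)
    (hμ : μ ∈ Icc (0 : ℝ) 1) :
    t ^ (l - 1) * √(min (t ^ n)⁻¹ V) ≤ V ^ (μ / 2) * t ^ ((l : ℝ) - 1 - (1 - μ) * n / 2) := by
  have hV0 : 0 < V := by linarith
  set m := min (t ^ n)⁻¹ V with hm
  have hm0 : 0 < m := lt_min (by positivity) hV0
  have h1 : √m = m ^ ((1 - μ) / 2) * m ^ (μ / 2) := by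
    rw [← Real.rpow_add hm0, Real.sqrt_eq_rpow]
    congr 1
    ring
  have h2 : m ^ ((1 - μ) / 2) ≤ t ^ (-((1 - μ) * n / 2)) := by
    calc m ^ ((1 - μ) / 2) ≤ ((t ^ n)⁻¹) ^ ((1 - μ) / 2) :=
          Real.rpow_le_rpow hm0.le (min_le_left _ _) (by linarith [hμ.2])
      _ = _ := by
          rw [← Real.rpow_natCast, ← Real.rpow_neg ht.le, ← Real.rpow_mul ht.le]
          congr 1
          ring
  have h3 : m ^ (μ / 2) ≤ V ^ (μ / 2) :=
    Real.rpow_le_rpow hm0.le (min_le_right _ _) (by linarith [hμ.1])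
  have h4 : t ^ (l - 1) = t ^ ((l : ℝ) - 1) := by
    rw [← Real.rpow_natCast, Nat.cast_sub hl, Nat.cast_one]
  calc t ^ (l - 1) * √m = t ^ (l - 1) * (m ^ ((1 - μ) / 2) * m ^ (μ / 2)) := by rw [h1]
    _ ≤ t ^ (l - 1) * (t ^ (-((1 - μ) * n / 2)) * V ^ (μ / 2)) := by gcongr
    _ = V ^ (μ / 2) * (t ^ ((l : ℝ) - 1) * t ^ (-((1 - μ) * n / 2))) := by rw [h4]; ring
    _ = _ := by
      rw [← Real.rpow_add ht]
      congr 2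

theorem lintegral_pow_mul_sqrt_min_le_of_exponent {n l : ℕ} (hl : 1 ≤ l) {V μ : ℝ} (hV : 1 ≤ V)
    (hμ : μ ∈ Icc (0 : ℝ) 1) (he : 0 < (l : ℝ) - (1 - μ) * n / 2) :
    ∫⁻ t in Ioc (0 : ℝ) (1 / 2), ENNReal.ofReal (t ^ (l - 1) * √(min (t ^ n)⁻¹ V)) ≤
      ENNReal.ofReal (1 / ((l : ℝ) - (1 - μ) * n / 2) * V ^ (μ / 2)) := by
  have hV0 : 0 < V := by linarith
  calc _ ≤ ∫⁻ t in Ioc (0 : ℝ) (1 / 2), ENNReal.ofReal (V ^ (μ / 2)) *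
        ENNReal.ofReal (t ^ ((l : ℝ) - 1 - (1 - μ) * n / 2)) := by
        refine setLIntegral_mono' measurableSet_Ioc fun t ht => ?_
        rw [← ENNReal.ofReal_mul (by positivity)]
        exact ENNReal.ofReal_le_ofReal (pow_mul_sqrt_min_le hl hV ht.1 hμ)
    _ ≤ ENNReal.ofReal (V ^ (μ / 2)) *
        ENNReal.ofReal (1 / ((l : ℝ) - 1 - (1 - μ) * n / 2 + 1)) := by
        rw [lintegral_const_mul' _ _ ENNReal.ofReal_ne_top]
        exact mul_le_mul_right (lintegral_rpow_Ioc_le (by linarith)) _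
    _ = _ := by
        rw [← ENNReal.ofReal_mul (by positivity), mul_comm]
        congr 3
        ring

/-- In the borderline case n = 2l the choice μ = 0 would lead to 1/t, which is not integrable. The
root of the minimum is instead bounded by 2√V / (1 + t^l √V); multiplied by t^(l-1), this has a
logarithm as antiderivative. -/
theorem lintegral_pow_mul_sqrt_min_le_log {l : ℕ} (hl : 1 ≤ l) {V : ℝ} (hV : 1 ≤ V) :
    ∫⁻ t in Ioc (0 : ℝ) (1 / 2), ENNReal.ofReal (t ^ (l - 1) * √(min (t ^ (2 * l))⁻¹ V)) ≤
      ENNReal.ofReal (2 * (1 + Real.log V)) := by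
  have hV0 : 0 < V := by linarith
  have hl0 : (0 : ℝ) < l := by exact_mod_cast hl
  have hsV : 1 ≤ √V := Real.one_le_sqrt.2 hV
  have hd : ∀ t : ℝ, 0 ≤ t → HasDerivAt (fun t : ℝ => 2 / l * Real.log (1 + t ^ l * √V))
      (2 * (t ^ (l - 1) * √V / (1 + t ^ l * √V))) t := by
    intro t ht
    have h1 : HasDerivAt (fun t : ℝ => 1 + t ^ l * √V) (l * t ^ (l - 1) * √V) t :=
      ((hasDerivAt_pow l t).mul_const _).const_add 1
    refine ((h1.log (by positivity)).const_mul (2 / l : ℝ)).congr_deriv ?_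
    field_simp
  have hcont : ContinuousOn (fun t : ℝ => 2 * (t ^ (l - 1) * √V / (1 + t ^ l * √V)))
      (Icc 0 1) := by
    refine ContinuousOn.mul (by fun_prop) (ContinuousOn.div (by fun_prop) (by fun_prop) ?_)
    intro t ht
    have := ht.1
    positivity
  calc _ ≤ ∫⁻ t in Ioc (0 : ℝ) 1,
        ENNReal.ofReal (2 * (t ^ (l - 1) * √V / (1 + t ^ l * √V))) := by
        refine (setLIntegral_mono' measurableSet_Ioc fun t ht => ?_).trans
          (lintegral_mono_set (Ioc_subset_Ioc_right (by norm_num)))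
        have ht0 := ht.1
        refine ENNReal.ofReal_le_ofReal ?_
        have h1 : √(min (t ^ (2 * l))⁻¹ V) ≤ 2 * (√V / (1 + t ^ l * √V)) := by
          have h2 : √(t ^ (2 * l))⁻¹ = (t ^ l)⁻¹ := by
            rw [mul_comm, pow_mul, ← inv_pow, Real.sqrt_sq (by positivity)]
          rcases le_total (t ^ l * √V) 1 with h | h
          · refine (Real.sqrt_le_sqrt (min_le_right _ _)).trans ?_
            rw [← mul_div_assoc, le_div_iff₀ (by positivity)]
            nlinarith
          · refine (Real.sqrt_le_sqrt (min_le_left _ _)).trans ?_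
            rw [h2, ← mul_div_assoc, le_div_iff₀ (by positivity), inv_mul_le_iff₀ (by positivity)]
            nlinarith
        calc _ ≤ t ^ (l - 1) * (2 * (√V / (1 + t ^ l * √V))) := by gcongr
          _ = _ := by ring
    _ = ENNReal.ofReal (∫ t in Ioc (0 : ℝ) 1, 2 * (t ^ (l - 1) * √V / (1 + t ^ l * √V))) := by
        rw [ofReal_integral_eq_lintegral_ofReal
          ((hcont.integrableOn_compact isCompact_Icc).mono_set Ioc_subset_Icc_self)]
        filter_upwards [ae_restrict_mem measurableSet_Ioc] with t ht
        have := ht.1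
        simp only [Pi.zero_apply]
        positivity
    _ ≤ _ := by
        refine ENNReal.ofReal_le_ofReal ?_
        rw [← intervalIntegral.integral_of_le zero_le_one,
          intervalIntegral.integral_eq_sub_of_hasDerivAt (fun t ht => hd t ?_)
            (hcont.intervalIntegrable_of_Icc zero_le_one)]
        · have h1 : Real.log (1 + √V) ≤ 1 + Real.log V := by
            calc Real.log (1 + √V) ≤ Real.log (2 * V) := by
                  refine Real.log_le_log (by positivity) ?_
                  nlinarith [Real.sq_sqrt hV0.le]
              _ = Real.log 2 + Real.log V := Real.log_mul (by norm_num) hV0.ne'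
              _ ≤ 1 + Real.log V := by
                  have := Real.log_two_lt_d9
                  linarith
          have h2 : 0 ≤ 1 + Real.log V := by
            have := Real.log_nonneg hV
            linarith
          have h3 : (2 : ℝ) / l ≤ 2 := by
            rw [div_le_iff₀ hl0]
            have : (1 : ℝ) ≤ l := by exact_mod_cast hl
            linarith
          have h4 : (0 : ℝ) ^ l = 0 := zero_pow (by omega)
          simp only [one_pow, one_mul, h4, zero_mul, add_zero, Real.log_one, mul_zero, sub_zero]
          calc 2 / l * Real.log (1 + √V) ≤ 2 / l * (1 + Real.log V) := by gcongr
            _ ≤ 2 * (1 + Real.log V) := by gcongr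
        · rw [uIcc_of_le zero_le_one] at ht
          exact ht.1

/-- For log V ≥ 1 the logarithmic factor is at least one; otherwise V ≤ e < 3 and the summand one
suffices. Hence a power of the logarithm can be inserted whatever its exponent `β ≥ 0`. -/
theorem rpow_le_mul_one_add_rpow_mul_log {V α β : ℝ} (hV : 1 ≤ V) (hα' : α ≤ 1)
    (hβ : 0 ≤ β) : V ^ α ≤ 3 * (1 + V ^ α * Real.log V ^ β) := by
  have hV0 : 0 < V := by linarith
  have hlog : 0 ≤ Real.log V := Real.log_nonneg hV
  rcases le_total 1 (Real.log V) with h | h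
  · have h1 : 1 ≤ Real.log V ^ β := Real.one_le_rpow h hβ
    have h2 : 0 ≤ V ^ α := by positivity
    nlinarith
  · have h1 : V ≤ Real.exp 1 := (Real.log_le_iff_le_exp hV0).1 h
    have h2 : V ^ α ≤ V ^ (1 : ℝ) := Real.rpow_le_rpow_of_exponent_le hV hα'
    rw [Real.rpow_one] at h2
    have h3 : 0 ≤ V ^ α * Real.log V ^ β := by positivity
    have := Real.exp_one_lt_d9
    linarith

theorem exists_lintegral_pow_mul_sqrt_min_le (n l : ℕ) (hl : 1 ≤ l) (hln : l ≤ n) :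
    ∃ C : ℝ, 0 < C ∧ ∀ V : ℝ, 1 ≤ V →
      ∫⁻ t in Ioc (0 : ℝ) (1 / 2), ENNReal.ofReal (t ^ (l - 1) * √(min (t ^ n)⁻¹ V)) ≤
        ENNReal.ofReal (C * kappa n l V) := by
  rcases lt_trichotomy n (2 * l) with h | h | h
  · have h' : (n : ℝ) < 2 * l := by exact_mod_cast h
    have he : 0 < (l : ℝ) - (1 - 0) * n / 2 := by linarith
    refine ⟨1 / ((l : ℝ) - (1 - 0) * n / 2), by positivity, fun V hV => ?_⟩
    refine (lintegral_pow_mul_sqrt_min_le_of_exponent hl hV (by simp) he).trans_eq ?_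
    simp [kappa, h]
  · refine ⟨2, by norm_num, fun V hV => ?_⟩
    subst h
    refine (lintegral_pow_mul_sqrt_min_le_log hl hV).trans_eq ?_
    have hl0 : (0 : ℝ) < l := by exact_mod_cast hl
    have e1 : ((2 * l : ℕ) : ℝ) / (2 * (((2 * l : ℕ) : ℝ) - l)) = 1 := by
      push_cast
      field_simp
      ring
    have e2 : (((2 * l : ℕ) : ℝ) - 2 * l) / (2 * (((2 * l : ℕ) : ℝ) - l)) = 0 := by
      push_cast
      simp
    rw [kappa, if_neg (by omega), if_pos (by omega), e1, e2]
    simp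
  · have h' : (2 * l : ℝ) < n := by exact_mod_cast h
    have hl0 : (0 : ℝ) < l := by exact_mod_cast hl
    have hnl : (0 : ℝ) < n - l := by linarith
    -- With this choice V^(μ/2) is exactly the power of V in κ, and the exponent of t plus one is
    -- l(n - 2l) / (2(n - l)), which is positive.
    set μ : ℝ := ((n : ℝ) - 2 * l) / (n - l) with hμdef
    have hμ : μ ∈ Icc (0 : ℝ) 1 :=
      ⟨div_nonneg (by linarith) hnl.le, (div_le_one hnl).2 (by linarith)⟩
    have he : 0 < (l : ℝ) - (1 - μ) * n / 2 := by
      have : (l : ℝ) - (1 - μ) * n / 2 = l * (n - 2 * l) / (2 * (n - l)) := by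
        rw [hμdef]
        field_simp
        ring
      rw [this]
      have : (0 : ℝ) < n - 2 * l := by linarith
      positivity
    refine ⟨1 / ((l : ℝ) - (1 - μ) * n / 2) * 3, by positivity, fun V hV => ?_⟩
    refine (lintegral_pow_mul_sqrt_min_le_of_exponent hl hV hμ he).trans
      (ENNReal.ofReal_le_ofReal ?_)
    rw [mul_assoc]
    refine mul_le_mul_of_nonneg_left ?_ (by positivity)
    have e1 : μ / 2 = ((n : ℝ) - 2 * l) / (2 * (n - l)) := by
      rw [hμdef, div_div, mul_comm (2 : ℝ) ((n : ℝ) - l)]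
    have key : ∀ β : ℝ, 0 ≤ β → V ^ (μ / 2) ≤
        3 * (1 + V ^ (((n : ℝ) - 2 * l) / (2 * (n - l))) * Real.log V ^ β) := by
      intro β hβ
      rw [← e1]
      exact rpow_le_mul_one_add_rpow_mul_log hV (by linarith [hμ.2]) hβ
    rw [kappa, if_neg (by omega)]
    split_ifs with h2
    · exact key _ (by positivity)
    · refine key _ (div_nonneg (by positivity) ?_)
      have : (2 * l + 2 : ℝ) ≤ n := by
        have : 2 * l + 2 ≤ n := by omega
        exact_mod_cast this
      nlinarith

end Kappa

/-! ### From the trilinear form to the norm of the operator -/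

section FarEstimate

variable {n : ℕ} {p a b : Eucl n → ℝ} {c : ℝ → ℝ} {S : Set ℝ}

/-- The weight `p` is replaced by its bound on the segments that contribute; what remains is the
trilinear form of the moduli. -/
theorem lintegral_mul_enorm_rayOp_le (ha : IsTestFun univ a) (hb : IsTestFun univ b)
    (hS : MeasurableSet S) (hc : Measurable c) {d : ℝ}
    (hd : ∀ t ∈ S, ∀ y z, a (y - t • z) * b (y + (1 - t) • z) ≠ 0 → |p z| ≤ d)
    {f : Eucl n → ℝ≥0∞} (hf : Measurable f) :
    ∫⁻ y, f y * ‖rayOp c S p a b y‖ₑ ≤ ENNReal.ofReal d *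
      ∫⁻ t in S, ‖c t‖ₑ * rayForm f (fun x => ‖a x‖ₑ) (fun x => ‖b x‖ₑ) t := by
  obtain ⟨α, hα, hαm⟩ : ∃ α : Eucl n → ℝ≥0∞, (fun x => ‖a x‖ₑ) = α ∧ Measurable α :=
    ⟨_, rfl, ha.continuous.enorm.measurable⟩
  obtain ⟨β, hβ, hβm⟩ : ∃ β : Eucl n → ℝ≥0∞, (fun x => ‖b x‖ₑ) = β ∧ Measurable β :=
    ⟨_, rfl, hb.continuous.enorm.measurable⟩
  obtain ⟨γ, hγ, hγm⟩ : ∃ γ : ℝ → ℝ≥0∞, (fun t => ‖c t‖ₑ) = γ ∧ Measurable γ :=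
    ⟨_, rfl, hc.enorm⟩
  have hα' : ∀ x, ‖a x‖ₑ = α x := congrFun hα
  have hβ' : ∀ x, ‖b x‖ₑ = β x := congrFun hβ
  have hγ' : ∀ t, ‖c t‖ₑ = γ t := congrFun hγ
  rw [hα, hβ]
  simp only [hγ']
  have h1 : Measurable fun q : (Eucl n × ℝ) × Eucl n =>
      f q.1.1 * (α (q.1.1 - q.1.2 • q.2) * β (q.1.1 + (1 - q.1.2) • q.2)) := by fun_prop
  have h2 : Measurable (Function.uncurry fun (y : Eucl n) (t : ℝ) => γ t *
      ∫⁻ z, f y * (α (y - t • z) * β (y + (1 - t) • z))) :=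
    (hγm.comp measurable_snd).mul h1.lintegral_prod_right'
  calc ∫⁻ y, f y * ‖rayOp c S p a b y‖ₑ
      ≤ ∫⁻ y, ENNReal.ofReal d * ∫⁻ t in S, γ t *
          ∫⁻ z, f y * (α (y - t • z) * β (y + (1 - t) • z)) := by
        refine lintegral_mono fun y => ?_
        have h3 : ∀ t ∈ S, ‖c t * rayInt p a b t y‖ₑ ≤ ENNReal.ofReal d * (γ t *
            ∫⁻ z, (α (y - t • z) * β (y + (1 - t) • z))) := by
          intro t ht
          rw [enorm_mul, mul_left_comm, hγ']
          refine mul_le_mul_right ?_ _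
          refine (enorm_integral_le_lintegral_enorm _).trans ?_
          rw [← lintegral_const_mul' _ _ ENNReal.ofReal_ne_top]
          refine lintegral_mono fun z => ?_
          rw [← hα', ← hβ', enorm_mul, ← enorm_mul (a _)]
          by_cases h0 : a (y - t • z) * b (y + (1 - t) • z) = 0
          · rw [h0]
            simp
          · refine mul_le_mul_left ?_ _
            rw [← ofReal_norm]
            exact ENNReal.ofReal_le_ofReal (hd t ht y z h0)
        have h4 : ‖rayOp c S p a b y‖ₑ ≤ ENNReal.ofReal d * ∫⁻ t in S, γ t *
            ∫⁻ z, (α (y - t • z) * β (y + (1 - t) • z)) := by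
          refine (enorm_integral_le_lintegral_enorm _).trans ?_
          rw [← lintegral_const_mul' _ _ ENNReal.ofReal_ne_top]
          exact setLIntegral_mono' hS h3
        have h6 : Measurable fun t : ℝ => ∫⁻ z, α (y - t • z) * β (y + (1 - t) • z) := by
          have : Measurable fun q : ℝ × Eucl n =>
            α (y - q.1 • q.2) * β (y + (1 - q.1) • q.2) := by fun_prop
          exact this.lintegral_prod_right'
        calc _ ≤ f y * (ENNReal.ofReal d * ∫⁻ t in S, γ t *
              ∫⁻ z, (α (y - t • z) * β (y + (1 - t) • z))) := mul_le_mul_right h4 _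
          _ = ENNReal.ofReal d * (f y * ∫⁻ t in S, γ t *
              ∫⁻ z, (α (y - t • z) * β (y + (1 - t) • z))) := by ring
          _ = _ := by
              rw [← lintegral_const_mul (f := fun t => γ t *
                ∫⁻ z, α (y - t • z) * β (y + (1 - t) • z)) _ (hγm.mul h6)]
              congr 1
              refine lintegral_congr fun t => ?_
              rw [lintegral_const_mul _ (by fun_prop)]
              ring
    _ = ENNReal.ofReal d * ∫⁻ y, ∫⁻ t in S, γ t *
          ∫⁻ z, f y * (α (y - t • z) * β (y + (1 - t) • z)) :=
        lintegral_const_mul' _ _ ENNReal.ofReal_ne_top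
    _ = _ := by
        rw [lintegral_lintegral_swap h2.aemeasurable]
        congr 1
        refine lintegral_congr fun t => ?_
        have : Measurable fun y => ∫⁻ z, f y * (α (y - t • z) * β (y + (1 - t) • z)) := by
          have : Measurable fun q : Eucl n × Eucl n =>
              f q.1 * (α (q.1 - t • q.2) * β (q.1 + (1 - t) • q.2)) := by fun_prop
          exact this.lintegral_prod_right'
        rw [lintegral_const_mul _ this]
        rfl

/-- Duality with the modulus of `W` itself as `f`, followed by division by the norm of `W`. The
hypothesis `hL` is required only almost everywhere, so that the endpoint `t = 0` can be ignored. -/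
theorem integral_rayOp_sq_le (hS : IsCompact S) (hS' : S ⊆ Icc 0 1) (hc : IntegrableOn c S)
    (hcm : Measurable c) (hp : Continuous p) (ha : IsTestFun univ a) (hb : IsTestFun univ b)
    {d : ℝ} (hd0 : 0 ≤ d)
    (hd : ∀ t ∈ S, ∀ y z, a (y - t • z) * b (y + (1 - t) • z) ≠ 0 → |p z| ≤ d)
    {L : ℝ → ℝ≥0∞}
    (hL : ∀ᵐ t ∂volume.restrict S, ∀ f : Eucl n → ℝ≥0∞, Measurable f →
      rayForm f (fun x => ‖a x‖ₑ) (fun x => ‖b x‖ₑ) t ≤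
        L t * ((∫⁻ x, f x ^ 2) * ∫⁻ x, ‖b x‖ₑ ^ 2) ^ (1 / 2 : ℝ))
    {A : ℝ} (hA0 : 0 ≤ A) (hA : ∫⁻ t in S, ‖c t‖ₑ * L t ≤ ENNReal.ofReal A) :
    ∫ y, rayOp c S p a b y ^ 2 ≤ (d * A) ^ 2 * ∫ x, b x ^ 2 := by
  set W := rayOp c S p a b with hW
  have hWt : IsTestFun univ W := isTestFun_rayOp hS hS' hc hp ha hb fun _ _ _ _ => subset_univ _
  have hWm : Measurable fun y => ‖W y‖ₑ := hWt.continuous.enorm.measurable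
  have sqe : ∀ {g : Eucl n → ℝ}, IsTestFun univ g →
      ∫⁻ x, ‖g x‖ₑ ^ 2 = ENNReal.ofReal (∫ x, g x ^ 2) := by
    intro g hg
    rw [lintegral_enorm_sq_eq_ofReal (hg.memLp 2 _)]
    simp
  set w := ∫ y, W y ^ 2 with hw
  set q := ∫ x, b x ^ 2 with hq
  have hw0 : 0 ≤ w := integral_nonneg fun y => sq_nonneg _
  have hq0 : 0 ≤ q := integral_nonneg fun y => sq_nonneg _
  have h1 := lintegral_mul_enorm_rayOp_le (p := p) ha hb hS.measurableSet hcm hd hWm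
  have h2 : ENNReal.ofReal w ≤ ENNReal.ofReal (d * A * √(w * q)) := by
    calc ENNReal.ofReal w = ∫⁻ y, ‖W y‖ₑ * ‖rayOp c S p a b y‖ₑ := by
          rw [← sqe hWt]
          exact lintegral_congr fun y => by rw [sq]
      _ ≤ _ := h1
      _ ≤ ENNReal.ofReal d * ∫⁻ t in S, ENNReal.ofReal (√(w * q)) * (‖c t‖ₑ * L t) := by
          refine mul_le_mul_right (lintegral_mono_ae ?_) _
          filter_upwards [hL] with t ht
          have h3 := ht _ hWm
          rw [sqe hWt, sqe hb, ← ENNReal.ofReal_mul hw0, ENNReal.ofReal_rpow_of_nonneg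
            (mul_nonneg hw0 hq0) (by norm_num), ← Real.sqrt_eq_rpow] at h3
          calc _ ≤ ‖c t‖ₑ * (L t * ENNReal.ofReal √(w * q)) := mul_le_mul_right h3 _
            _ = _ := by ring
      _ ≤ ENNReal.ofReal d * (ENNReal.ofReal (√(w * q)) * ENNReal.ofReal A) := by
          rw [lintegral_const_mul' _ _ ENNReal.ofReal_ne_top]
          exact mul_le_mul_right (mul_le_mul_right hA _) _
      _ = _ := by
          rw [← ENNReal.ofReal_mul (Real.sqrt_nonneg _), ← ENNReal.ofReal_mul hd0]
          congr 1
          ring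
  have h3 : w ≤ d * A * √(w * q) := (ENNReal.ofReal_le_ofReal_iff (by positivity)).1 h2
  rcases hw0.eq_or_lt with h0 | h0
  · rw [← h0]
    positivity
  · have h4 : w ^ 2 ≤ (d * A) ^ 2 * (w * q) := by
      calc w ^ 2 ≤ (d * A * √(w * q)) ^ 2 := pow_le_pow_left₀ hw0 h3 2
        _ = _ := by rw [mul_pow, Real.sq_sqrt (mul_nonneg hw0 hq0)]
    refine le_of_mul_le_mul_left ?_ h0
    nlinarith [h4]

end FarEstimate

/-! ### Dilated bumps and their norms -/

section Bump

variable {n : ℕ}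

/-- The function `f` transported from the unit ball to the ball `B(z, ρ)`. -/
noncomputable def dilate (f : Eucl n → ℝ) (z : Eucl n) (ρ : ℝ) (x : Eucl n) : ℝ := f (ρ⁻¹ • (x - z))

variable {f : Eucl n → ℝ} {z : Eucl n} {ρ : ℝ}

theorem isTestFun_dilate (hf : IsTestFun (Metric.ball 0 1) f) (hρ : 0 < ρ) :
    IsTestFun (Metric.ball z ρ) (dilate f z ρ) := by
  have hcl : IsClosed {x : Eucl n | ρ⁻¹ • (x - z) ∈ tsupport f} :=
    (isClosed_tsupport f).preimage (by fun_prop)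
  have hsub : {x : Eucl n | ρ⁻¹ • (x - z) ∈ tsupport f} ⊆ Metric.ball z ρ := by
    intro x hx
    have := hf.2.2 hx
    rw [mem_ball_zero_iff, norm_smul, norm_inv, Real.norm_of_nonneg hρ.le,
      inv_mul_lt_iff₀ hρ, mul_one] at this
    rwa [mem_ball_iff_norm]
  have hs : tsupport (dilate f z ρ) ⊆ {x : Eucl n | ρ⁻¹ • (x - z) ∈ tsupport f} :=
    closure_minimal (fun x hx => subset_tsupport f hx) hcl
  refine ⟨?_, ?_, hs.trans hsub⟩
  · have := hf.1
    unfold dilate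
    fun_prop
  · exact HasCompactSupport.of_support_subset_isCompact (isCompact_closedBall z ρ)
      ((subset_tsupport _).trans (hs.trans (hsub.trans Metric.ball_subset_closedBall)))

theorem fderiv_dilate (hf : Differentiable ℝ f) (x e : Eucl n) :
    fderiv ℝ (dilate f z ρ) x e = ρ⁻¹ * dilate (fun x => fderiv ℝ f x e) z ρ x := by
  have h : HasFDerivAt (dilate f z ρ)
      ((fderiv ℝ f (ρ⁻¹ • (x - z))).comp (ρ⁻¹ • ContinuousLinearMap.id ℝ (Eucl n))) x :=
    (hf _).hasFDerivAt.comp x (((hasFDerivAt_id x).sub_const z).fun_const_smul ρ⁻¹)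
  rw [h.fderiv]
  simp [dilate]

theorem lintegral_dilate (F : Eucl n → ℝ≥0∞) (hρ : 0 < ρ) :
    ∫⁻ x, F (ρ⁻¹ • (x - z)) = ENNReal.ofReal (ρ ^ n) * ∫⁻ x, F x := by
  rw [lintegral_sub_right_eq_self (fun x => F (ρ⁻¹ • x)), lintegral_comp_smul_Eucl _ (by positivity)]
  simp

theorem integral_dilate {F : Type*} [NormedAddCommGroup F] [NormedSpace ℝ F] (g : Eucl n → F)
    (hρ : 0 < ρ) : ∫ x, g (ρ⁻¹ • (x - z)) = ρ ^ n • ∫ x, g x := by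
  rw [integral_sub_right_eq_self (fun x => g (ρ⁻¹ • x)),
    Measure.integral_comp_smul_of_nonneg _ _ _ (hR := by positivity)]
  simp

theorem norm_realFourier_dilate (hρ : 0 < ρ) (ξ : Eucl n) :
    ‖realFourier (dilate f z ρ) ξ‖ = ρ ^ n * ‖realFourier f (ρ • ξ)‖ := by
  have h : realFourier (dilate f z ρ) ξ =
      Complex.exp (((-2 * Real.pi * inner ℝ z ξ : ℝ) : ℂ) * Complex.I) *
        (ρ ^ n • realFourier f (ρ • ξ)) := by
    rw [realFourier_eq, realFourier_eq, ← integral_dilate (z := z) _ hρ, ← integral_const_mul]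
    refine integral_congr_ae (Filter.Eventually.of_forall fun x => ?_)
    simp only [dilate]
    rw [← mul_assoc, ← Complex.exp_add, ← add_mul, ← Complex.ofReal_add]
    congr 5
    rw [real_inner_smul_left, real_inner_smul_right, inner_sub_left]
    field_simp
    ring
  rw [h, norm_mul, Complex.norm_exp_ofReal_mul_I, one_mul, norm_smul,
    Real.norm_of_nonneg (by positivity)]

theorem exists_norm_realFourier_le {Ω : Set (Eucl n)} (hf : IsTestFun Ω f) :
    ∃ C : ℝ, 0 < C ∧ ∀ ξ, ‖realFourier f ξ‖ ≤ C / (1 + ‖ξ‖) ^ 2 := by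
  obtain ⟨C0, h0, hC0⟩ := (FourierTransform.fourier hf.toSchwartz).decay 0 0
  obtain ⟨C2, h2, hC2⟩ := (FourierTransform.fourier hf.toSchwartz).decay 2 0
  rw [hf.coe_fourier_toSchwartz] at hC0 hC2
  refine ⟨2 * (C0 + C2), by positivity, fun ξ => ?_⟩
  have h3 := hC0 ξ
  have h4 := hC2 ξ
  rw [norm_iteratedFDeriv_zero] at h3 h4
  rw [le_div_iff₀ (by positivity)]
  nlinarith [norm_nonneg (realFourier f ξ), mul_nonneg (norm_nonneg (realFourier f ξ))
    (sq_nonneg (‖ξ‖ - 1))]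

end Bump

section ScaledBump

variable {n : ℕ}

/-- A normalized smooth bump in the ball `B(z, ρ)` with the natural bounds, up to the factor `C`. -/
structure IsScaledBump (C : ℝ) (z : Eucl n) (ρ : ℝ) (θ : Eucl n → ℝ) : Prop where
  isTestFun : IsTestFun (Metric.ball z ρ) θ
  integral_eq : ∫ x, θ x = 1
  l1 : ∫⁻ x, ‖θ x‖ₑ ≤ ENNReal.ofReal C
  l2 : ∫⁻ x, ‖θ x‖ₑ ^ 2 ≤ ENNReal.ofReal (C * (ρ ^ n)⁻¹)
  l1_fderiv : ∀ j, ∫⁻ x, ‖fderiv ℝ θ x (stdVec j)‖ₑ ≤ ENNReal.ofReal (C * ρ⁻¹)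
  l2_fderiv : ∀ j, ∫⁻ x, ‖fderiv ℝ θ x (stdVec j)‖ₑ ^ 2 ≤
    ENNReal.ofReal (C * ((ρ ^ n)⁻¹ * ρ⁻¹ ^ 2))
  fourier : ∀ ξ, ‖realFourier θ ξ‖ ≤ C / (1 + ρ * ‖ξ‖) ^ 2
  fourier_mul : ∀ k ξ, ‖realFourier (fun x => (x - z) k * θ x) ξ‖ ≤ C * ρ / (1 + ρ * ‖ξ‖) ^ 2

theorem realFourier_const_mul (s : ℝ) (f : Eucl n → ℝ) (ξ : Eucl n) :
    realFourier (fun x => s * f x) ξ = s * realFourier f ξ := by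
  rw [realFourier_eq, realFourier_eq, ← integral_const_mul]
  congr 1
  ext x
  push_cast
  ring

theorem exists_dilate_bounds {f : Eucl n → ℝ} (hf : IsTestFun univ f) :
    ∃ C : ℝ, 0 < C ∧ ∀ (z : Eucl n) (ρ s : ℝ), 0 < ρ →
      ∫⁻ x, ‖s * dilate f z ρ x‖ₑ ≤ ENNReal.ofReal (C * (|s| * ρ ^ n)) ∧
      ∫⁻ x, ‖s * dilate f z ρ x‖ₑ ^ 2 ≤ ENNReal.ofReal (C * (s ^ 2 * ρ ^ n)) ∧
      ∀ ξ, ‖realFourier (fun x => s * dilate f z ρ x) ξ‖ ≤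
        C * (|s| * ρ ^ n) / (1 + ρ * ‖ξ‖) ^ 2 := by
  obtain ⟨C, hC, hC'⟩ := exists_norm_realFourier_le hf
  have h1 : ∫⁻ x, ‖f x‖ₑ = ENNReal.ofReal (∫ x, ‖f x‖) :=
    (ofReal_integral_norm_eq_lintegral_enorm
      (hf.continuous.integrable_of_hasCompactSupport hf.2.1)).symm
  have h2 : ∫⁻ x, ‖f x‖ₑ ^ 2 = ENNReal.ofReal (∫ x, ‖f x‖ ^ 2) :=
    lintegral_enorm_sq_eq_ofReal (hf.memLp 2 _)
  have i1 : 0 ≤ ∫ x, ‖f x‖ := integral_nonneg fun x => norm_nonneg _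
  have i2 : 0 ≤ ∫ x, ‖f x‖ ^ 2 := integral_nonneg fun x => by positivity
  refine ⟨C + (∫ x, ‖f x‖) + ∫ x, ‖f x‖ ^ 2, by positivity, fun z ρ s hρ => ⟨?_, ?_, ?_⟩⟩
  · simp only [enorm_mul, dilate]
    rw [lintegral_const_mul' _ _ enorm_ne_top, lintegral_dilate (fun x => ‖f x‖ₑ) hρ, h1,
      ← ofReal_norm, Real.norm_eq_abs, ← ENNReal.ofReal_mul (by positivity),
      ← ENNReal.ofReal_mul (by positivity)]
    refine ENNReal.ofReal_le_ofReal ?_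
    have : 0 ≤ |s| * ρ ^ n := by positivity
    nlinarith
  · simp only [enorm_mul, dilate, mul_pow]
    rw [lintegral_const_mul' _ _ (by finiteness), lintegral_dilate (fun x => ‖f x‖ₑ ^ 2) hρ, h2,
      ← ofReal_norm, Real.norm_eq_abs, ← ENNReal.ofReal_pow (abs_nonneg _), sq_abs,
      ← ENNReal.ofReal_mul (by positivity), ← ENNReal.ofReal_mul (by positivity)]
    refine ENNReal.ofReal_le_ofReal ?_
    have : 0 ≤ s ^ 2 * ρ ^ n := by positivity
    nlinarith
  · intro ξ
    rw [realFourier_const_mul, norm_mul, norm_realFourier_dilate hρ, Complex.norm_real,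
      Real.norm_eq_abs]
    have h3 := hC' (ρ • ξ)
    rw [norm_smul, Real.norm_of_nonneg hρ.le] at h3
    have h4 : C / (1 + ρ * ‖ξ‖) ^ 2 ≤
        (C + (∫ x, ‖f x‖) + ∫ x, ‖f x‖ ^ 2) / (1 + ρ * ‖ξ‖) ^ 2 := by
      gcongr
      linarith
    calc |s| * (ρ ^ n * ‖realFourier f (ρ • ξ)‖)
        ≤ |s| * (ρ ^ n * ((C + (∫ x, ‖f x‖) + ∫ x, ‖f x‖ ^ 2) / (1 + ρ * ‖ξ‖) ^ 2)) := by
          gcongr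
          exact h3.trans h4
      _ = _ := by ring

theorem exists_unit_bump (n : ℕ) :
    ∃ θ : Eucl n → ℝ, IsTestFun (Metric.ball 0 1) θ ∧ ∫ x, θ x = 1 := by
  let B : ContDiffBump (0 : Eucl n) := ⟨1 / 4, 1 / 2, by norm_num, by norm_num⟩
  refine ⟨B.normed volume, ⟨B.contDiff_normed, B.hasCompactSupport_normed, ?_⟩, B.integral_normed⟩
  rw [B.tsupport_normed_eq]
  exact Metric.closedBall_subset_ball (by norm_num [B])

/-- A single bump in the unit ball is dilated and divided by ρⁿ. The constant collects the finitely
many profiles that occur: the bump, its partial derivatives and its products with the coordinates.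
-/
theorem exists_isScaledBump (n : ℕ) :
    ∃ C : ℝ, 0 < C ∧ ∀ (z : Eucl n) (ρ : ℝ), 0 < ρ → ∃ θ, IsScaledBump C z ρ θ := by
  obtain ⟨θ, hθ, hθ1⟩ := exists_unit_bump n
  obtain ⟨C0, hC0, hC0'⟩ := exists_dilate_bounds hθ.univ
  choose C1 hC1 hC1' using fun j : Fin n => exists_dilate_bounds (hθ.fderiv (stdVec j)).univ
  choose C2 hC2 hC2' using fun k : Fin n =>
    exists_dilate_bounds (hθ.mul_contDiff (contDiff_coord k)).univ
  set C := C0 + (∑ j, C1 j) + ∑ k, C2 k with hC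
  have s1 : 0 ≤ ∑ j, C1 j := Finset.sum_nonneg fun j _ => (hC1 j).le
  have s2 : 0 ≤ ∑ j, C2 j := Finset.sum_nonneg fun j _ => (hC2 j).le
  have l0 : C0 ≤ C := by linarith
  have l1 : ∀ j, C1 j ≤ C := fun j => by
    have := Finset.single_le_sum (f := C1) (fun j _ => (hC1 j).le) (Finset.mem_univ j)
    linarith
  have l2 : ∀ j, C2 j ≤ C := fun j => by
    have := Finset.single_le_sum (f := C2) (fun j _ => (hC2 j).le) (Finset.mem_univ j)
    linarith
  refine ⟨C, by positivity, fun z ρ hρ => ⟨fun x => (ρ ^ n)⁻¹ * dilate θ z ρ x, ?_⟩⟩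
  have hρn : (ρ ^ n)⁻¹ * ρ ^ n = 1 := inv_mul_cancel₀ (by positivity)
  have e1 : ∀ (j : Fin n) x, fderiv ℝ (fun x => (ρ ^ n)⁻¹ * dilate θ z ρ x) x (stdVec j) =
      ((ρ ^ n)⁻¹ * ρ⁻¹) * dilate (fun x => fderiv ℝ θ x (stdVec j)) z ρ x := by
    intro j x
    rw [fderiv_const_mul (isTestFun_dilate hθ hρ).differentiable.differentiableAt]
    simp only [_root_.smul_apply, smul_eq_mul, fderiv_dilate hθ.differentiable]
    ring
  have e2 : ∀ k : Fin n, (fun x => (x - z) k * ((ρ ^ n)⁻¹ * dilate θ z ρ x)) =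
      fun x => ((ρ ^ n)⁻¹ * ρ) * dilate (fun x => x k * θ x) z ρ x := by
    intro k
    ext x
    simp only [dilate, PiLp.smul_apply, smul_eq_mul]
    field_simp
  have a0 : |(ρ ^ n)⁻¹| * ρ ^ n = 1 := by rw [abs_of_pos (by positivity), hρn]
  have a1 : |(ρ ^ n)⁻¹ * ρ⁻¹| * ρ ^ n = ρ⁻¹ := by
    rw [abs_of_pos (by positivity), mul_right_comm, hρn, one_mul]
  have a2 : |(ρ ^ n)⁻¹ * ρ| * ρ ^ n = ρ := by
    rw [abs_of_pos (by positivity), mul_right_comm, hρn, one_mul]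
  have b0 : ((ρ ^ n)⁻¹) ^ 2 * ρ ^ n = (ρ ^ n)⁻¹ := by
    rw [sq, mul_assoc, hρn, mul_one]
  have b1 : ((ρ ^ n)⁻¹ * ρ⁻¹) ^ 2 * ρ ^ n = (ρ ^ n)⁻¹ * ρ⁻¹ ^ 2 := by
    rw [mul_pow, mul_right_comm, b0]
  refine ⟨(isTestFun_dilate hθ hρ).const_mul _, ?_, ?_, ?_, fun j => ?_, fun j => ?_, fun ξ => ?_,
    fun k ξ => ?_⟩
  · rw [integral_const_mul]
    simp only [dilate]
    rw [integral_dilate θ hρ, hθ1, smul_eq_mul, mul_one, hρn]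
  · refine (hC0' z ρ (ρ ^ n)⁻¹ hρ).1.trans (ENNReal.ofReal_le_ofReal ?_)
    rw [a0, mul_one]
    exact l0
  · refine (hC0' z ρ (ρ ^ n)⁻¹ hρ).2.1.trans (ENNReal.ofReal_le_ofReal ?_)
    rw [b0]
    gcongr
  · simp only [e1]
    refine (hC1' j z ρ _ hρ).1.trans (ENNReal.ofReal_le_ofReal ?_)
    rw [a1]
    gcongr
    exact l1 j
  · simp only [e1]
    refine (hC1' j z ρ _ hρ).2.1.trans (ENNReal.ofReal_le_ofReal ?_)
    rw [b1]
    gcongr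
    exact l1 j
  · refine ((hC0' z ρ (ρ ^ n)⁻¹ hρ).2.2 ξ).trans ?_
    rw [a0, mul_one]
    gcongr
  · rw [e2]
    refine ((hC2' k z ρ _ hρ).2.2 ξ).trans ?_
    rw [a2]
    gcongr
    exact l2 k

end ScaledBump

/-! ### Geometry of star shaped domains -/

section StarGeometry

variable {n : ℕ} {D : Set (Eucl n)} {z : Eucl n} {ρ : ℝ}

theorem StarShapedBall.segment_subset (h : StarShapedBall D z ρ) {x y : Eucl n}
    (hx : x ∈ Metric.ball z ρ) (hy : y ∈ D) : segment ℝ x y ⊆ D :=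
  (segment_subset_convexHull (by simp [hx]) (by simp)).trans (h.hull_subset y hy)

/-- Two points on a coordinate axis through the centre have distance `ρ`. In dimension zero the
diameter would be zero. -/
theorem radius_le_diam_ball (hn : 1 ≤ n) (z : Eucl n) (hρ : 0 < ρ) :
    ρ ≤ Metric.diam (Metric.ball z ρ) := by
  obtain ⟨j⟩ : Nonempty (Fin n) := ⟨⟨0, hn⟩⟩
  have hv : ‖(stdVec j : Eucl n)‖ = 1 := by simp [stdVec]
  have key : ∀ s : ℝ, |s| < ρ → z + s • stdVec j ∈ Metric.ball z ρ := by
    intro s hs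
    rw [mem_ball_iff_norm, add_sub_cancel_left, norm_smul, hv, mul_one]
    exact hs
  have h := Metric.dist_le_diam_of_mem Metric.isBounded_ball
    (key (ρ / 2) (by rw [abs_of_pos] <;> linarith))
    (key (-(ρ / 2)) (by rw [abs_neg, abs_of_pos] <;> linarith))
  have h2 : dist (z + (ρ / 2) • (stdVec j : Eucl n)) (z + (-(ρ / 2)) • stdVec j) = ρ := by
    rw [dist_eq_norm, show (z + (ρ / 2) • (stdVec j : Eucl n)) - (z + (-(ρ / 2)) • stdVec j) =
      ρ • stdVec j by module, norm_smul, hv, mul_one, Real.norm_of_nonneg hρ.le]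
  linarith

theorem StarShapedBall.diam_ball_le (h : StarShapedBall D z ρ) :
    Metric.diam (Metric.ball z ρ) ≤ Metric.diam D :=
  Metric.diam_mono h.ball_subset h.isBounded

theorem StarShapedBall.measurableSet (h : StarShapedBall D z ρ) : MeasurableSet D :=
  h.isOpen.measurableSet

theorem StarShapedBall.volume_lt_top (h : StarShapedBall D z ρ) : volume D < ⊤ :=
  h.isBounded.measure_lt_top

theorem volume_real_ball (z : Eucl n) (hρ : 0 < ρ) :
    volume.real (Metric.ball z ρ) = ρ ^ n * volume.real (Metric.ball (0 : Eucl n) 1) := by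
  have h := Measure.addHaar_ball_of_pos (volume : Measure (Eucl n)) z hρ
  rw [finrank_euclideanSpace_fin] at h
  simp [Measure.real, h, hρ.le]

theorem volume_real_ball_pos (z : Eucl n) (hρ : 0 < ρ) : 0 < volume.real (Metric.ball z ρ) :=
  ENNReal.toReal_pos (Metric.measure_ball_pos _ _ hρ).ne' measure_ball_lt_top.ne

theorem StarShapedBall.one_le_ratio (h : StarShapedBall D z ρ) :
    1 ≤ volume.real D / volume.real (Metric.ball z ρ) := by
  rw [le_div_iff₀ (volume_real_ball_pos z h.radius_pos), one_mul]
  exact measureReal_mono h.ball_subset h.volume_lt_top.ne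

theorem StarShapedBall.le_starConst (hn : 1 ≤ n) (h : StarShapedBall D z ρ) {c : ℝ} (hc : 0 ≤ c)
    (l : ℕ) : c ≤ starConst c l D z ρ := by
  have h1 := radius_le_diam_ball hn z h.radius_pos
  have h2 : 0 < Metric.diam (Metric.ball z ρ) := h.radius_pos.trans_le h1
  have h3 : 1 ≤ Metric.diam D / Metric.diam (Metric.ball z ρ) :=
    (one_le_div h2).2 h.diam_ball_le
  have h4 := one_le_kappa (n := n) (l := l) h.one_le_ratio
  unfold starConst
  have h5 : 1 ≤ Metric.diam D / Metric.diam (Metric.ball z ρ) *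
      kappa n l (volume.real D / volume.real (Metric.ball z ρ)) := one_le_mul_of_one_le_of_one_le h3 h4
  nlinarith

theorem norm_apply_le (k : Fin n) (x : Eucl n) : |x k| ≤ ‖x‖ := PiLp.norm_apply_le x k

/-- Segments that contribute to `rayInt` are not longer than the diameter of the domain. -/
theorem StarShapedBall.abs_coord_le (h : StarShapedBall D z ρ) {a b : Eucl n → ℝ}
    (ha : Function.support a ⊆ Metric.ball z ρ) (hb : IsTestFun D b) (k : Fin n) (t : ℝ)
    (y w : Eucl n) (h0 : a (y - t • w) * b (y + (1 - t) • w) ≠ 0) : |w k| ≤ Metric.diam D := by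
  have h1 : y - t • w ∈ D := h.ball_subset (ha (left_ne_zero_of_mul h0))
  have h2 : y + (1 - t) • w ∈ D := by
    by_contra h'
    exact right_ne_zero_of_mul h0 (hb.eq_zero h')
  calc |w k| ≤ ‖w‖ := norm_apply_le k w
    _ = dist (y + (1 - t) • w) (y - t • w) := by
      rw [dist_eq_norm]
      congr 1
      module
    _ ≤ _ := Metric.dist_le_diam_of_mem h.isBounded h2 h1

end StarGeometry

/-! ### The L² estimate of the transposed operator with a derivative -/

section BogovskiiEstimate

variable {n : ℕ} {D : Set (Eucl n)} {z : Eucl n} {ρ : ℝ} {a b f : Eucl n → ℝ}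

theorem le_mul_rpow_half_of_sq_le {X Y : ℝ≥0∞} {r : ℝ} (hr : 0 ≤ r)
    (h : X ^ 2 ≤ ENNReal.ofReal r * Y) : X ≤ ENNReal.ofReal (√r) * Y ^ (1 / 2 : ℝ) := by
  have h1 : X = (X ^ 2) ^ (1 / 2 : ℝ) := by
    rw [← ENNReal.rpow_natCast, ← ENNReal.rpow_mul]
    norm_num
  rw [h1]
  refine (ENNReal.rpow_le_rpow h (by norm_num)).trans_eq ?_
  rw [ENNReal.mul_rpow_of_nonneg _ _ (by norm_num), ENNReal.ofReal_rpow_of_nonneg hr (by norm_num),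
    Real.sqrt_eq_rpow]

/-- Both bounds of the trilinear form hold, so their minimum does. On the range of `t` considered,
the factor (1-t)^(-n) is at most the 2ⁿ contained in `h2`. -/
theorem rayForm_le_sqrt_min {f α β : Eucl n → ℝ≥0∞} (hf : Measurable f) (hα : Measurable α)
    (hβ : Measurable β) (hD : MeasurableSet D) (hβD : ∀ x ∉ D, β x = 0) {K V : ℝ} (hK : 0 ≤ K)
    (hV : 0 ≤ V) (h1 : ∫⁻ x, α x ≤ ENNReal.ofReal K)
    (h2 : 2 ^ n * volume D * ∫⁻ x, α x ^ 2 ≤ ENNReal.ofReal (K ^ 2 * V)) {t : ℝ}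
    (ht : t ∈ Ioc (0 : ℝ) (1 / 2)) :
    rayForm f α β t ≤ ENNReal.ofReal (K * √(min (t ^ n)⁻¹ V)) *
      ((∫⁻ x, f x ^ 2) * ∫⁻ x, β x ^ 2) ^ (1 / 2 : ℝ) := by
  have ht0 := ht.1
  have hm : 0 ≤ min (t ^ n)⁻¹ V := le_min (by positivity) hV
  have h3 : K * √(min (t ^ n)⁻¹ V) = √(K ^ 2 * min (t ^ n)⁻¹ V) := by
    rw [Real.sqrt_mul (sq_nonneg K), Real.sqrt_sq hK]
  rw [h3]
  refine le_mul_rpow_half_of_sq_le (by positivity) ?_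
  rcases min_choice (t ^ n)⁻¹ V with hc | hc
  · rw [hc]
    refine (rayForm_sq_le hf hα hβ ht0).trans (mul_le_mul_left ?_ _)
    calc _ ≤ ENNReal.ofReal (t ^ n)⁻¹ * (ENNReal.ofReal K) ^ 2 := by gcongr
      _ = _ := by
        rw [← ENNReal.ofReal_pow hK, ← ENNReal.ofReal_mul (by positivity), mul_comm]
  · rw [hc]
    refine (rayForm_sq_le_of_support hf hα hβ hD hβD (by linarith [ht.2])).trans
      (mul_le_mul_left (le_trans ?_ h2) _)
    have h4 : ENNReal.ofReal ((1 - t) ^ n)⁻¹ ≤ 2 ^ n := by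
      have h5 : (1 / 2 : ℝ) ≤ 1 - t := by linarith [ht.2]
      calc _ ≤ ENNReal.ofReal (2 ^ n) := by
            refine ENNReal.ofReal_le_ofReal ?_
            rw [← inv_pow]
            refine pow_le_pow_left₀ (by simp; linarith) ?_ n
            rw [inv_le_comm₀ (by linarith) (by norm_num)]
            linarith
        _ = 2 ^ n := by rw [ENNReal.ofReal_pow (by norm_num), ENNReal.ofReal_ofNat]
    gcongr

theorem rayForm_le_of_half_le {f α β : Eucl n → ℝ≥0∞} (hf : Measurable f) (hα : Measurable α)
    (hβ : Measurable β) {K : ℝ} (hK : 0 ≤ K) (h1 : ∫⁻ x, α x ≤ ENNReal.ofReal K) {t : ℝ}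
    (ht : t ∈ Icc (1 / 2 : ℝ) 1) :
    rayForm f α β t ≤ ENNReal.ofReal (√(2 ^ n * K ^ 2)) *
      ((∫⁻ x, f x ^ 2) * ∫⁻ x, β x ^ 2) ^ (1 / 2 : ℝ) := by
  have ht0 : 0 < t := by linarith [ht.1]
  refine le_mul_rpow_half_of_sq_le (by positivity) ?_
  refine (rayForm_sq_le hf hα hβ ht0).trans (mul_le_mul_left ?_ _)
  rw [ENNReal.ofReal_mul (by positivity), ENNReal.ofReal_pow hK]
  gcongr
  rw [← inv_pow]
  gcongr
  rw [inv_le_comm₀ ht0 (by norm_num)]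
  linarith [ht.1]

end BogovskiiEstimate

section BogovskiiEstimate

variable {n l : ℕ} {D : Set (Eucl n)} {z : Eucl n} {ρ : ℝ} {a p θ ψ : Eucl n → ℝ}

/-- In its uses the left endpoint is 0. There, for n ≥ 1, the weight `(t ^ n)⁻¹` has the default
value zero and bounds nothing, so the endpoint is discarded as a null set. -/
theorem ae_restrict_Icc_of_Ioc {P : ℝ → Prop} {x y : ℝ} (h : ∀ t ∈ Ioc x y, P t) :
    ∀ᵐ t ∂volume.restrict (Icc x y), P t := by
  rw [← Measure.restrict_congr_set (Ioc_ae_eq_Icc (μ := volume))]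
  filter_upwards [ae_restrict_mem measurableSet_Ioc] with t ht using h t ht

theorem StarShapedBall.integral_rayOp_far_sq_le (h : StarShapedBall D z ρ) (hp : Continuous p)
    (ha : IsTestFun univ a) (hψ : IsTestFun D ψ) {d : ℝ} (hd0 : 0 ≤ d)
    (hd : ∀ (t : ℝ) (y w : Eucl n), a (y - t • w) * ψ (y + (1 - t) • w) ≠ 0 → |p w| ≤ d)
    {K V : ℝ} (hK : 0 ≤ K) (hV : 0 ≤ V) (h1 : ∫⁻ x, ‖a x‖ₑ ≤ ENNReal.ofReal K)
    (h2 : 2 ^ n * volume D * ∫⁻ x, ‖a x‖ₑ ^ 2 ≤ ENNReal.ofReal (K ^ 2 * V))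
    {c : ℝ → ℝ} (hc : ContinuousOn c (Icc 0 (1 / 2))) (hcm : Measurable c)
    (hcl : ∀ t ∈ Icc (0 : ℝ) (1 / 2), |c t| ≤ 2 * t ^ (l - 1)) {A : ℝ} (hA0 : 0 ≤ A)
    (hA : ∫⁻ t in Ioc (0 : ℝ) (1 / 2), ENNReal.ofReal (t ^ (l - 1) * √(min (t ^ n)⁻¹ V)) ≤
      ENNReal.ofReal A) :
    ∫ y, rayOp c (Icc 0 (1 / 2)) p a ψ y ^ 2 ≤ (d * (2 * K * A)) ^ 2 * ∫ x, ψ x ^ 2 := by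
  refine integral_rayOp_sq_le isCompact_Icc (Icc_subset_Icc_right (by norm_num))
    (hc.integrableOn_compact isCompact_Icc) hcm hp ha hψ.univ hd0 (fun t _ => hd t)
    (L := fun t => ENNReal.ofReal (K * √(min (t ^ n)⁻¹ V)))
    (ae_restrict_Icc_of_Ioc fun t ht f hf => ?_) (by positivity) ?_
  · exact rayForm_le_sqrt_min hf ha.continuous.enorm.measurable hψ.continuous.enorm.measurable
      h.measurableSet (fun x hx => by simp [hψ.eq_zero hx]) hK hV h1 h2 ht
  · rw [← setLIntegral_congr (Ioc_ae_eq_Icc (μ := volume))]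
    calc _ ≤ ∫⁻ t in Ioc (0 : ℝ) (1 / 2), ENNReal.ofReal (2 * K) *
          ENNReal.ofReal (t ^ (l - 1) * √(min (t ^ n)⁻¹ V)) := by
          refine setLIntegral_mono' measurableSet_Ioc fun t ht => ?_
          rw [← ofReal_norm, Real.norm_eq_abs, ← ENNReal.ofReal_mul (abs_nonneg _),
            ← ENNReal.ofReal_mul (by positivity)]
          refine ENNReal.ofReal_le_ofReal ?_
          calc |c t| * (K * √(min (t ^ n)⁻¹ V))
              ≤ (2 * t ^ (l - 1)) * (K * √(min (t ^ n)⁻¹ V)) := by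
                gcongr
                exact hcl t (Ioc_subset_Icc_self ht)
            _ = _ := by ring
      _ ≤ ENNReal.ofReal (2 * K) * ENNReal.ofReal A := by
          rw [lintegral_const_mul' _ _ ENNReal.ofReal_ne_top]
          exact mul_le_mul_right hA _
      _ = _ := by rw [← ENNReal.ofReal_mul (by positivity)]

theorem continuousOn_pow_div (m : ℕ) :
    ContinuousOn (fun t : ℝ => t ^ m / (1 - t)) (Icc 0 (1 / 2)) := by
  refine ContinuousOn.div (by fun_prop) (by fun_prop) fun t ht => ?_
  linarith [ht.2]

theorem abs_pow_div_le {m k : ℕ} (hkm : k ≤ m) {t : ℝ} (ht : t ∈ Icc (0 : ℝ) (1 / 2)) :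
    |t ^ m / (1 - t)| ≤ 2 * t ^ k := by
  have h0 : 0 < 1 - t := by linarith [ht.2]
  have h1 : 0 ≤ t ^ m / (1 - t) := div_nonneg (pow_nonneg ht.1 _) h0.le
  rw [abs_of_nonneg h1, div_le_iff₀ h0]
  have h2 : t ^ m ≤ t ^ k := pow_le_pow_of_le_one ht.1 (by linarith [ht.2]) hkm
  have h3 : 0 ≤ t ^ k := pow_nonneg ht.1 _
  nlinarith [ht.2]

/-- For `t ≤ 1/2` division by `1 - t` is harmless, so the derivative can be moved entirely from `ψ`
to the bump. -/
theorem rayOp_far_eq (ha : IsTestFun univ a) (hψ : IsTestFun univ ψ) (hl : 1 ≤ l) (y : Eucl n)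
    (j k : Fin n) :
    rayOp (fun t => t ^ (l - 1)) (Icc 0 (1 / 2)) (fun w => w k) a
        (fun x => fderiv ℝ ψ x (stdVec j)) y =
      rayOp (fun t => t ^ l / (1 - t)) (Icc 0 (1 / 2)) (fun w => w k)
        (fun x => fderiv ℝ a x (stdVec j)) ψ y -
      (if k = j then 1 else 0) *
        rayOp (fun t => t ^ (l - 1) / (1 - t)) (Icc 0 (1 / 2)) (fun _ => 1) a ψ y := by
  have hS : IsCompact (Icc (0 : ℝ) (1 / 2)) := isCompact_Icc
  have i1 := (continuousOn_pow_div l).integrableOn_compact (μ := volume) hS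
  have i2 := (continuousOn_pow_div (l - 1)).integrableOn_compact (μ := volume) hS
  simp only [rayOp]
  rw [← integral_const_mul, ← integral_sub
    (integrableOn_rayInt hS i1 (continuous_coord k) (ha.fderiv _) hψ y)
    ((integrableOn_rayInt hS i2 continuous_const ha hψ y).const_mul _)]
  refine setIntegral_congr_fun measurableSet_Icc fun t ht => ?_
  have h0 : 1 - t ≠ 0 := by linarith [ht.2]
  have h1 := rayInt_coord_fderiv_right ha hψ t y j k
  have h2 : t ^ l = t * t ^ (l - 1) := by rw [← pow_succ', Nat.sub_add_cancel hl]
  simp only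
  rw [h2]
  field_simp
  linear_combination t ^ (l - 1) * h1

/-- The identity t w = (y - z) - ((y - t w) - z) trades the weight `w k` for a factor outside the
integral and a modified bump. Only weight one remains, to which the Fourier formula applies. -/
theorem rayInt_near_eq (ha : IsTestFun univ a) (hψ : IsTestFun univ ψ) (t : ℝ)
    (z y : Eucl n) (k : Fin n) :
    t * rayInt (fun w => w k) a ψ t y =
      (y - z) k * rayInt (fun _ => 1) a ψ t y -
        rayInt (fun _ => 1) (fun x => (x - z) k * a x) ψ t y := by
  have ha' : IsTestFun univ fun x => (x - z) k * a x := ha.mul_contDiff (by fun_prop)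
  simp only [rayInt]
  rw [← integral_const_mul, ← integral_const_mul, ← integral_sub
    ((integrable_ray continuous_const ha hψ t y).const_mul _)
    (integrable_ray continuous_const ha' hψ t y)]
  congr 1
  ext w
  simp only [PiLp.sub_apply, PiLp.smul_apply, smul_eq_mul]
  ring

theorem rayOp_near_eq (ha : IsTestFun univ a) (hψ : IsTestFun univ ψ) (z y : Eucl n) (k : Fin n) :
    rayOp (fun t => t ^ (l - 1)) (Icc (1 / 2) 1) (fun w => w k) a ψ y =
      (y - z) k * rayOp (fun t => t ^ (l - 1) / t) (Icc (1 / 2) 1) (fun _ => 1) a ψ y -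
        rayOp (fun t => t ^ (l - 1) / t) (Icc (1 / 2) 1) (fun _ => 1)
          (fun x => (x - z) k * a x) ψ y := by
  have ha' : IsTestFun univ fun x => (x - z) k * a x := ha.mul_contDiff (by fun_prop)
  have hS : IsCompact (Icc (1 / 2 : ℝ) 1) := isCompact_Icc
  have i1 : IntegrableOn (fun t : ℝ => t ^ (l - 1) / t) (Icc (1 / 2) 1) :=
    (ContinuousOn.div (by fun_prop) (by fun_prop) fun t ht => by
      linarith [ht.1]).integrableOn_compact hS
  simp only [rayOp]
  rw [← integral_const_mul, ← integral_sub
    ((integrableOn_rayInt hS i1 continuous_const ha hψ y).const_mul _)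
    (integrableOn_rayInt hS i1 continuous_const ha' hψ y)]
  refine setIntegral_congr_fun measurableSet_Icc fun t ht => ?_
  have h0 : 0 < t := by linarith [ht.1]
  have h1 := rayInt_near_eq ha hψ t z y k
  simp only
  field_simp
  linear_combination h1

theorem integral_sq_add_le {X : Type*} [MeasurableSpace X] {μ : Measure X} {f g : X → ℝ}
    (hf : Integrable (fun x => f x ^ 2) μ) (hg : Integrable (fun x => g x ^ 2) μ) :
    ∫ x, (f x + g x) ^ 2 ∂μ ≤ 2 * (∫ x, f x ^ 2 ∂μ) + 2 * ∫ x, g x ^ 2 ∂μ := by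
  rw [← integral_const_mul, ← integral_const_mul, ← integral_add (hf.const_mul 2) (hg.const_mul 2)]
  refine integral_mono_of_nonneg (Filter.Eventually.of_forall fun x => sq_nonneg _)
    ((hf.const_mul 2).add (hg.const_mul 2)) (Filter.Eventually.of_forall fun x => ?_)
  simp only
  nlinarith [sq_nonneg (f x - g x)]

theorem IsTestFun.integrable_sq {Ω : Set (Eucl n)} (hψ : IsTestFun Ω ψ) :
    Integrable fun x => ψ x ^ 2 := (hψ.memLp 2 _).integrable_sq

theorem rayOp_Icc_split (hp : Continuous p) (ha : IsTestFun univ a) (hψ : IsTestFun univ ψ)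
    (m : ℕ) (y : Eucl n) :
    rayOp (fun t => t ^ m) (Icc 0 1) p a ψ y =
      rayOp (fun t => t ^ m) (Icc 0 (1 / 2)) p a ψ y +
        rayOp (fun t => t ^ m) (Icc (1 / 2) 1) p a ψ y := by
  have hc : ∀ x y : ℝ, IntegrableOn (fun t : ℝ => t ^ m) (Icc x y) := fun x y =>
    (continuous_pow m).integrableOn_Icc
  have i1 := integrableOn_rayInt (isCompact_Icc (a := (0 : ℝ)) (b := 1 / 2)) (hc _ _) hp ha hψ y
  have i2 := integrableOn_rayInt (isCompact_Icc (a := (1 / 2 : ℝ)) (b := 1)) (hc _ _) hp ha hψ y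
  simp only [rayOp]
  rw [integral_Icc_eq_integral_Ioc (x := 0) (y := 1 / 2),
    integral_Icc_eq_integral_Ioc (x := 1 / 2) (y := 1), integral_Icc_eq_integral_Ioc,
    ← setIntegral_union (Ioc_disjoint_Ioc_of_le le_rfl) measurableSet_Ioc
      (i1.mono_set Ioc_subset_Icc_self) (i2.mono_set Ioc_subset_Icc_self),
    Ioc_union_Ioc_eq_Ioc (by norm_num) (by norm_num)]

end BogovskiiEstimate

section BogovskiiEstimate

variable {n l : ℕ} {D : Set (Eucl n)} {z : Eucl n} {ρ : ℝ} {θ ψ : Eucl n → ℝ}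

theorem StarShapedBall.isTestFun_rayOp (h : StarShapedBall D z ρ)
    (hθ : IsTestFun (Metric.ball z ρ) θ) (hψ : IsTestFun D ψ) {S : Set ℝ} (hS : IsCompact S)
    (hS' : S ⊆ Icc 0 1) {c : ℝ → ℝ} (hc : IntegrableOn c S) {p : Eucl n → ℝ}
    (hp : Continuous p) : IsTestFun D (rayOp c S p θ ψ) :=
  _root_.isTestFun_rayOp hS hS' hc hp hθ.univ hψ.univ fun _ hx _ hx' =>
    h.segment_subset (hθ.2.2 hx) (hψ.2.2 hx')

/-- Without a derivative on `ψ` a crude bound is enough; no uniformity of `K` is claimed. It serves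
to place the potential in L² and to show that some Poincaré constant exists. -/
theorem StarShapedBall.exists_integral_rayOp_sq_le (h : StarShapedBall D z ρ) {C : ℝ}
    (hC : 0 < C) (hθ : IsScaledBump C z ρ θ) :
    ∃ K : ℝ, ∀ (m : ℕ) (ψ : Eucl n → ℝ), IsTestFun D ψ → ∀ k : Fin n,
      ∫ y, rayOp (fun t => t ^ m) (Icc 0 1) (fun w => w k) θ ψ y ^ 2 ≤ K * ∫ x, ψ x ^ 2 := by
  set G : ℝ≥0∞ := 2 ^ n * volume D * ∫⁻ x, ‖θ x‖ₑ ^ 2 with hG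
  have hGtop : G ≠ ⊤ := by
    refine ENNReal.mul_ne_top (ENNReal.mul_ne_top (by finiteness) h.volume_lt_top.ne) ?_
    exact (hθ.l2.trans_lt ENNReal.ofReal_lt_top).ne
  have hGV : G ≤ ENNReal.ofReal (C ^ 2 * (G.toReal / C ^ 2)) := by
    rw [mul_div_cancel₀ _ (by positivity), ENNReal.ofReal_toReal hGtop]
  -- This value turns the hypothesis on the L² norm in `rayForm_le_sqrt_min` into an equality.
  set V := G.toReal / C ^ 2 with hV
  have hV0 : 0 ≤ V := by positivity
  set A := C * √V + √(2 ^ n * C ^ 2)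
  refine ⟨(Metric.diam D * A) ^ 2, fun m ψ hψ k => ?_⟩
  have hcont : Continuous fun t : ℝ => t ^ m := continuous_pow m
  refine integral_rayOp_sq_le isCompact_Icc le_rfl hcont.integrableOn_Icc hcont.measurable
    (continuous_coord k) hθ.isTestFun.univ hψ.univ Metric.diam_nonneg
    (fun t _ y w h0 => h.abs_coord_le ((subset_tsupport θ).trans hθ.isTestFun.2.2) hψ k t y w h0)
    (L := fun _ => ENNReal.ofReal A)
    (ae_restrict_Icc_of_Ioc fun t ht f hf => ?_) (by positivity) ?_
  · have mθ := hθ.isTestFun.continuous.enorm.measurable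
    have mψ := hψ.continuous.enorm.measurable
    rcases le_total t (1 / 2) with ht' | ht'
    · refine (rayForm_le_sqrt_min hf mθ mψ h.measurableSet (fun x hx => by simp [hψ.eq_zero hx])
        hC.le hV0 hθ.l1 hGV ⟨ht.1, ht'⟩).trans (mul_le_mul_left (ENNReal.ofReal_le_ofReal ?_) _)
      calc C * √(min (t ^ n)⁻¹ V) ≤ C * √V := by gcongr; exact min_le_right _ _
        _ ≤ A := le_add_of_nonneg_right (by positivity)
    · refine (rayForm_le_of_half_le hf mθ mψ hC.le hθ.l1 ⟨ht', ht.2⟩).trans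
        (mul_le_mul_left (ENNReal.ofReal_le_ofReal ?_) _)
      exact le_add_of_nonneg_left (by positivity)
  · calc _ ≤ ∫⁻ _ in Icc (0 : ℝ) 1, ENNReal.ofReal A := by
          refine setLIntegral_mono' measurableSet_Icc fun t ht => ?_
          refine (mul_le_mul_left ?_ _).trans_eq (one_mul _)
          rw [← ofReal_norm, Real.norm_of_nonneg (pow_nonneg ht.1 _)]
          exact ENNReal.ofReal_le_one.2 (pow_le_one₀ ht.1 ht.2)
      _ = _ := by simp

theorem integrableOn_pow_div_near (m : ℕ) :
    IntegrableOn (fun t : ℝ => t ^ m / t) (Icc (1 / 2) 1) :=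
  (ContinuousOn.div (by fun_prop) (by fun_prop) fun t ht => by
    linarith [ht.1]).integrableOn_compact isCompact_Icc

theorem abs_pow_div_near_le (m : ℕ) {t : ℝ} (ht : t ∈ Icc (1 / 2 : ℝ) 1) : |t ^ m / t| ≤ 2 := by
  have h0 : 0 < t := by linarith [ht.1]
  rw [abs_of_nonneg (by positivity), div_le_iff₀ h0]
  have := pow_le_one₀ (n := m) h0.le ht.2
  linarith [ht.1]

/-- After the weight is split, the factor `(y - z) k` is at most the diameter because the operator
is supported in `D`, and it multiplies a bound of order C/ρ. The modified bump has a Fourier bound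
of order Cρ, which cancels the 1/ρ. -/
theorem StarShapedBall.integral_rayOp_near_sq_le (h : StarShapedBall D z ρ) {C : ℝ} (hC : 0 < C)
    (hθ : IsScaledBump C z ρ θ) (hρ : ρ ≤ Metric.diam D) (hψ : IsTestFun D ψ) (j k : Fin n) :
    ∫ y, rayOp (fun t => t ^ (l - 1)) (Icc (1 / 2) 1) (fun w => w k) θ
      (fun x => fderiv ℝ ψ x (stdVec j)) y ^ 2 ≤
      (2 ^ (n + 2) * (4 * Real.pi) * C * (Metric.diam D / ρ)) ^ 2 * ∫ x, ψ x ^ 2 := by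
  have hρ0 := h.radius_pos
  set d := Metric.diam D
  set Q := ∫ x, ψ x ^ 2
  have hQ : 0 ≤ Q := integral_nonneg fun x => sq_nonneg _
  have hb := hψ.fderiv (stdVec j)
  have hθ' : IsTestFun (Metric.ball z ρ) fun x => (x - z) k * θ x :=
    hθ.isTestFun.mul_contDiff (by fun_prop)
  have hcI := integrableOn_pow_div_near (l - 1)
  have hj : ‖(stdVec j : Eucl n)‖ ≤ 1 := by simp [stdVec]
  set N := rayOp (fun t => t ^ (l - 1) / t) (Icc (1 / 2) 1) (fun _ => 1) θ
    (fun x => fderiv ℝ ψ x (stdVec j)) with hN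
  set N' := rayOp (fun t => t ^ (l - 1) / t) (Icc (1 / 2) 1) (fun _ => 1)
    (fun x => (x - z) k * θ x) (fun x => fderiv ℝ ψ x (stdVec j)) with hN'
  have hS : Icc (1 / 2 : ℝ) 1 ⊆ Icc 0 1 := Icc_subset_Icc_left (by norm_num)
  have tN : IsTestFun D N := h.isTestFun_rayOp hθ.isTestFun hb isCompact_Icc hS hcI
    continuous_const
  have tN' : IsTestFun D N' := h.isTestFun_rayOp hθ' hb isCompact_Icc hS hcI continuous_const
  have e1 : ∫ y, N y ^ 2 ≤ 2 ^ (n + 1) * (2 * (2 * Real.pi) * (C / ρ)) ^ 2 * Q :=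
    integral_rayOp_fderiv_sq_le hθ.isTestFun.univ hψ.univ hρ0 hθ.fourier hcI
      (fun t ht => abs_pow_div_near_le _ ht) hj
  have e2 : ∫ y, N' y ^ 2 ≤ 2 ^ (n + 1) * (2 * (2 * Real.pi) * (C * ρ / ρ)) ^ 2 * Q :=
    integral_rayOp_fderiv_sq_le hθ'.univ hψ.univ hρ0 (hθ.fourier_mul k) hcI
      (fun t ht => abs_pow_div_near_le _ ht) hj
  have e3 : ∫ y, ((y - z) k * N y) ^ 2 ≤ d ^ 2 * ∫ y, N y ^ 2 := by
    rw [← integral_const_mul]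
    refine integral_mono (tN.mul_contDiff (by fun_prop)).integrable_sq
      (tN.integrable_sq.const_mul _) fun y => ?_
    simp only [mul_pow]
    by_cases hy : y ∈ D
    · refine mul_le_mul_of_nonneg_right ?_ (sq_nonneg _)
      rw [← sq_abs]
      refine pow_le_pow_left₀ (abs_nonneg _) ((norm_apply_le k _).trans ?_) 2
      rw [← dist_eq_norm]
      exact Metric.dist_le_diam_of_mem h.isBounded hy
        (h.ball_subset (Metric.mem_ball_self hρ0))
    · simp [tN.eq_zero hy]
  have hr : 1 ≤ d / ρ := (one_le_div hρ0).2 hρ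
  calc _ = ∫ y, ((y - z) k * N y + -1 * N' y) ^ 2 := by
        congr 1
        ext y
        rw [rayOp_near_eq hθ.isTestFun.univ hb.univ z y k]
        ring
    _ ≤ 2 * (∫ y, ((y - z) k * N y) ^ 2) + 2 * ∫ y, (-1 * N' y) ^ 2 :=
        integral_sq_add_le (tN.mul_contDiff (by fun_prop)).integrable_sq
          (tN'.const_mul _).integrable_sq
    _ ≤ 2 * (d ^ 2 * (2 ^ (n + 1) * (2 * (2 * Real.pi) * (C / ρ)) ^ 2 * Q)) +
          2 * (2 ^ (n + 1) * (2 * (2 * Real.pi) * C) ^ 2 * Q) := by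
        rw [mul_div_cancel_right₀ _ hρ0.ne'] at e2
        have e4 : ∫ y, (-1 * N' y) ^ 2 = ∫ y, N' y ^ 2 := by simp
        rw [e4]
        have := e3.trans (mul_le_mul_of_nonneg_left e1 (sq_nonneg d))
        linarith
    _ = 2 ^ (n + 2) * ((4 * Real.pi * C) ^ 2 * Q) * ((d / ρ) ^ 2 + 1) := by
        field_simp
        ring
    -- Since d/ρ ≥ 1, a factor two would suffice; it is enlarged to 2^(n+2) to obtain a perfect
    -- square.
    _ ≤ 2 ^ (n + 2) * ((4 * Real.pi * C) ^ 2 * Q) * (2 ^ (n + 2) * (d / ρ) ^ 2) := by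
        refine mul_le_mul_of_nonneg_left ?_ (by positivity)
        have h2 : (4 : ℝ) ≤ 2 ^ (n + 2) := by
          rw [pow_add]; nlinarith [one_le_pow₀ (M₀ := ℝ) (a := 2) (n := n) (by norm_num)]
        nlinarith
    _ = _ := by ring

set_option maxHeartbeats 800000 in
/-- The estimate of the regularized Poincaré operator (in dual form) on star shaped domains. -/
theorem exists_bogovskii_estimate (n l : ℕ) (hl : 1 ≤ l) (hln : l ≤ n) :
    ∃ C : ℝ, 0 < C ∧ ∀ (D : Set (Eucl n)) (z : Eucl n) (ρ : ℝ), StarShapedBall D z ρ →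
      ∃ θ, IsTestFun (Metric.ball z ρ) θ ∧ ∫ x, θ x = 1 ∧
        (∃ K : ℝ, ∀ (m : ℕ) (ψ : Eucl n → ℝ), IsTestFun D ψ → ∀ k : Fin n,
          ∫ y, rayOp (fun t => t ^ m) (Icc 0 1) (fun w => w k) θ ψ y ^ 2 ≤ K * ∫ x, ψ x ^ 2) ∧
        ∀ ψ, IsTestFun D ψ → ∀ j k : Fin n,
          ∫ y, rayOp (fun t => t ^ (l - 1)) (Icc 0 1) (fun w => w k) θ
            (fun x => fderiv ℝ ψ x (stdVec j)) y ^ 2 ≤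
            starConst C l D z ρ ^ 2 * ∫ x, ψ x ^ 2 := by
  obtain ⟨C₀, hC₀, hbump⟩ := exists_isScaledBump n
  obtain ⟨C₁, hC₁, hint⟩ := exists_lintegral_pow_mul_sqrt_min_le n l hl hln
  set vol₁ := volume.real (Metric.ball (0 : Eucl n) 1) with h_vol₁
  have h_pos : 0 < vol₁ := volume_real_ball_pos 0 one_pos
  -- `K` dominates the L¹ constant `C₀`, and its square dominates the L² constant 2ⁿ C₀ vol₁, so the
  -- same `K` enters both bounds of the trilinear form.
  set K := 1 + C₀ + 2 ^ n * C₀ * vol₁ with hK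
  have hK0 : 0 < K := by positivity
  have hK1 : 2 ^ n * C₀ * vol₁ ≤ K ^ 2 := by
    have : 0 < 2 ^ n * C₀ * vol₁ := by positivity
    nlinarith
  set M := 2 * K * C₁ + 2 ^ (n + 2) * (4 * Real.pi) * C₀ with hM
  have hM0 : 0 < M := by positivity
  -- Three operators, each with squared norm at most B², add up to at most 10 B² ≤ (4B)². Passing
  -- from ρ to the diameter of the ball, which is at most 2ρ, costs another factor two.
  refine ⟨8 * M, by positivity, fun D z ρ h => ?_⟩
  obtain ⟨θ, hθ⟩ := hbump z ρ h.radius_pos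
  refine ⟨θ, hθ.isTestFun, hθ.integral_eq, h.exists_integral_rayOp_sq_le hC₀ hθ,
    fun ψ hψ j k => ?_⟩
  have hρ0 := h.radius_pos
  have hρb := radius_le_diam_ball (hl.trans hln) z hρ0
  have hρ := hρb.trans h.diam_ball_le
  set d := Metric.diam D with hd
  set Q := ∫ x, ψ x ^ 2
  have hQ : 0 ≤ Q := integral_nonneg fun x => sq_nonneg _
  set V := volume.real D / volume.real (Metric.ball z ρ) with hV
  have hV1 : 1 ≤ V := h.one_le_ratio
  set κ := kappa n l V with hκ
  have hκ1 : 1 ≤ κ := one_le_kappa hV1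
  have hA := hint V hV1
  have hvol : volume D = ENNReal.ofReal (V * (ρ ^ n * vol₁)) := by
    rw [hV, h_vol₁, ← volume_real_ball z hρ0, div_mul_cancel₀ _ (volume_real_ball_pos z hρ0).ne',
      Measure.real, ENNReal.ofReal_toReal h.volume_lt_top.ne]
  have hV0 : 0 ≤ V := by linarith
  have supp : ∀ {a : Eucl n → ℝ}, IsTestFun (Metric.ball z ρ) a →
      Function.support a ⊆ Metric.ball z ρ := fun ha => (subset_tsupport _).trans ha.2.2
  have h2n : (2 : ℝ≥0∞) ^ n = ENNReal.ofReal (2 ^ n) := by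
    rw [ENNReal.ofReal_pow (by norm_num), ENNReal.ofReal_ofNat]
  have hθj := hθ.isTestFun.fderiv (stdVec j)
  set F₁ := rayOp (fun t => t ^ l / (1 - t)) (Icc 0 (1 / 2)) (fun w => w k)
    (fun x => fderiv ℝ θ x (stdVec j)) ψ with hF₁
  set F₀ := rayOp (fun t => t ^ (l - 1) / (1 - t)) (Icc 0 (1 / 2)) (fun _ => 1) θ ψ with hF₀
  set N := rayOp (fun t => t ^ (l - 1)) (Icc (1 / 2) 1) (fun w => w k) θ
    (fun x => fderiv ℝ ψ x (stdVec j)) with hN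
  have hS : Icc (0 : ℝ) (1 / 2) ⊆ Icc 0 1 := Icc_subset_Icc_right (by norm_num)
  have tF₁ : IsTestFun D F₁ := h.isTestFun_rayOp hθj hψ isCompact_Icc hS
    ((continuousOn_pow_div l).integrableOn_compact isCompact_Icc) (continuous_coord k)
  have tF₀ : IsTestFun D F₀ := h.isTestFun_rayOp hθ.isTestFun hψ isCompact_Icc hS
    ((continuousOn_pow_div _).integrableOn_compact isCompact_Icc) continuous_const
  have tN : IsTestFun D N := h.isTestFun_rayOp hθ.isTestFun (hψ.fderiv _) isCompact_Icc
    (Icc_subset_Icc_left (by norm_num)) (continuous_pow _).integrableOn_Icc (continuous_coord k)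
  have e₁ : ∫ y, F₁ y ^ 2 ≤ (d * (2 * (K / ρ) * (C₁ * κ))) ^ 2 * Q := by
    refine h.integral_rayOp_far_sq_le (l := l) (continuous_coord k) hθj.univ hψ Metric.diam_nonneg
      (fun t y w h0 => h.abs_coord_le (supp hθj) hψ k t y w h0) (by positivity) hV0
      ((hθ.l1_fderiv j).trans (ENNReal.ofReal_le_ofReal ?_)) ?_ (continuousOn_pow_div l)
      (by fun_prop) (fun t ht => abs_pow_div_le (Nat.sub_le _ _) ht) (by positivity) hA
    · rw [div_eq_mul_inv]
      gcongr
      have : 0 < 2 ^ n * C₀ * vol₁ := by positivity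
      linarith
    · rw [h2n, hvol]
      refine (mul_le_mul_right (hθ.l2_fderiv j) _).trans ?_
      rw [← ENNReal.ofReal_mul (by positivity), ← ENNReal.ofReal_mul (by positivity)]
      refine ENNReal.ofReal_le_ofReal ?_
      calc _ = (2 ^ n * C₀ * vol₁) * (ρ⁻¹ ^ 2 * V) := by field_simp
        _ ≤ K ^ 2 * (ρ⁻¹ ^ 2 * V) := by gcongr
        _ = _ := by ring
  have e₀ : ∫ y, F₀ y ^ 2 ≤ (1 * (2 * K * (C₁ * κ))) ^ 2 * Q := by
    refine h.integral_rayOp_far_sq_le (l := l) continuous_const hθ.isTestFun.univ hψ zero_le_one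
      (fun t y w h0 => by simp) (by positivity) hV0
      (hθ.l1.trans (ENNReal.ofReal_le_ofReal ?_)) ?_ (continuousOn_pow_div (l - 1))
      (by fun_prop) (fun t ht => abs_pow_div_le le_rfl ht) (by positivity) hA
    · have : 0 < 2 ^ n * C₀ * vol₁ := by positivity
      linarith
    · rw [h2n, hvol]
      refine (mul_le_mul_right hθ.l2 _).trans ?_
      rw [← ENNReal.ofReal_mul (by positivity), ← ENNReal.ofReal_mul (by positivity)]
      refine ENNReal.ofReal_le_ofReal ?_
      calc _ = (2 ^ n * C₀ * vol₁) * V := by field_simp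
        _ ≤ K ^ 2 * V := by gcongr
  have eN : ∫ y, N y ^ 2 ≤ (2 ^ (n + 2) * (4 * Real.pi) * C₀ * (d / ρ)) ^ 2 * Q :=
    h.integral_rayOp_near_sq_le hC₀ hθ hρ hψ j k
  have hr : 1 ≤ d / ρ := (one_le_div hρ0).2 hρ
  set B := M * (d / ρ) * κ with hB
  have b₁ : d * (2 * (K / ρ) * (C₁ * κ)) ≤ B := by
    have h1 : d * (2 * (K / ρ) * (C₁ * κ)) = 2 * K * C₁ * (d / ρ) * κ := by ring
    rw [h1, hB]
    gcongr
    exact le_add_of_nonneg_right (by positivity)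
  have b₀ : 1 * (2 * K * (C₁ * κ)) ≤ B := by
    have h1 : 1 * (2 * K * (C₁ * κ)) = 2 * K * C₁ * 1 * κ := by ring
    rw [h1, hB]
    gcongr
    exact le_add_of_nonneg_right (by positivity)
  have bN : 2 ^ (n + 2) * (4 * Real.pi) * C₀ * (d / ρ) ≤ B := by
    have h1 : 2 ^ (n + 2) * (4 * Real.pi) * C₀ * (d / ρ) =
      2 ^ (n + 2) * (4 * Real.pi) * C₀ * (d / ρ) * 1 := by ring
    rw [h1, hB]
    gcongr
    exact le_add_of_nonneg_left (by positivity)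
  have hd0 : 0 ≤ d := Metric.diam_nonneg
  have f₁ := e₁.trans (mul_le_mul_of_nonneg_right (pow_le_pow_left₀ (by positivity) b₁ 2) hQ)
  have f₀ := e₀.trans (mul_le_mul_of_nonneg_right (pow_le_pow_left₀ (by positivity) b₀ 2) hQ)
  have fN := eN.trans (mul_le_mul_of_nonneg_right (pow_le_pow_left₀ (by positivity) bN 2) hQ)
  have hball : Metric.diam (Metric.ball z ρ) ≤ 2 * ρ := Metric.diam_ball hρ0.le
  have hBs : 4 * B ≤ starConst (8 * M) l D z ρ := by
    have h1 : d / ρ ≤ 2 * (d / Metric.diam (Metric.ball z ρ)) := by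
      rw [← mul_div_assoc, div_le_div_iff₀ hρ0 (hρ0.trans_le hρb)]
      nlinarith
    calc 4 * B ≤ 4 * (M * (2 * (d / Metric.diam (Metric.ball z ρ))) * κ) := by rw [hB]; gcongr
      _ = _ := by rw [starConst]; ring
  set δ : ℝ := if k = j then 1 else 0 with hδ
  have hδ2 : δ ^ 2 ≤ 1 := by rw [hδ]; split_ifs <;> norm_num
  calc _ = ∫ y, ((F₁ y + -δ * F₀ y) + N y) ^ 2 := by
        congr 1
        ext y
        rw [rayOp_Icc_split (continuous_coord k) hθ.isTestFun.univ (hψ.fderiv _).univ (l - 1) y,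
          rayOp_far_eq hθ.isTestFun.univ hψ.univ hl y j k]
        ring
    _ ≤ 2 * (∫ y, (F₁ y + -δ * F₀ y) ^ 2) + 2 * ∫ y, N y ^ 2 :=
        integral_sq_add_le (tF₁.add (tF₀.const_mul _)).integrable_sq tN.integrable_sq
    _ ≤ 2 * (2 * (∫ y, F₁ y ^ 2) + 2 * ∫ y, (-δ * F₀ y) ^ 2) + 2 * ∫ y, N y ^ 2 := by
        gcongr
        exact integral_sq_add_le tF₁.integrable_sq (tF₀.const_mul _).integrable_sq
    _ ≤ 2 * (2 * (B ^ 2 * Q) + 2 * (B ^ 2 * Q)) + 2 * (B ^ 2 * Q) := by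
        have h1 : ∫ y, (-δ * F₀ y) ^ 2 ≤ ∫ y, F₀ y ^ 2 := by
          simp only [mul_pow, neg_sq]
          rw [integral_const_mul]
          exact mul_le_of_le_one_left (integral_nonneg fun y => sq_nonneg _) hδ2
        linarith
    _ ≤ (4 * B) ^ 2 * Q := by
        have : 0 ≤ B ^ 2 * Q := by positivity
        nlinarith
    _ ≤ _ := by gcongr

end BogovskiiEstimate

/-! ### Calculus of weak gradients -/

section WeakDerivatives

variable {n : ℕ} {Ω Ω' : Set (Eucl n)} {f g ψ : Eucl n → ℝ}

theorem IsTestFun.setIntegral_mul (hψ : IsTestFun Ω ψ) (f : Eucl n → ℝ) :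
    ∫ x in Ω, f x * ψ x = ∫ x, f x * ψ x :=
  setIntegral_eq_integral_of_forall_compl_eq_zero fun x hx => by rw [hψ.eq_zero hx, mul_zero]

theorem IsTestFun.setIntegral_mul_mono (hψ : IsTestFun Ω' ψ) (h : Ω' ⊆ Ω) (f : Eucl n → ℝ) :
    ∫ x in Ω, f x * ψ x = ∫ x in Ω', f x * ψ x := by
  rw [hψ.setIntegral_mul, (hψ.mono h).setIntegral_mul]

theorem IsTestFun.setIntegral_sq (hψ : IsTestFun Ω ψ) :
    ∫ x in Ω, ψ x ^ 2 = ∫ x, ψ x ^ 2 :=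
  setIntegral_eq_integral_of_forall_compl_eq_zero fun x hx => by rw [hψ.eq_zero hx]; simp

theorem MemL2.integrable_mul (hf : MemL2 Ω f) (hg : MemL2 Ω g) :
    Integrable (fun x => f x * g x) (volume.restrict Ω) :=
  MemLp.integrable_mul hf hg

theorem IsTestFun.memL2 (hψ : IsTestFun Ω ψ) (D : Set (Eucl n)) : MemL2 D ψ := hψ.memLp 2 _

theorem MemL2.mono (hf : MemL2 Ω f) (h : Ω' ⊆ Ω) : MemL2 Ω' f :=
  MemLp.mono_measure (Measure.restrict_mono h le_rfl) hf

theorem MemL2.integrableOn_sq (hf : MemL2 Ω f) : IntegrableOn (fun x => f x ^ 2) Ω :=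
  MemLp.integrable_sq hf

theorem ae_eq_zero_of_integral_isTestFun (hΩ : IsOpen Ω) (hf : MemL2 Ω f)
    (h : ∀ ψ, IsTestFun Ω ψ → ∫ x in Ω, f x * ψ x = 0) : f =ᵐ[volume.restrict Ω] 0 := by
  have h1 : LocallyIntegrableOn f Ω := locallyIntegrableOn_of_locallyIntegrable_restrict
    (MemLp.locallyIntegrable hf (by norm_num))
  have h2 := hΩ.ae_eq_zero_of_integral_contDiff_smul_eq_zero h1 fun ψ h₁ h₂ h₃ => by
    have h4 : IsTestFun Ω ψ := ⟨h₁, h₂, h₃⟩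
    have h5 := h ψ h4
    rw [h4.setIntegral_mul] at h5
    simpa [mul_comm] using h5
  rw [Filter.EventuallyEq, ae_restrict_iff' hΩ.measurableSet]
  exact h2

theorem MemL2.ae_eq_of_integral (hΩ : IsOpen Ω) (hf : MemL2 Ω f) (hg : MemL2 Ω g)
    (h : ∀ ψ, IsTestFun Ω ψ → ∫ x in Ω, f x * ψ x = ∫ x in Ω, g x * ψ x) :
    f =ᵐ[volume.restrict Ω] g := by
  have h1 : MemL2 Ω (fun x => f x - g x) := MemLp.sub hf hg
  have := ae_eq_zero_of_integral_isTestFun hΩ h1 fun ψ hψ => by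
    simp only [sub_mul]
    rw [integral_sub (hf.integrable_mul (hψ.memL2 _)) (hg.integrable_mul (hψ.memL2 _)), h ψ hψ,
      sub_self]
  filter_upwards [this] with x hx using sub_eq_zero.1 hx

/-- `f ∈ H¹(Ω)` with weak gradient `G`. -/
structure HasWeakGrad (Ω : Set (Eucl n)) (f : Eucl n → ℝ) (G : Fin n → Eucl n → ℝ) : Prop where
  memL2 : MemL2 Ω f
  memL2_grad : ∀ j, MemL2 Ω (G j)
  hasWeakPartial : ∀ j, HasWeakPartial Ω j f (G j)

variable {G H : Fin n → Eucl n → ℝ}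

theorem HasWeakGrad.memH1 (h : HasWeakGrad Ω f G) : MemH1 Ω f :=
  ⟨h.memL2, fun j => ⟨G j, h.memL2_grad j, h.hasWeakPartial j⟩⟩

theorem MemH1.hasWeakGrad (h : MemH1 Ω f) : HasWeakGrad Ω f fun j => weakPartial Ω j f := by
  refine ⟨h.1, fun j => ?_, fun j => ?_⟩
  all_goals
    have := (h.2 j).choose_spec
    simp only [weakPartial, dif_pos (h.2 j)]
    tauto

theorem HasWeakGrad.ae_eq (hΩ : IsOpen Ω) (h : HasWeakGrad Ω f G) (h' : HasWeakGrad Ω f H)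
    (j : Fin n) : G j =ᵐ[volume.restrict Ω] H j :=
  MemL2.ae_eq_of_integral hΩ (h.memL2_grad j) (h'.memL2_grad j) fun ψ hψ => by
    rw [h.hasWeakPartial j ψ hψ, h'.hasWeakPartial j ψ hψ]

/-- `weakPartial` is a chosen representative. By uniqueness almost everywhere the seminorm may be
computed from any weak gradient. -/
theorem HasWeakGrad.h1SemiSq_eq (hΩ : IsOpen Ω) (h : HasWeakGrad Ω f G) :
    h1SemiSq Ω f = ∑ j, l2NormSq Ω (G j) :=
  Finset.sum_congr rfl fun j _ => integral_congr_ae <| by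
    filter_upwards [h.memH1.hasWeakGrad.ae_eq hΩ h j] with x hx
    rw [hx]

theorem HasWeakGrad.add (h : HasWeakGrad Ω f G) (h' : HasWeakGrad Ω g H) :
    HasWeakGrad Ω (fun x => f x + g x) fun j x => G j x + H j x := by
  refine ⟨MemLp.add h.memL2 h'.memL2, fun j => MemLp.add (h.memL2_grad j) (h'.memL2_grad j),
    fun j ψ hψ => ?_⟩
  simp only [add_mul]
  rw [integral_add ((h.memL2_grad j).integrable_mul (hψ.memL2 _))
    ((h'.memL2_grad j).integrable_mul (hψ.memL2 _)),
    integral_add (h.memL2.integrable_mul ((hψ.fderiv _).memL2 _))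
    (h'.memL2.integrable_mul ((hψ.fderiv _).memL2 _)),
    h.hasWeakPartial j ψ hψ, h'.hasWeakPartial j ψ hψ]
  ring

theorem HasWeakGrad.const_mul (h : HasWeakGrad Ω f G) (c : ℝ) :
    HasWeakGrad Ω (fun x => c * f x) fun j x => c * G j x := by
  refine ⟨MemLp.const_mul h.memL2 c, fun j => MemLp.const_mul (h.memL2_grad j) c,
    fun j ψ hψ => ?_⟩
  simp only [mul_assoc]
  rw [integral_const_mul, integral_const_mul, h.hasWeakPartial j ψ hψ]
  ring

theorem HasWeakGrad.sub (h : HasWeakGrad Ω f G) (h' : HasWeakGrad Ω g H) :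
    HasWeakGrad Ω (fun x => f x - g x) fun j x => G j x - H j x := by
  have := h.add (h'.const_mul (-1))
  simpa only [neg_one_mul, ← sub_eq_add_neg] using this

theorem hasWeakGrad_zero : HasWeakGrad Ω (fun _ => 0) fun _ _ => 0 :=
  ⟨MemLp.zero', fun _ => MemLp.zero', fun j ψ hψ => by simp⟩

theorem HasWeakGrad.sum {ι : Type*} (s : Finset ι) {f : ι → Eucl n → ℝ}
    {G : ι → Fin n → Eucl n → ℝ} (h : ∀ i ∈ s, HasWeakGrad Ω (f i) (G i)) :
    HasWeakGrad Ω (fun x => ∑ i ∈ s, f i x) fun j x => ∑ i ∈ s, G i j x := by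
  classical
  induction s using Finset.induction_on with
  | empty => simpa using hasWeakGrad_zero
  | insert i s hi ih =>
    simp only [Finset.sum_insert hi]
    exact (h i (by simp)).add (ih fun i' hi' => h i' (by simp [hi']))

theorem HasWeakGrad.mono (h : HasWeakGrad Ω f G) (hs : Ω' ⊆ Ω) : HasWeakGrad Ω' f G :=
  ⟨h.memL2.mono hs, fun j => (h.memL2_grad j).mono hs, fun j ψ hψ => by
    rw [← hψ.setIntegral_mul_mono hs, ← (hψ.fderiv _).setIntegral_mul_mono hs,
      h.hasWeakPartial j ψ (hψ.mono hs)]⟩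

theorem IsTestFun.integral_fderiv_eq_zero (hψ : IsTestFun Ω ψ) (e : Eucl n) :
    ∫ x, _root_.fderiv ℝ ψ x e = 0 := by
  have h := integral_mul_fderiv_eq_neg_fderiv_mul_of_integrable (𝕜 := ℝ) (μ := volume)
    (f := fun _ : Eucl n => (1 : ℝ)) (g := ψ) (v := e) (by simp)
    (by simpa using ((hψ.fderiv e).continuous.integrable_of_hasCompactSupport (hψ.fderiv e).2.1))
    (by simpa using hψ.continuous.integrable_of_hasCompactSupport hψ.2.1)
    (by fun_prop) fun x _ => hψ.differentiable x
  simpa using h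

theorem hasWeakGrad_const (hΩ : volume Ω < ⊤) (c : ℝ) :
    HasWeakGrad Ω (fun _ => c) fun _ _ => 0 := by
  have : IsFiniteMeasure (volume.restrict Ω) := ⟨by simpa using hΩ⟩
  refine ⟨memLp_const c, fun _ => MemLp.zero', fun j ψ hψ => ?_⟩
  have h1 := hψ.integral_fderiv_eq_zero (stdVec j)
  rw [(hψ.fderiv _).setIntegral_mul]
  simp only [zero_mul, integral_zero, integral_const_mul, h1, mul_zero, neg_zero]

end WeakDerivatives

/-! ### Representation of functionals on test functions -/

section Riesz

variable {n : ℕ} {Ω : Set (Eucl n)}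

/-- The bound forces `T` to vanish on the kernel of `ι`, so `T` descends to the range. The range
need be neither closed nor dense: Hahn–Banach extends the functional with the same norm before the
Riesz theorem is applied. -/
theorem exists_inner_eq_of_abs_le {W E : Type*} [AddCommGroup W] [Module ℝ W]
    [NormedAddCommGroup E] [InnerProductSpace ℝ E] [CompleteSpace E] (ι : W →ₗ[ℝ] E)
    (T : W →ₗ[ℝ] ℝ) {C : ℝ} (hC : 0 ≤ C) (hT : ∀ ψ, |T ψ| ≤ C * ‖ι ψ‖) :
    ∃ h : E, (∀ ψ, inner ℝ h (ι ψ) = T ψ) ∧ ‖h‖ ≤ C := by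
  obtain ⟨s, hs⟩ := ι.rangeRestrict.exists_rightInverse_of_surjective ι.range_rangeRestrict
  have hs' : ∀ y : LinearMap.range ι, ι (s y) = y := fun y =>
    congrArg Subtype.val (LinearMap.congr_fun hs y)
  have hTs : ∀ ψ, T (s (ι.rangeRestrict ψ)) = T ψ := fun ψ => by
    rw [← sub_eq_zero, ← map_sub, ← abs_nonpos_iff]
    refine (hT _).trans_eq ?_
    rw [map_sub, hs']
    simp
  set T' := (T.comp s).mkContinuous C fun y => by
    refine (hT (s y)).trans_eq ?_
    rw [hs']
    rfl
  obtain ⟨g, hg, hgn⟩ := exists_extension_norm_eq (LinearMap.range ι) T'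
  refine ⟨(InnerProductSpace.toDual ℝ E).symm g, fun ψ => ?_, ?_⟩
  · rw [InnerProductSpace.toDual_symm_apply, ← hTs ψ]
    exact hg (ι.rangeRestrict ψ)
  · rw [LinearIsometryEquiv.norm_map, hgn]
    exact LinearMap.mkContinuous_norm_le _ hC _

/-- The space of test functions. -/
def testSubmodule (Ω : Set (Eucl n)) : Submodule ℝ (Eucl n → ℝ) where
  carrier := {ψ | IsTestFun Ω ψ}
  add_mem' h h' := h.add h'
  zero_mem' := ⟨contDiff_const, HasCompactSupport.zero, by simp [tsupport]⟩
  smul_mem' c _ h := h.const_mul c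

/-- The inclusion of the test functions in `L²(Ω)`. -/
noncomputable def testToLp (Ω : Set (Eucl n)) :
    testSubmodule Ω →ₗ[ℝ] Lp ℝ 2 (volume.restrict Ω) where
  toFun ψ := (IsTestFun.memL2 ψ.2 Ω).toLp ψ.1
  map_add' _ _ := rfl
  map_smul' _ _ := rfl

theorem norm_toLp_sq {f : Eucl n → ℝ} (hf : MemL2 Ω f) : ‖hf.toLp f‖ ^ 2 = ∫ x in Ω, f x ^ 2 := by
  rw [← real_inner_self_eq_norm_sq, L2.inner_def]
  refine integral_congr_ae ?_
  filter_upwards [MemLp.coeFn_toLp hf] with x hx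
  rw [hx]
  simp [sq]

theorem exists_memL2_of_le (T : testSubmodule Ω →ₗ[ℝ] ℝ) {C : ℝ} (hC : 0 ≤ C)
    (hT : ∀ ψ, |T ψ| ≤ C * √(∫ x in Ω, ψ.1 x ^ 2)) :
    ∃ h, MemL2 Ω h ∧ (∀ ψ, ∫ x in Ω, h x * ψ.1 x = T ψ) ∧ ∫ x in Ω, h x ^ 2 ≤ C ^ 2 := by
  have hT' : ∀ ψ, |T ψ| ≤ C * ‖testToLp Ω ψ‖ := fun ψ => by
    refine (hT ψ).trans_eq ?_
    congr 1
    rw [Real.sqrt_eq_iff_mul_self_eq (integral_nonneg fun x => sq_nonneg _) (norm_nonneg _), ← sq]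
    exact (norm_toLp_sq (IsTestFun.memL2 ψ.2 Ω)).symm
  obtain ⟨h, hh, hC'⟩ := exists_inner_eq_of_abs_le (testToLp Ω) T hC hT'
  have hmem : MemL2 Ω h := Lp.memLp h
  refine ⟨h, hmem, fun ψ => ?_, ?_⟩
  · rw [← hh ψ, L2.inner_def]
    refine integral_congr_ae ?_
    filter_upwards [MemLp.coeFn_toLp (IsTestFun.memL2 ψ.2 Ω)] with x hx
    change _ = inner ℝ (h x) (MemLp.toLp ψ.1 (IsTestFun.memL2 ψ.2 Ω) x)
    rw [hx]
    simp [mul_comm]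
  · have h1 : MemLp.toLp h hmem = h := Lp.toLp_coeFn h hmem
    rw [← norm_toLp_sq hmem, h1]
    exact pow_le_pow_left₀ (norm_nonneg _) hC' 2

theorem abs_integral_mul_le {f g : Eucl n → ℝ} (hf : MemL2 Ω f) (hg : MemL2 Ω g) :
    |∫ x in Ω, f x * g x| ≤ √(∫ x in Ω, f x ^ 2) * √(∫ x in Ω, g x ^ 2) := by
  have h1 : ∫ x in Ω, f x * g x = inner ℝ (MemLp.toLp f hf) (MemLp.toLp g hg) := by
    rw [L2.inner_def]
    refine integral_congr_ae ?_
    filter_upwards [MemLp.coeFn_toLp hf, MemLp.coeFn_toLp hg] with x hx hx'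
    rw [hx, hx']
    simp [mul_comm]
  rw [h1, ← norm_toLp_sq hf, ← norm_toLp_sq hg, Real.sqrt_sq (norm_nonneg _),
    Real.sqrt_sq (norm_nonneg _)]
  exact abs_real_inner_le_norm _ _

/-- A sum of adjoints of `L²`-bounded operators on test functions, applied to `L²` functions. -/
theorem exists_memL2_adjoint {ι : Type*} [Fintype ι] {f : ι → Eucl n → ℝ}
    (hf : ∀ i, MemL2 Ω (f i)) (L : ι → (Eucl n → ℝ) → Eucl n → ℝ)
    (hL : ∀ i ψ, IsTestFun Ω ψ → IsTestFun Ω (L i ψ))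
    (hadd : ∀ i ψ χ, IsTestFun Ω ψ → IsTestFun Ω χ → L i (ψ + χ) = L i ψ + L i χ)
    (hsmul : ∀ i (c : ℝ) ψ, IsTestFun Ω ψ → L i (c • ψ) = c • L i ψ) {A : ℝ} (hA : 0 ≤ A)
    (hLA : ∀ i ψ, IsTestFun Ω ψ → ∫ x, L i ψ x ^ 2 ≤ A ^ 2 * ∫ x, ψ x ^ 2) :
    ∃ h, MemL2 Ω h ∧ (∀ ψ, IsTestFun Ω ψ →
      ∫ x in Ω, h x * ψ x = ∑ i, ∫ x in Ω, f i x * L i ψ x) ∧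
      ∫ x in Ω, h x ^ 2 ≤ A ^ 2 * (Fintype.card ι * ∑ i, ∫ x in Ω, f i x ^ 2) := by
  let T : testSubmodule Ω →ₗ[ℝ] ℝ :=
    { toFun := fun ψ => ∑ i, ∫ x in Ω, f i x * L i ψ.1 x
      map_add' := fun ψ χ => by
        rw [← Finset.sum_add_distrib]
        refine Finset.sum_congr rfl fun i _ => ?_
        rw [← integral_add ((hf i).integrable_mul ((hL i _ ψ.2).memL2 _))
          ((hf i).integrable_mul ((hL i _ χ.2).memL2 _)), Submodule.coe_add,
          hadd i _ _ ψ.2 χ.2]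
        simp [mul_add]
      map_smul' := fun c ψ => by
        rw [smul_eq_mul, Finset.mul_sum]
        refine Finset.sum_congr rfl fun i _ => ?_
        rw [← integral_const_mul, Submodule.coe_smul, hsmul i c _ ψ.2]
        simp [mul_left_comm] }
  have hQ : ∀ i, 0 ≤ ∫ x in Ω, f i x ^ 2 := fun i => integral_nonneg fun x => sq_nonneg _
  obtain ⟨h, h1, h2, h3⟩ := exists_memL2_of_le T
    (C := ∑ i, A * √(∫ x in Ω, f i x ^ 2)) (by positivity) fun ψ => by
      rw [Finset.sum_mul]
      refine (Finset.abs_sum_le_sum_abs _ _).trans (Finset.sum_le_sum fun i _ => ?_)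
      refine (abs_integral_mul_le (hf i) ((hL i _ ψ.2).memL2 _)).trans ?_
      rw [IsTestFun.setIntegral_sq ψ.2, (hL i _ ψ.2).setIntegral_sq,
        mul_comm A, mul_assoc]
      gcongr
      rw [← Real.sqrt_sq hA, ← Real.sqrt_mul (sq_nonneg _)]
      exact Real.sqrt_le_sqrt (hLA i _ ψ.2)
  refine ⟨h, h1, fun ψ hψ => h2 ⟨ψ, hψ⟩, h3.trans ?_⟩
  rw [← Finset.mul_sum, mul_pow]
  refine mul_le_mul_of_nonneg_left ?_ (sq_nonneg _)
  refine (sq_sum_le_card_mul_sum_sq (s := Finset.univ)).trans_eq ?_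
  simp only [Real.sq_sqrt (hQ _), Finset.card_univ]

end Riesz

/-! ### Coefficients of forms along arbitrary tuples -/

section Coefficients

variable {n k : ℕ} {Ω : Set (Eucl n)} {u : Eucl n → Forms n k}

theorem mem_incrTuples {I : Fin k → Fin n} : I ∈ incrTuples n k ↔ StrictMono I := by
  simp [incrTuples]

theorem succAbove_mem_incrTuples {J : Fin (k + 1) → Fin n} (hJ : J ∈ incrTuples n (k + 1))
    (p : Fin (k + 1)) : (fun q => J (p.succAbove q)) ∈ incrTuples n k :=
  mem_incrTuples.2 ((mem_incrTuples.1 hJ).comp (Fin.strictMono_succAbove p))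

theorem exists_perm_mem_incrTuples {K : Fin k → Fin n} (hK : Function.Injective K) :
    ∃ σ : Equiv.Perm (Fin k), (fun q => K (σ q)) ∈ incrTuples n k :=
  ⟨Tuple.sort K, mem_incrTuples.2
    ((Tuple.monotone_sort K).strictMono_of_injective (hK.comp (Tuple.sort K).injective))⟩

/-- Up to sign, the values of an alternating map on basis vectors are zero or values on an
increasing tuple. -/
theorem AlternatingMap.eq_zero_or_exists_sign {k : ℕ} (K : Fin k → Fin n) :
    (∀ f : Eucl n [⋀^Fin k]→ₗ[ℝ] ℝ, f (fun q => stdVec (K q)) = 0) ∨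
      ∃ J ∈ incrTuples n k, ∃ ε : ℝ, ε ^ 2 = 1 ∧ ∀ f : Eucl n [⋀^Fin k]→ₗ[ℝ] ℝ,
        f (fun q => stdVec (K q)) = ε * f (fun q => stdVec (J q)) := by
  by_cases hK : Function.Injective K
  · obtain ⟨σ, hσ⟩ := exists_perm_mem_incrTuples hK
    refine Or.inr ⟨_, hσ, ((Equiv.Perm.sign σ : ℤ) : ℝ), ?_, fun f => ?_⟩
    · rcases Int.units_eq_one_or (Equiv.Perm.sign σ) with h | h <;> simp [h]
    · have h1 := f.map_perm (fun q => stdVec (K q)) σ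
      have h2 : f (fun q => stdVec (K (σ q))) =
          ((Equiv.Perm.sign σ : ℤ) : ℝ) * f (fun q => stdVec (K q)) := by
        rw [← zsmul_eq_mul]
        exact h1
      rw [h2]
      rcases Int.units_eq_one_or (Equiv.Perm.sign σ) with h | h <;> simp [h]
  · refine Or.inl fun f => f.map_eq_zero_of_not_injective _ fun h => hK fun a b hab => h ?_
    simp only [hab]

theorem coeff_eq_zero_or_exists_sign (u : Eucl n → Forms n k) (K : Fin k → Fin n) :
    (∀ x, coeff u K x = 0) ∨ ∃ J ∈ incrTuples n k, ∃ ε : ℝ, ε ^ 2 = 1 ∧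
      ∀ x, coeff u K x = ε * coeff u J x := by
  rcases AlternatingMap.eq_zero_or_exists_sign K with h | ⟨J, hJ, ε, hε, h⟩
  · exact Or.inl fun x => h (u x).toAlternatingMap
  · exact Or.inr ⟨J, hJ, ε, hε, fun x => h (u x).toAlternatingMap⟩

theorem FormMemL2.coeff (hu : FormMemL2 Ω u) (K : Fin k → Fin n) : MemL2 Ω (coeff u K) := by
  rcases coeff_eq_zero_or_exists_sign u K with h | ⟨J, hJ, ε, -, h⟩
  · rw [show _root_.coeff u K = fun _ => 0 from funext h]
    exact MemLp.zero'
  · rw [show _root_.coeff u K = fun x => ε * _root_.coeff u J x from funext h]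
    exact MemLp.const_mul (hu J hJ) ε

theorem l2NormSq_nonneg (f : Eucl n → ℝ) : 0 ≤ l2NormSq Ω f :=
  integral_nonneg fun _ => sq_nonneg _

theorem l2NormSq_coeff_le (u : Eucl n → Forms n k) (K : Fin k → Fin n) :
    l2NormSq Ω (coeff u K) ≤ ∑ J ∈ incrTuples n k, l2NormSq Ω (coeff u J) := by
  rcases coeff_eq_zero_or_exists_sign u K with h | ⟨J, hJ, ε, hε, h⟩
  · rw [show coeff u K = fun _ => 0 from funext h]
    simpa [l2NormSq] using Finset.sum_nonneg fun J _ => l2NormSq_nonneg (Ω := Ω) (coeff u J)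
  · rw [show coeff u K = fun x => ε * coeff u J x from funext h]
    simp only [l2NormSq, mul_pow, hε, one_mul]
    exact Finset.single_le_sum (fun J _ => l2NormSq_nonneg (Ω := Ω) (coeff u J)) hJ

theorem coeff_insert_removeNth (u : Eucl n → Forms n (k + 1)) (J : Fin (k + 1) → Fin n)
    (p : Fin (k + 1)) (x : Eucl n) :
    coeff u (Fin.cons (J p) fun q => J (p.succAbove q)) x = (-1) ^ (p : ℕ) * coeff u J x := by
  have h1 := (u x).toAlternatingMap.map_insertNth p (stdVec (J p))
    (fun q => stdVec (J (p.succAbove q)))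
  have h2 : p.insertNth (stdVec (J p)) (fun q => stdVec (J (p.succAbove q))) =
      fun q => (stdVec (J q) : Eucl n) := Fin.insertNth_self_removeNth p fun q => stdVec (J q)
  have h3 : (fun q => (stdVec (Fin.cons (α := fun _ => Fin n) (J p)
      (fun q => J (p.succAbove q)) q) : Eucl n)) =
      Matrix.vecCons (stdVec (J p)) (fun q => stdVec (J (p.succAbove q))) := by
    ext q : 1
    refine Fin.cases ?_ (fun i => ?_) q <;> simp
  rw [h2] at h1
  change (u x).toAlternatingMap _ = _ * (u x).toAlternatingMap _
  rw [h3, h1, zsmul_eq_mul]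
  push_cast
  rw [← mul_assoc, ← mul_pow]
  simp

/-- The closedness of a form, tested for a tuple of indices that need not be increasing. -/
theorem WeaklyClosed.sum_eq_zero (hu : FormMemL2 Ω u) (hc : WeaklyClosed Ω u)
    (K : Fin (k + 1) → Fin n) {ψ : Eucl n → ℝ} (hψ : IsTestFun Ω ψ) :
    ∑ p : Fin (k + 1), (-1 : ℝ) ^ (p : ℕ) *
      ∫ x in Ω, coeff u (fun q => K (p.succAbove q)) x * fderiv ℝ ψ x (stdVec (K p)) = 0 := by
  -- The sum to be shown zero is the integral of the `K`-component of dψ ∧ u. This form is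
  -- alternating, so the component is zero or a sign times a component along an increasing tuple,
  -- where closedness applies.
  set A : Eucl n → Eucl n [⋀^Fin (k + 1)]→ₗ[ℝ] ℝ := fun x =>
    AlternatingMap.alternatizeUncurryFin
      ((fderiv ℝ ψ x).toLinearMap.smulRight (u x).toAlternatingMap) with hA
  have hAK : ∀ (K : Fin (k + 1) → Fin n) x, A x (fun q => stdVec (K q)) =
      ∑ p : Fin (k + 1), (-1 : ℝ) ^ (p : ℕ) *
        (coeff u (fun q => K (p.succAbove q)) x * fderiv ℝ ψ x (stdVec (K p))) := fun K x => by
    rw [hA, AlternatingMap.alternatizeUncurryFin_apply]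
    refine Finset.sum_congr rfl fun p _ => ?_
    rw [zsmul_eq_mul, mul_comm (coeff u _ x)]
    push_cast
    rfl
  have hint : ∀ K : Fin (k + 1) → Fin n, ∑ p : Fin (k + 1), (-1 : ℝ) ^ (p : ℕ) *
      ∫ x in Ω, coeff u (fun q => K (p.succAbove q)) x * fderiv ℝ ψ x (stdVec (K p)) =
      ∫ x in Ω, A x (fun q => stdVec (K q)) := fun K => by
    simp only [hAK]
    rw [integral_finsetSum _ fun p _ =>
      ((hu.coeff _).integrable_mul ((hψ.fderiv _).memL2 _)).const_mul _]
    simp only [integral_const_mul]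
  rw [hint]
  rcases AlternatingMap.eq_zero_or_exists_sign K with h | ⟨J, hJ, ε, -, h⟩
  · simp [h]
  · simp only [h]
    rw [integral_const_mul, ← hint]
    have h1 := hc J hJ ψ hψ
    rw [eq_comm, neg_eq_iff_eq_neg] at h1
    rw [h1]
    simp [coeff]

end Coefficients

/-! ### Basis forms and the removal of two indices -/

section BasisForms

variable {n k : ℕ} {Ω : Set (Eucl n)}

/-- The form `dx_I`. -/
noncomputable def basisForm (I : Fin k → Fin n) : Forms n k :=
  let f := (Matrix.detRowAlternating (R := ℝ) (n := Fin k)).compLinearMap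
    (LinearMap.pi fun q => (EuclideanSpace.proj (I q) : Eucl n →L[ℝ] ℝ).toLinearMap)
  { f.toMultilinearMap with
    cont := by
      change Continuous fun w : Fin k → Eucl n => Matrix.det (Matrix.of fun p q => w p (I q))
      refine Continuous.matrix_det ?_
      fun_prop
    map_eq_zero_of_eq' := f.map_eq_zero_of_eq' }

theorem basisForm_apply (I : Fin k → Fin n) (w : Fin k → Eucl n) :
    basisForm I w = Matrix.det (Matrix.of fun p q => w p (I q)) := rfl

/-- Increasing tuples with equal range coincide. If they differ, some entry of `J` is missing from
the range of `I`, and the corresponding row of the matrix vanishes. -/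
theorem basisForm_incr {I J : Fin k → Fin n} (hI : I ∈ incrTuples n k) (hJ : J ∈ incrTuples n k) :
    basisForm I (fun q => stdVec (J q)) = if I = J then 1 else 0 := by
  rw [mem_incrTuples] at hI hJ
  rw [basisForm_apply]
  split_ifs with h
  · subst h
    rw [show (Matrix.of fun p q => (stdVec (I p) : Eucl n) (I q)) = 1 by
      ext p q
      simp [stdVec, Matrix.one_apply, hI.injective.eq_iff, eq_comm]]
    exact Matrix.det_one
  · have h1 : ∃ p, J p ∉ range I := by
      by_contra! h2
      refine h (hI.range_inj hJ |>.1 ?_)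
      have h3 : range J ⊆ range I := range_subset_iff.2 h2
      refine (eq_of_subset_of_ncard_le h3 ?_ (Set.toFinite _)).symm
      rw [← image_univ, ← image_univ, ncard_image_of_injective _ hI.injective,
        ncard_image_of_injective _ hJ.injective]
    obtain ⟨p, hp⟩ := h1
    refine Matrix.det_eq_zero_of_row_eq_zero p fun q => ?_
    have : I q ≠ J p := fun h' => hp ⟨q, h'⟩
    simp [stdVec, this]

/-- The form with given coefficients. -/
noncomputable def formOfCoeff (w : (Fin k → Fin n) → Eucl n → ℝ) : Eucl n → Forms n k :=
  fun x => ∑ I ∈ incrTuples n k, w I x • basisForm I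

theorem coeff_formOfCoeff (w : (Fin k → Fin n) → Eucl n → ℝ) {I : Fin k → Fin n}
    (hI : I ∈ incrTuples n k) : coeff (formOfCoeff w) I = w I := by
  ext x
  rw [coeff, formOfCoeff, ContinuousAlternatingMap.sum_apply]
  rw [Finset.sum_eq_single_of_mem I hI fun J hJ hJI => ?_]
  · rw [ContinuousAlternatingMap.smul_apply, basisForm_incr hI hI]
    simp
  · rw [ContinuousAlternatingMap.smul_apply, basisForm_incr hJ hI, if_neg hJI, smul_zero]

/-- Removing two entries of a tuple, in both orders. -/
theorem sum_succAbove_comm {α : Type*} (F : α → α → (Fin k → α) → ℝ) (J : Fin (k + 2) → α) :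
    ∑ p : Fin (k + 2), ∑ q : Fin (k + 1), (-1 : ℝ) ^ ((p : ℕ) + q) *
      F (J p) (J (p.succAbove q)) (fun r => J (p.succAbove (q.succAbove r))) =
    -∑ p : Fin (k + 2), ∑ q : Fin (k + 1), (-1 : ℝ) ^ ((p : ℕ) + q) *
      F (J (p.succAbove q)) (J p) (fun r => J (p.succAbove (q.succAbove r))) := by
  simp only [← Fintype.sum_prod_type']
  rw [← Finset.sum_neg_distrib]
  -- Removing the same two entries in the opposite order is an involution of the index pairs that
  -- reverses the sign.
  have hinv : Function.Involutive fun x : Fin (k + 2) × Fin (k + 1) =>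
      (x.1.succAbove x.2, x.2.predAbove x.1) := fun x => by
    simp [Fin.succAbove_succAbove_predAbove, Fin.predAbove_predAbove_succAbove]
  refine Fintype.sum_equiv hinv.toPerm _ _ fun x => ?_
  simp only [Function.Involutive.coe_toPerm, Fin.succAbove_succAbove_predAbove,
    Fin.succAbove_succAbove_succAbove_predAbove, Fin.neg_one_pow_succAbove_add_predAbove]
  ring

end BasisForms

/-! ### The weak exterior derivative in terms of weak gradients -/

section ExteriorDerivative

variable {n k : ℕ} {Ω : Set (Eucl n)} {v : Eucl n → Forms n k} {u : Eucl n → Forms n (k + 1)}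
  {G : (Fin k → Fin n) → Fin n → Eucl n → ℝ}

theorem sum_integral_eq_neg_of_hasWeakGrad
    (h : ∀ I ∈ incrTuples n k, HasWeakGrad Ω (coeff v I) (G I)) {J : Fin (k + 1) → Fin n}
    (hJ : J ∈ incrTuples n (k + 1)) {ψ : Eucl n → ℝ} (hψ : IsTestFun Ω ψ) :
    ∫ x in Ω, (∑ p : Fin (k + 1), (-1 : ℝ) ^ (p : ℕ) *
        G (fun q => J (p.succAbove q)) (J p) x) * ψ x =
      - ∑ p : Fin (k + 1), (-1 : ℝ) ^ (p : ℕ) *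
          ∫ x in Ω, coeff v (fun q => J (p.succAbove q)) x * fderiv ℝ ψ x (stdVec (J p)) := by
  simp only [Finset.sum_mul, mul_assoc]
  have hG := fun p => h _ (succAbove_mem_incrTuples hJ p)
  rw [integral_finsetSum _ fun p _ =>
    (((hG p).memL2_grad _).integrable_mul (hψ.memL2 _)).const_mul _, ← Finset.sum_neg_distrib]
  refine Finset.sum_congr rfl fun p _ => ?_
  rw [integral_const_mul, (hG p).hasWeakPartial _ ψ hψ, mul_neg]

theorem memL2_sum_grad (h : ∀ I ∈ incrTuples n k, HasWeakGrad Ω (coeff v I) (G I))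
    {J : Fin (k + 1) → Fin n} (hJ : J ∈ incrTuples n (k + 1)) :
    MemL2 Ω fun x => ∑ p : Fin (k + 1), (-1 : ℝ) ^ (p : ℕ) *
      G (fun q => J (p.succAbove q)) (J p) x :=
  memLp_finsetSum _ fun p _ =>
    MemLp.const_mul ((h _ (succAbove_mem_incrTuples hJ p)).memL2_grad _) _

theorem hasWeakExtDeriv_of_ae_eq (h : ∀ I ∈ incrTuples n k, HasWeakGrad Ω (coeff v I) (G I))
    (hu : ∀ J ∈ incrTuples n (k + 1), coeff u J =ᵐ[volume.restrict Ω] fun x =>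
      ∑ p : Fin (k + 1), (-1 : ℝ) ^ (p : ℕ) * G (fun q => J (p.succAbove q)) (J p) x) :
    HasWeakExtDeriv Ω v u := by
  intro J hJ ψ hψ
  rw [← sum_integral_eq_neg_of_hasWeakGrad h hJ hψ]
  exact integral_congr_ae ((hu J hJ).mono fun x hx => by simp only [hx])

theorem HasWeakExtDeriv.ae_eq (hΩ : IsOpen Ω)
    (h : ∀ I ∈ incrTuples n k, HasWeakGrad Ω (coeff v I) (G I)) (hu : FormMemL2 Ω u)
    (hv : HasWeakExtDeriv Ω v u) {J : Fin (k + 1) → Fin n} (hJ : J ∈ incrTuples n (k + 1)) :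
    coeff u J =ᵐ[volume.restrict Ω] fun x =>
      ∑ p : Fin (k + 1), (-1 : ℝ) ^ (p : ℕ) * G (fun q => J (p.succAbove q)) (J p) x :=
  MemL2.ae_eq_of_integral hΩ (hu J hJ) (memL2_sum_grad h hJ) fun ψ hψ => by
    rw [sum_integral_eq_neg_of_hasWeakGrad h hJ hψ, hv J hJ ψ hψ]

theorem HasWeakExtDeriv.mono {Ω' : Set (Eucl n)} (hv : HasWeakExtDeriv Ω v u) (h : Ω' ⊆ Ω) :
    HasWeakExtDeriv Ω' v u := fun J hJ ψ hψ => by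
  rw [← hψ.setIntegral_mul_mono h, hv J hJ ψ (hψ.mono h)]
  simp only [(hψ.fderiv _).setIntegral_mul_mono h]

end ExteriorDerivative

/-! ### Linearity of the transposed operator in the test function -/

section RayOpLinear

variable {n : ℕ} {S : Set ℝ} {c : ℝ → ℝ} {p a ψ χ : Eucl n → ℝ}

theorem rayInt_add_right (hp : Continuous p) (ha : IsTestFun univ a) (hψ : IsTestFun univ ψ)
    (hχ : IsTestFun univ χ) (t : ℝ) (y : Eucl n) :
    rayInt p a (ψ + χ) t y = rayInt p a ψ t y + rayInt p a χ t y := by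
  simp only [rayInt]
  rw [← integral_add (integrable_ray hp ha hψ t y) (integrable_ray hp ha hχ t y)]
  simp [mul_add]

theorem rayOp_add_right (hS : IsCompact S) (hc : IntegrableOn c S) (hp : Continuous p)
    (ha : IsTestFun univ a) (hψ : IsTestFun univ ψ) (hχ : IsTestFun univ χ) :
    rayOp c S p a (ψ + χ) = rayOp c S p a ψ + rayOp c S p a χ := by
  ext y
  simp only [rayOp, Pi.add_apply]
  rw [← integral_add (integrableOn_rayInt hS hc hp ha hψ y) (integrableOn_rayInt hS hc hp ha hχ y)]
  simp only [rayInt_add_right hp ha hψ hχ, mul_add]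

theorem rayOp_smul_right (s : ℝ) : rayOp c S p a (s • ψ) = s • rayOp c S p a ψ := by
  ext y
  simp only [rayOp, rayInt, Pi.smul_apply, smul_eq_mul, mul_left_comm _ s, integral_const_mul]

theorem fderiv_add_right (hψ : IsTestFun univ ψ) (hχ : IsTestFun univ χ) (e : Eucl n) :
    (fun x => fderiv ℝ (ψ + χ) x e) = (fun x => fderiv ℝ ψ x e) + fun x => fderiv ℝ χ x e := by
  ext x
  rw [fderiv_add (hψ.differentiable x) (hχ.differentiable x)]
  rfl

theorem fderiv_smul_right (s : ℝ) (hψ : IsTestFun univ ψ) (e : Eucl n) :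
    (fun x => fderiv ℝ (s • ψ) x e) = s • fun x => fderiv ℝ ψ x e := by
  ext x
  rw [fderiv_const_smul (hψ.differentiable x)]
  rfl

end RayOpLinear

/-! ### The homotopy formula and potentials on star shaped domains -/

section LocalPotential

variable {n k : ℕ} {D : Set (Eucl n)} {z : Eucl n} {ρ : ℝ} {θ : Eucl n → ℝ}

/-- Brings a bound with a constant of unknown sign into the form with a square that
`exists_memL2_adjoint` expects. -/
theorem exists_dual_bound {P : (Eucl n → ℝ) → Eucl n → ℝ} {K : ℝ} {Ω : Set (Eucl n)}
    (h : ∀ ψ, IsTestFun Ω ψ → ∫ y, P ψ y ^ 2 ≤ K * ∫ x, ψ x ^ 2) {ψ : Eucl n → ℝ}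
    (hψ : IsTestFun Ω ψ) : ∫ y, P ψ y ^ 2 ≤ √(max K 0) ^ 2 * ∫ x, ψ x ^ 2 := by
  rw [Real.sq_sqrt (le_max_right _ _)]
  exact (h ψ hψ).trans (mul_le_mul_of_nonneg_right (le_max_left _ _)
    (integral_nonneg fun x => sq_nonneg _))

/-- The homotopy formula: the form with coefficients obtained by duality is a potential. -/
theorem hasWeakExtDeriv_of_dual (h : StarShapedBall D z ρ) (hθ : IsTestFun (Metric.ball z ρ) θ)
    (hθ1 : ∫ x, θ x = 1) {u : Eucl n → Forms n (k + 1)} (hu : FormMemL2 D u)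
    (hc : WeaklyClosed D u) {V : (Fin k → Fin n) → Eucl n → ℝ}
    (hV : ∀ I ψ, IsTestFun D ψ → ∫ x in D, V I x * ψ x = ∑ i : Fin n,
      ∫ x in D, coeff u (Fin.cons i I) x *
        rayOp (fun t => t ^ k) (Icc 0 1) (fun w => w i) θ ψ x) :
    HasWeakExtDeriv D (formOfCoeff V) u := by
  intro J hJ ψ hψ
  have hS : Icc (0 : ℝ) 1 ⊆ Icc 0 1 := le_rfl
  have hci : ∀ m : ℕ, IntegrableOn (fun t : ℝ => t ^ m) (Icc 0 1) := fun m =>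
    (continuous_pow m).integrableOn_Icc
  set H := rayOp (fun t => t ^ k) (Icc 0 1) (fun _ => 1) θ ψ with hH
  have tH : IsTestFun D H := h.isTestFun_rayOp hθ hψ isCompact_Icc hS (hci _) continuous_const
  set η : Fin n → Eucl n → ℝ := fun i =>
    rayOp (fun t => t ^ (k + 1)) (Icc 0 1) (fun w => w i) θ ψ with hη
  have tη : ∀ i, IsTestFun D (η i) := fun i =>
    h.isTestFun_rayOp hθ hψ isCompact_Icc hS (hci _) (continuous_coord i)
  -- Moves the derivative off `ψ`. The companion `I2` is the divergence of the flux `η`; since its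
  -- exponent `k + 1` is positive, only the endpoint `t = 1` contributes to it.
  have I1 : ∀ (y : Eucl n) (j i : Fin n),
      rayOp (fun t => t ^ k) (Icc 0 1) (fun w => w i) θ (fun x => fderiv ℝ ψ x (stdVec j)) y =
      fderiv ℝ (η i) y (stdVec j) - (if i = j then 1 else 0) * H y := fun y j i => by
    rw [rayOp_coord_fderiv_right isCompact_Icc (hci k) hθ.univ hψ.univ y j i]
    simp only [hη, pow_succ']
    rfl
  have I2 : ∀ y, ∑ i, fderiv ℝ (η i) y (stdVec i) = (k + 1 : ℕ) * H y - ψ y := fun y => by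
    have := sum_fderiv_rayOp hθ.univ hψ.univ (k + 1) y
    rw [hθ1] at this
    simpa using this
  have e1 : ∀ p : Fin (k + 1),
      ∫ x in D, coeff (formOfCoeff V) (fun q => J (p.succAbove q)) x *
        fderiv ℝ ψ x (stdVec (J p)) =
      (∑ i, ∫ x in D, coeff u (Fin.cons i fun q => J (p.succAbove q)) x *
        fderiv ℝ (η i) x (stdVec (J p))) - (-1) ^ (p : ℕ) * ∫ x in D, coeff u J x * H x := by
    intro p
    rw [coeff_formOfCoeff V (succAbove_mem_incrTuples hJ p), hV _ _ (hψ.fderiv _)]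
    simp only [I1, mul_sub]
    have e2 : ∀ i, ∫ x in D, (coeff u (Fin.cons i fun q => J (p.succAbove q)) x *
          fderiv ℝ (η i) x (stdVec (J p)) -
          coeff u (Fin.cons i fun q => J (p.succAbove q)) x *
            ((if i = J p then 1 else 0) * H x)) =
        (∫ x in D, coeff u (Fin.cons i fun q => J (p.succAbove q)) x *
          fderiv ℝ (η i) x (stdVec (J p))) - (if i = J p then 1 else 0) *
          ∫ x in D, coeff u (Fin.cons i fun q => J (p.succAbove q)) x * H x := fun i => by
      rw [integral_sub ((hu.coeff _).integrable_mul (((tη i).fderiv _).memL2 _))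
        ((hu.coeff _).integrable_mul ((tH.const_mul _).memL2 _)), ← integral_const_mul]
      congr 2
      ext x
      ring
    rw [Finset.sum_congr rfl fun i _ => e2 i, Finset.sum_sub_distrib]
    simp only [ite_mul, one_mul, zero_mul, Finset.sum_ite_eq',
      Finset.mem_univ, if_true, coeff_insert_removeNth, mul_assoc, integral_const_mul]
  -- Closedness is tested with `η i` on the tuple with `i` put in front of `J`: omitting the first
  -- entry gives the right side, omitting the others gives the left side.
  have e3 : ∀ i, ∑ p : Fin (k + 1), (-1 : ℝ) ^ (p : ℕ) *
      ∫ x in D, coeff u (Fin.cons i fun q => J (p.succAbove q)) x *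
        fderiv ℝ (η i) x (stdVec (J p)) =
      ∫ x in D, coeff u J x * fderiv ℝ (η i) x (stdVec i) := fun i => by
    have h1 := hc.sum_eq_zero hu (Fin.cons i J) (tη i)
    rw [Fin.sum_univ_succ] at h1
    simp only [Fin.val_zero, pow_zero, one_mul, Fin.cons_zero, Fin.zero_succAbove, Fin.cons_succ,
      Fin.val_succ, pow_succ, mul_neg, mul_one, neg_mul, Finset.sum_neg_distrib] at h1
    rw [← sub_eq_add_neg, sub_eq_zero] at h1
    rw [h1]
    refine Finset.sum_congr rfl fun p _ => ?_
    congr 3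
    ext x
    congr 2
    ext q : 1
    refine Fin.cases ?_ (fun r => ?_) q
    · simp
    · simp
  have e4 : ∑ i, ∫ x in D, coeff u J x * fderiv ℝ (η i) x (stdVec i) =
      (k + 1 : ℕ) * (∫ x in D, coeff u J x * H x) - ∫ x in D, coeff u J x * ψ x := by
    rw [← integral_finsetSum _ fun i _ =>
      (hu.coeff J).integrable_mul (((tη i).fderiv _).memL2 _)]
    simp only [← Finset.mul_sum, I2, mul_sub]
    rw [integral_sub ((hu.coeff _).integrable_mul ((tH.const_mul _).memL2 _))
      ((hu.coeff _).integrable_mul (hψ.memL2 _)), ← integral_const_mul]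
    congr 2
    ext x
    ring
  have e5 : ∀ p : Fin (k + 1), (-1 : ℝ) ^ (p : ℕ) * (-1) ^ (p : ℕ) = 1 := fun p => by
    rw [← mul_pow]; simp
  simp only [e1, mul_sub, Finset.mul_sum, Finset.sum_sub_distrib, ← mul_assoc, e5, one_mul]
  -- The Kronecker deltas contribute `k + 1` copies of the integral of `coeff u J` times `H`. They
  -- cancel the multiple of `H` in the divergence, and the integral against `ψ` remains.
  rw [Finset.sum_comm]
  simp only [e3, e4, Finset.sum_const, Finset.card_univ, Fintype.card_fin, nsmul_eq_mul]
  ring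

/-- On a star shaped domain a closed `L²`-form has a potential in `H¹`, with an estimate. -/
theorem exists_local_potential (n k : ℕ) (hk : k + 1 ≤ n) :
    ∃ c : ℝ, 0 < c ∧ ∀ (D : Set (Eucl n)) (z : Eucl n) (ρ : ℝ), StarShapedBall D z ρ →
      ∀ u : Eucl n → Forms n (k + 1), FormMemL2 D u → WeaklyClosed D u →
        ∃ (V : (Fin k → Fin n) → Eucl n → ℝ) (G : (Fin k → Fin n) → Fin n → Eucl n → ℝ),
          (∀ I, HasWeakGrad D (V I) (G I)) ∧
          (∀ J ∈ incrTuples n (k + 1), coeff u J =ᵐ[volume.restrict D] fun x =>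
            ∑ p : Fin (k + 1), (-1 : ℝ) ^ (p : ℕ) * G (fun q => J (p.succAbove q)) (J p) x) ∧
          ∑ I ∈ incrTuples n k, ∑ j, l2NormSq D (G I j) ≤
            starConst c (k + 1) D z ρ ^ 2 *
              ∑ J ∈ incrTuples n (k + 1), l2NormSq D (coeff u J) := by
  obtain ⟨C, hC, hest⟩ := exists_bogovskii_estimate n (k + 1) (by omega) hk
  -- The factor n³ consists of the number of summands in the adjoint, the crude bound of each
  -- coefficient along (i, I) by the whole norm of `u`, and the number of partial derivatives.
  set N : ℝ := (incrTuples n k).card * n ^ 3 with hN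
  have hN0 : 0 ≤ N := by positivity
  refine ⟨(N + 1) * C, by positivity, fun D z ρ h u hu hc => ?_⟩
  obtain ⟨θ, hθ, hθ1, ⟨K, hK⟩, hA⟩ := hest D z ρ h
  simp only [Nat.add_sub_cancel] at hA
  set A := starConst C (k + 1) D z ρ with hAdef
  have hA0 : 0 ≤ A := hC.le.trans (h.le_starConst (by omega) hC.le _)
  have hci : ∀ m : ℕ, IntegrableOn (fun t : ℝ => t ^ m) (Icc 0 1) := fun m =>
    (continuous_pow m).integrableOn_Icc
  have ex1 : ∀ I : Fin k → Fin n, ∃ f, MemL2 D f ∧ ∀ ψ, IsTestFun D ψ →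
      ∫ x in D, f x * ψ x = ∑ i : Fin n, ∫ x in D, coeff u (Fin.cons i I) x *
        rayOp (fun t => t ^ k) (Icc 0 1) (fun w => w i) θ ψ x := fun I => by
    obtain ⟨f, h1, h2, -⟩ := exists_memL2_adjoint (fun i => hu.coeff (Fin.cons i I))
      (fun i ψ => rayOp (fun t => t ^ k) (Icc 0 1) (fun w => w i) θ ψ)
      (fun i ψ hψ => h.isTestFun_rayOp hθ hψ isCompact_Icc le_rfl (hci _) (continuous_coord i))
      (fun i ψ χ hψ hχ => rayOp_add_right isCompact_Icc (hci _) (continuous_coord i) hθ.univ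
        hψ.univ hχ.univ) (fun i s ψ _ => rayOp_smul_right s) (Real.sqrt_nonneg _)
      (fun i ψ hψ => exists_dual_bound (fun ψ hψ => hK k ψ hψ i) hψ)
    exact ⟨f, h1, h2⟩
  have ex2 : ∀ (I : Fin k → Fin n) (j : Fin n), ∃ g, MemL2 D g ∧ (∀ ψ, IsTestFun D ψ →
      ∫ x in D, g x * ψ x = ∑ i : Fin n, ∫ x in D, coeff u (Fin.cons i I) x *
        rayOp (fun t => t ^ k) (Icc 0 1) (fun w => w i) θ
          (fun x => fderiv ℝ ψ x (stdVec j)) x) ∧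
      l2NormSq D g ≤ A ^ 2 * (Fintype.card (Fin n) *
        ∑ i : Fin n, l2NormSq D (coeff u (Fin.cons i I))) := fun I j => by
    refine exists_memL2_adjoint (fun i => hu.coeff (Fin.cons i I))
      (fun i ψ => rayOp (fun t => t ^ k) (Icc 0 1) (fun w => w i) θ
        fun x => fderiv ℝ ψ x (stdVec j))
      (fun i ψ hψ => h.isTestFun_rayOp hθ (hψ.fderiv _) isCompact_Icc le_rfl (hci _)
        (continuous_coord i)) (fun i ψ χ hψ hχ => ?_) (fun i s ψ hψ => ?_) hA0
      (fun i ψ hψ => hA ψ hψ j i)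
    · simp only [fderiv_add_right hψ.univ hχ.univ]
      exact rayOp_add_right isCompact_Icc (hci _) (continuous_coord i) hθ.univ
        (hψ.fderiv _).univ (hχ.fderiv _).univ
    · simp only [fderiv_smul_right s hψ.univ]
      exact rayOp_smul_right s
  choose V hV hV' using ex1
  choose G hG hG' hGA using ex2
  -- `G I j` represents the functional that pairs `V I` with the derivative of the test function,
  -- hence is minus the weak derivative.
  have hgrad : ∀ I, HasWeakGrad D (V I) fun j x => -1 * G I j x := fun I =>
    ⟨hV I, fun j => MemLp.const_mul (hG I j) _, fun j ψ hψ => by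
      simp only [mul_assoc]
      rw [integral_const_mul, hG' I j ψ hψ, hV' I _ (hψ.fderiv _)]
      ring⟩
  refine ⟨V, fun I j x => -1 * G I j x, hgrad, fun J hJ => ?_, ?_⟩
  · exact (hasWeakExtDeriv_of_dual h hθ hθ1 hu hc hV').ae_eq h.isOpen
      (fun I hI => by rw [coeff_formOfCoeff V hI]; exact hgrad I) hu hJ
  · set U := ∑ J ∈ incrTuples n (k + 1), l2NormSq D (coeff u J) with hU
    have hU0 : 0 ≤ U := Finset.sum_nonneg fun J _ => l2NormSq_nonneg _
    have hb : ∀ I j, l2NormSq D (fun x => -1 * G I j x) ≤ A ^ 2 * (n * (n * U)) := fun I j => by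
      have h1 : l2NormSq D (fun x => -1 * G I j x) = l2NormSq D (G I j) := by simp [l2NormSq]
      rw [h1]
      refine (hGA I j).trans ?_
      rw [Fintype.card_fin]
      gcongr
      refine (Finset.sum_le_sum fun i _ => l2NormSq_coeff_le u (Fin.cons i I)).trans_eq ?_
      simp [hU]
    calc _ ≤ ∑ I ∈ incrTuples n k, ∑ j : Fin n, A ^ 2 * (n * (n * U)) := by
          gcongr with I _ j _
          exact hb I j
      _ = N * (A ^ 2 * U) := by
          simp only [Finset.sum_const, nsmul_eq_mul, Finset.card_univ, Fintype.card_fin]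
          rw [hN]
          ring
      _ ≤ (N + 1) ^ 2 * (A ^ 2 * U) := by gcongr; nlinarith
      _ = _ := by
          rw [hAdef, starConst, starConst]
          ring

end LocalPotential

/-! ### The Poincaré inequality and its best constant -/

section Poincare

variable {n : ℕ} {D : Set (Eucl n)} {z : Eucl n} {ρ : ℝ} {f : Eucl n → ℝ} {G : Fin n → Eucl n → ℝ}

/-- For exponent zero the divergence of the flux is (∫ψ)θ - ψ. Testing the gradient of `f` with the
flux therefore yields `f` minus its average with weight `θ`. -/
theorem integral_mul_sub_eq_of_hasWeakGrad (h : StarShapedBall D z ρ) {θ : Eucl n → ℝ}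
    (hθ : IsTestFun (Metric.ball z ρ) θ) (hθ1 : ∫ x, θ x = 1) (hf : HasWeakGrad D f G)
    {ψ : Eucl n → ℝ} (hψ : IsTestFun D ψ) :
    ∫ x in D, (f x - ∫ y in D, f y * θ y) * ψ x = ∑ i, ∫ x in D, G i x *
      rayOp (fun t => t ^ 0) (Icc 0 1) (fun w => w i) θ ψ x := by
  have tη : ∀ i : Fin n, IsTestFun D (rayOp (fun t => t ^ 0) (Icc 0 1) (fun w => w i) θ ψ) :=
    fun i => h.isTestFun_rayOp hθ hψ isCompact_Icc le_rfl (continuous_pow 0).integrableOn_Icc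
      (continuous_coord i)
  have hθD : IsTestFun D θ := hθ.mono h.ball_subset
  have i1 : Integrable (fun x => f x * ψ x) (volume.restrict D) :=
    hf.memL2.integrable_mul (hψ.memL2 _)
  have i2 : Integrable (fun x => f x * θ x) (volume.restrict D) :=
    hf.memL2.integrable_mul (hθD.memL2 _)
  have e1 : ∑ i, ∫ x in D, G i x * rayOp (fun t => t ^ 0) (Icc 0 1) (fun w => w i) θ ψ x =
      -∫ x in D, f x * ((∫ w, ψ w) * θ x - ψ x) := by
    simp only [(hf.hasWeakPartial _ _ (tη _)), Finset.sum_neg_distrib]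
    rw [← integral_finsetSum _ fun i _ => hf.memL2.integrable_mul (((tη i).fderiv _).memL2 _)]
    simp only [← Finset.mul_sum, sum_fderiv_rayOp hθ.univ hψ.univ 0, hθ1]
    congr 2
    ext x
    ring
  have e2 : ∀ x, f x * ((∫ w, ψ w) * θ x - ψ x) = (∫ w, ψ w) * (f x * θ x) - f x * ψ x :=
    fun x => by ring
  rw [e1]
  simp only [e2, sub_mul]
  rw [integral_sub (i2.const_mul _) i1, integral_const_mul, integral_sub i1
    ((hψ.continuous.integrable_of_hasCompactSupport hψ.2.1).integrableOn.const_mul _),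
    integral_const_mul, setIntegral_eq_integral_of_forall_compl_eq_zero fun x hx => hψ.eq_zero hx]
  ring

/-- The dual operator bounds f - m, where m is the average with weight `θ`. If `f` has mean zero,
then ‖f - m‖² = ‖f‖² + m²|D|, so the bound passes to `f`. -/
theorem StarShapedBall.exists_poincare (hn : 1 ≤ n) (h : StarShapedBall D z ρ) :
    ∃ K : ℝ, 0 ≤ K ∧ ∀ f G, HasWeakGrad D f G → ∫ x in D, f x = 0 →
      l2NormSq D f ≤ K * ∑ j, l2NormSq D (G j) := by
  obtain ⟨C, -, hest⟩ := exists_bogovskii_estimate n 1 le_rfl hn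
  obtain ⟨θ, hθ, hθ1, ⟨K, hK⟩, -⟩ := hest D z ρ h
  refine ⟨√(max K 0) ^ 2 * Fintype.card (Fin n), by positivity, fun f G hf hf0 => ?_⟩
  obtain ⟨g, hg, hg', hgA⟩ := exists_memL2_adjoint hf.memL2_grad
    (fun i ψ => rayOp (fun t => t ^ 0) (Icc 0 1) (fun w => w i) θ ψ)
    (fun i ψ hψ => h.isTestFun_rayOp hθ hψ isCompact_Icc le_rfl
      (continuous_pow 0).integrableOn_Icc (continuous_coord i))
    (fun i ψ χ hψ hχ => rayOp_add_right isCompact_Icc (continuous_pow 0).integrableOn_Icc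
      (continuous_coord i) hθ.univ hψ.univ hχ.univ) (fun i s ψ _ => rayOp_smul_right s)
    (Real.sqrt_nonneg _) (fun i ψ hψ => exists_dual_bound (fun ψ hψ => hK 0 ψ hψ i) hψ)
  set m := ∫ y in D, f y * θ y with hm
  have hfm := hf.sub (hasWeakGrad_const h.volume_lt_top m)
  have heq : (fun x => f x - m) =ᵐ[volume.restrict D] g :=
    MemL2.ae_eq_of_integral h.isOpen hfm.memL2 hg fun ψ hψ => by
      rw [hg' ψ hψ, integral_mul_sub_eq_of_hasWeakGrad h hθ hθ1 hf hψ]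
  have : IsFiniteMeasure (volume.restrict D) := ⟨by simpa using h.volume_lt_top⟩
  have hfi : Integrable f (volume.restrict D) := MemLp.integrable (by norm_num) hf.memL2
  have h1 : ∫ x in D, (f x - m) ^ 2 = l2NormSq D f + m ^ 2 * volume.real D := by
    have e : ∀ x, (f x - m) ^ 2 = f x ^ 2 - 2 * m * f x + m ^ 2 := fun x => by ring
    have i3 : Integrable (fun x => f x ^ 2 - 2 * m * f x) (volume.restrict D) :=
      hf.memL2.integrableOn_sq.sub (hfi.const_mul _)
    simp only [e]
    rw [integral_add i3 (integrable_const _),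
      integral_sub hf.memL2.integrableOn_sq (hfi.const_mul _), integral_const_mul, hf0]
    simp [l2NormSq, mul_comm]
  have h2 : ∫ x in D, (f x - m) ^ 2 = ∫ x in D, g x ^ 2 :=
    integral_congr_ae (heq.mono fun x hx => by simp only [← hx])
  have h3 : 0 ≤ m ^ 2 * volume.real D := by positivity
  rw [mul_assoc]
  refine le_trans ?_ hgA
  linarith

theorem poincareConst_nonneg (D : Set (Eucl n)) : 0 ≤ poincareConst D :=
  Real.sInf_nonneg fun _ hK => hK.1

theorem StarShapedBall.diam_pos (hn : 1 ≤ n) (h : StarShapedBall D z ρ) : 0 < Metric.diam D :=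
  h.radius_pos.trans_le ((radius_le_diam_ball hn z h.radius_pos).trans h.diam_ball_le)

/-- The best constant in the Poincaré inequality is attained. -/
theorem StarShapedBall.l2NormSq_le (hn : 1 ≤ n) (h : StarShapedBall D z ρ)
    (hf : HasWeakGrad D f G) (hf0 : ∫ x in D, f x = 0) :
    l2NormSq D f ≤ (poincareConst D * Metric.diam D) ^ 2 * ∑ j, l2NormSq D (G j) := by
  have hd := h.diam_pos hn
  obtain ⟨K, hK, hK'⟩ := h.exists_poincare hn
  have hs := hf.h1SemiSq_eq h.isOpen
  have hs0 : 0 ≤ ∑ j, l2NormSq D (G j) := Finset.sum_nonneg fun j _ => l2NormSq_nonneg _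
  suffices h1 : √(l2NormSq D f) ≤
      poincareConst D * Metric.diam D * √(∑ j, l2NormSq D (G j)) by
    have h2 := pow_le_pow_left₀ (Real.sqrt_nonneg _) h1 2
    rwa [mul_pow, Real.sq_sqrt (l2NormSq_nonneg _), Real.sq_sqrt hs0] at h2
  set S := {K : ℝ | 0 ≤ K ∧ ∀ f : Eucl n → ℝ, MemH1 D f → ∫ x in D, f x = 0 →
    √(l2NormSq D f) ≤ K * Metric.diam D * √(h1SemiSq D f)} with hS
  -- The set of admissible constants has to be nonempty, as otherwise its infimum would be the
  -- default value zero.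
  have hne : √K / Metric.diam D ∈ S := by
    refine ⟨by positivity, fun g hg hg0 => ?_⟩
    rw [div_mul_cancel₀ _ hd.ne', ← Real.sqrt_mul hK]
    exact Real.sqrt_le_sqrt (hK' g _ hg.hasWeakGrad hg0)
  have hle : ∀ K ∈ S, √(l2NormSq D f) ≤ K * (Metric.diam D * √(∑ j, l2NormSq D (G j))) :=
    fun K hK => by
      rw [← mul_assoc, ← hs]
      exact hK.2 f hf.memH1 hf0
  rw [mul_assoc]
  -- If the gradient vanishes, one admissible constant already shows that `f` has norm zero;
  -- otherwise one can divide and pass to the infimum.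
  rcases (mul_nonneg hd.le (Real.sqrt_nonneg (∑ j, l2NormSq D (G j)))).eq_or_lt with h0 | h0
  · rw [← h0] at hle ⊢
    simpa using hle _ hne
  · rw [← div_le_iff₀ h0]
    exact le_csInf ⟨_, hne⟩ fun K hK => (div_le_iff₀ h0).2 (hle K hK)

end Poincare

/-! ### Smooth truncations -/

section Truncation

open Filter Topology

/-- Smooth approximations of the identity that vanish near zero and have bounded derivatives. -/
theorem exists_truncation : ∃ (g : ℕ → ℝ → ℝ) (C : ℝ), (∀ m, ContDiff ℝ ∞ (g m)) ∧
    (∀ (m : ℕ) (s : ℝ), |s| ≤ 1 / (m + 1) → g m s = 0) ∧ (∀ m s, |g m s| ≤ |s|) ∧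
    (∀ m s, |deriv (g m) s| ≤ C) ∧ (∀ s, Tendsto (fun m => g m s) atTop (𝓝 s)) ∧
    ∀ s, Tendsto (fun m => deriv (g m) s) atTop (𝓝 (if s = 0 then 0 else 1)) := by
  let b : ContDiffBump (0 : ℝ) := ⟨1, 2, one_pos, one_lt_two⟩
  set h : ℝ → ℝ := fun r => r * b r with hh
  have hhs : ContDiff ℝ ∞ h := contDiff_id.mul b.contDiff
  have hhc : HasCompactSupport h := b.hasCompactSupport.mul_left
  obtain ⟨C, hC⟩ := hhc.deriv.exists_bound_of_continuous (hhs.continuous_deriv (by simp))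
  set f : ℝ → ℝ := fun r => r - h r with hf
  have hfs : ContDiff ℝ ∞ f := contDiff_id.sub hhs
  have hf0 : ∀ r, |r| ≤ 1 → f r = 0 := fun r hr => by
    have : b r = 1 := b.one_of_mem_closedBall (by simpa [Real.norm_eq_abs] using hr)
    simp [hf, hh, this]
  have hf1 : ∀ r, 2 ≤ |r| → f r = r := fun r hr => by
    have : b r = 0 := b.zero_of_le_dist (by simpa [Real.dist_eq] using hr)
    simp [hf, hh, this]
  have hfle : ∀ r, |f r| ≤ |r| := fun r => by
    have e : f r = r * (1 - b r) := by simp only [hf, hh]; ring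
    rw [e, abs_mul]
    refine mul_le_of_le_one_right (abs_nonneg _) ?_
    rw [abs_le]
    constructor <;> linarith [b.nonneg (x := r), b.le_one (x := r)]
  have hf' : ∀ r, |deriv f r| ≤ 1 + C := fun r => by
    have e : deriv f r = 1 - deriv h r := by
      have h1 := (hasDerivAt_id r).sub ((hhs.differentiable (by simp)) r).hasDerivAt
      exact h1.deriv
    rw [e]
    have := hC r
    rw [Real.norm_eq_abs] at this
    calc |1 - deriv h r| ≤ |1| + |deriv h r| := abs_sub _ _
      _ ≤ 1 + C := by rw [abs_one]; linarith
  -- The profile `f` at scale 1/(m+1): zero up to this distance from the origin and the identity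
  -- beyond twice this distance. The bound of the derivative is invariant under the scaling.
  set g : ℕ → ℝ → ℝ := fun m s => ((m : ℝ) + 1)⁻¹ * f ((m + 1) * s) with hg
  have hm : ∀ m : ℕ, (0 : ℝ) < m + 1 := fun m => by positivity
  have hg' : ∀ m s, deriv (g m) s = deriv f ((m + 1) * s) := fun m s => by
    have h1 : HasDerivAt (fun s : ℝ => ((m : ℝ) + 1) * s) ((m : ℝ) + 1) s := by
      simpa using (hasDerivAt_id s).const_mul ((m : ℝ) + 1)
    have h2 := ((hfs.differentiable (by simp) (((m : ℝ) + 1) * s)).hasDerivAt.comp s h1).const_mul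
      ((m : ℝ) + 1)⁻¹
    have h3 : deriv (g m) s = ((m : ℝ) + 1)⁻¹ * (deriv f (((m : ℝ) + 1) * s) * (m + 1)) := h2.deriv
    rw [h3]
    field_simp [(hm m).ne']
  have hev : ∀ s : ℝ, s ≠ 0 → ∀ᶠ m : ℕ in atTop, 2 < |((m : ℝ) + 1) * s| := fun s hs => by
    have h1 : Tendsto (fun m : ℕ => ((m : ℝ) + 1) * |s|) atTop atTop :=
      (tendsto_atTop_add_const_right _ _ tendsto_natCast_atTop_atTop).atTop_mul_const
        (abs_pos.2 hs)
    filter_upwards [h1.eventually_gt_atTop 2] with m hm2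
    rwa [abs_mul, abs_of_pos (hm m)]
  refine ⟨g, 1 + C, fun m => contDiff_const.mul (hfs.comp (contDiff_const.mul contDiff_id)),
    fun m s hs => ?_, fun m s => ?_, fun m s => ?_, fun s => ?_, fun s => ?_⟩
  · simp only [hg]
    rw [hf0, mul_zero]
    rw [abs_mul, abs_of_pos (hm m)]
    rwa [le_div_iff₀ (hm m), mul_comm] at hs
  · simp only [hg]
    rw [abs_mul, abs_of_pos (inv_pos.2 (hm m)), inv_mul_le_iff₀ (hm m)]
    refine (hfle _).trans_eq ?_
    rw [abs_mul, abs_of_pos (hm m)]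
  · rw [hg']
    exact hf' _
  · rcases eq_or_ne s 0 with rfl | hs
    · have : ∀ m, g m 0 = 0 := fun m => by simp [hg, hf0]
      simp [this]
    · refine tendsto_const_nhds.congr' ?_
      filter_upwards [hev s hs] with m hm2
      simp only [hg]
      rw [hf1 _ hm2.le, inv_mul_cancel_left₀ (hm m).ne']
  · simp only [hg']
    rcases eq_or_ne s 0 with rfl | hs
    · have h1 : deriv f 0 = 0 := by
        have h2 : f =ᶠ[𝓝 0] fun _ => 0 := by
          filter_upwards [Metric.ball_mem_nhds (0 : ℝ) one_pos] with r hr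
          exact hf0 r (by simpa [Real.norm_eq_abs] using (mem_ball_zero_iff.1 hr).le)
        rw [h2.deriv_eq, deriv_const]
      simp [h1]
    · rw [if_neg hs]
      refine tendsto_const_nhds.congr' ?_
      filter_upwards [hev s hs] with m hm2
      have h2 : f =ᶠ[𝓝 (((m : ℝ) + 1) * s)] fun r => r := by
        filter_upwards [(continuous_abs.isOpen_preimage _ isOpen_Ioi).mem_nhds
          (show ((m : ℝ) + 1) * s ∈ abs ⁻¹' Ioi 2 from hm2)] with r hr
        exact hf1 r (le_of_lt hr)
      rw [h2.deriv_eq]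
      simp

end Truncation

/-! ### Extension by zero of products with a vanishing smooth factor -/

section ExtensionByZero

open Filter Topology

variable {n : ℕ} {Ω O : Set (Eucl n)} {a w : Eucl n → ℝ} {G : Fin n → Eucl n → ℝ} {A : ℝ}

theorem MemL2.bdd_mul (hw : MemL2 O w) (ha : AEStronglyMeasurable a (volume.restrict O))
    (hA : ∀ᵐ x ∂volume.restrict O, |a x| ≤ A) : MemL2 O fun x => a x * w x :=
  MemLp.of_le_mul hw (ha.mul (MemLp.aestronglyMeasurable hw)) (c := A) <| hA.mono fun x hx => by
    rw [norm_mul, Real.norm_eq_abs]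
    exact mul_le_mul_of_nonneg_right hx (norm_nonneg _)

theorem ContDiffOn.continuousOn_fderiv_apply (hΩ : IsOpen Ω) (ha : ContDiffOn ℝ ∞ a Ω)
    (e : Eucl n) : ContinuousOn (fun x => fderiv ℝ a x e) Ω :=
  (ha.continuousOn_fderiv_of_isOpen hΩ (by simp)).clm_apply continuousOn_const

/-- The support of `a` may reach the boundary of `O` inside `Ω`. The part of the support of `ψ`
where `|a| ≥ ε` is however closed, and it lies in `O` because `a` vanishes on the rest of `Ω`. -/
theorem IsTestFun.comp_mul (hΩ : IsOpen Ω) (ha : ContDiffOn ℝ ∞ a Ω)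
    (ha0 : ∀ x ∈ Ω \ O, a x = 0) {g : ℝ → ℝ} (hg : ContDiff ℝ ∞ g) {ε : ℝ} (hε : 0 < ε)
    (hg0 : ∀ s, |s| ≤ ε → g s = 0) {ψ : Eucl n → ℝ} (hψ : IsTestFun Ω ψ) :
    IsTestFun O fun x => g (a x) * ψ x := by
  have h1 : IsTestFun Ω fun x => g (a x) * ψ x := hψ.mul_contDiffOn hΩ (hg.comp_contDiffOn ha)
  refine ⟨h1.1, h1.2.1, ?_⟩
  have h2 : IsClosed (tsupport ψ ∩ (fun x => |a x|) ⁻¹' Ici ε) :=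
    (ha.continuousOn.mono hψ.2.2).abs.preimage_isClosed_of_isClosed (isClosed_tsupport ψ)
      isClosed_Ici
  refine (closure_minimal (fun x hx => ?_) h2).trans fun x hx => ?_
  · have h3 : g (a x) * ψ x ≠ 0 := hx
    refine ⟨subset_tsupport ψ (right_ne_zero_of_mul h3), ?_⟩
    by_contra h4
    exact left_ne_zero_of_mul h3 (hg0 _ (not_le.1 h4).le)
  · by_contra h3
    have h4 := ha0 x ⟨hψ.2.2 hx.1, h3⟩
    have h5 : ε ≤ |a x| := hx.2
    rw [h4, abs_zero] at h5
    linarith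

/-- The weak derivative of `w` is tested with the truncations `g m (a x) * ψ x`, and dominated
convergence gives the limit. The derivatives of the truncations tend to zero at the origin and to
one elsewhere, so the indicator of `a ≠ 0` remains in front of the derivative of `a`. -/
theorem HasWeakGrad.integral_mul_eq (hΩ : IsOpen Ω) (hO : IsOpen O) (hOΩ : O ⊆ Ω)
    (ha : ContDiffOn ℝ ∞ a Ω) (ha0 : ∀ x ∈ Ω \ O, a x = 0) (hA : ∀ x ∈ O, |a x| ≤ A) (j : Fin n)
    (hA' : ∀ x ∈ O, |fderiv ℝ a x (stdVec j)| ≤ A) (hw : HasWeakGrad O w G) {ψ : Eucl n → ℝ}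
    (hψ : IsTestFun Ω ψ) :
    ∫ x in O, G j x * (a x * ψ x) = -∫ x in O, w x *
      ((if a x = 0 then 0 else 1) * fderiv ℝ a x (stdVec j) * ψ x +
        a x * fderiv ℝ ψ x (stdVec j)) := by
  obtain ⟨g, C, hgs, hg0, hgle, hgC, hgt, hgt'⟩ := exists_truncation
  have hOm := hO.measurableSet
  have ac : AEStronglyMeasurable a (volume.restrict O) :=
    (ha.continuousOn.mono hOΩ).aestronglyMeasurable hOm
  have a'c : AEStronglyMeasurable (fun x => fderiv ℝ a x (stdVec j)) (volume.restrict O) :=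
    ((ha.continuousOn_fderiv_apply hΩ _).mono hOΩ).aestronglyMeasurable hOm
  have hψ' := hψ.fderiv (stdVec j)
  have key : ∀ m, ∫ x in O, G j x * (g m (a x) * ψ x) = -∫ x in O, w x *
      (deriv (g m) (a x) * fderiv ℝ a x (stdVec j) * ψ x +
        g m (a x) * fderiv ℝ ψ x (stdVec j)) := fun m => by
    rw [hw.hasWeakPartial j _ (hψ.comp_mul hΩ ha ha0 (hgs m) (by positivity) (hg0 m))]
    congr 1
    refine setIntegral_congr_fun hOm fun x hx => ?_
    have h1 : DifferentiableAt ℝ a x :=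
      ((ha.differentiableOn (by simp)).differentiableAt (hΩ.mem_nhds (hOΩ hx)))
    have h2 := (((hgs m).differentiable (by simp) (a x)).hasDerivAt.comp_hasFDerivAt x
      h1.hasFDerivAt).mul (hψ.differentiable x).hasFDerivAt
    have h3 : fderiv ℝ (fun x => g m (a x) * ψ x) x = _ := h2.fderiv
    simp only [h3, add_apply, smul_apply, smul_eq_mul,
      Function.comp_apply]
    ring
  have t1 : Tendsto (fun m => ∫ x in O, G j x * (g m (a x) * ψ x)) atTop
      (𝓝 (∫ x in O, G j x * (a x * ψ x))) := by
    refine tendsto_integral_of_dominated_convergence (fun x => A * ‖G j x * ψ x‖) (fun m => ?_)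
      (((hw.memL2_grad j).integrable_mul (hψ.memL2 _)).norm.const_mul A) (fun m => ?_)
      (Eventually.of_forall fun x => ((hgt _).mul_const _).const_mul _)
    · exact (MemLp.aestronglyMeasurable (hw.memL2_grad j)).mul
        (((hgs m).continuous.comp_aestronglyMeasurable ac).mul
          hψ.continuous.aestronglyMeasurable)
    · filter_upwards [ae_restrict_mem hOm] with x hx
      rw [mul_left_comm, norm_mul, Real.norm_eq_abs (g m (a x))]
      exact mul_le_mul_of_nonneg_right ((hgle m _).trans (hA x hx)) (norm_nonneg _)
  have t2 : Tendsto (fun m => ∫ x in O, w x * (deriv (g m) (a x) * fderiv ℝ a x (stdVec j) * ψ x +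
        g m (a x) * fderiv ℝ ψ x (stdVec j))) atTop
      (𝓝 (∫ x in O, w x * ((if a x = 0 then 0 else 1) * fderiv ℝ a x (stdVec j) * ψ x +
        a x * fderiv ℝ ψ x (stdVec j)))) := by
    refine tendsto_integral_of_dominated_convergence
      (fun x => C * A * ‖w x * ψ x‖ + A * ‖w x * fderiv ℝ ψ x (stdVec j)‖) (fun m => ?_)
      (((hw.memL2.integrable_mul (hψ.memL2 _)).norm.const_mul _).add
        ((hw.memL2.integrable_mul (hψ'.memL2 _)).norm.const_mul _)) (fun m => ?_)
      (Eventually.of_forall fun x => ((((hgt' _).mul_const _).mul_const _).add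
        ((hgt _).mul_const _)).const_mul _)
    · exact (MemLp.aestronglyMeasurable hw.memL2).mul
        ((((((hgs m).continuous_deriv (by simp)).comp_aestronglyMeasurable ac).mul a'c).mul
          hψ.continuous.aestronglyMeasurable).add
        (((hgs m).continuous.comp_aestronglyMeasurable ac).mul
          hψ'.continuous.aestronglyMeasurable))
    · filter_upwards [ae_restrict_mem hOm] with x hx
      have hC0 : 0 ≤ C := (abs_nonneg _).trans (hgC 0 0)
      have e1 : |deriv (g m) (a x)| * |fderiv ℝ a x (stdVec j)| ≤ C * A :=
        mul_le_mul (hgC m _) (hA' x hx) (abs_nonneg _) hC0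
      have e2 : |g m (a x)| ≤ A := (hgle m _).trans (hA x hx)
      calc ‖w x * (deriv (g m) (a x) * fderiv ℝ a x (stdVec j) * ψ x +
            g m (a x) * fderiv ℝ ψ x (stdVec j))‖
          ≤ ‖(deriv (g m) (a x) * fderiv ℝ a x (stdVec j)) * (w x * ψ x)‖ +
            ‖g m (a x) * (w x * fderiv ℝ ψ x (stdVec j))‖ := by
            refine (le_of_eq ?_).trans (norm_add_le _ _)
            congr 1
            ring
        _ ≤ _ := by
            rw [norm_mul, norm_mul (g m (a x)), norm_mul (deriv (g m) (a x))]
            exact add_le_add (mul_le_mul_of_nonneg_right e1 (norm_nonneg _))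
              (mul_le_mul_of_nonneg_right e2 (norm_nonneg _))
  exact tendsto_nhds_unique t1 (by simpa only [key] using t2.neg)

/-- Extension by zero of a product with a smooth function vanishing outside of `O`. -/
theorem HasWeakGrad.extend_mul (hΩ : IsOpen Ω) (hO : IsOpen O) (hOΩ : O ⊆ Ω)
    (ha : ContDiffOn ℝ ∞ a Ω) (ha0 : ∀ x ∈ Ω \ O, a x = 0) (hA : ∀ x ∈ O, |a x| ≤ A)
    (hA' : ∀ j, ∀ x ∈ O, |fderiv ℝ a x (stdVec j)| ≤ A) (hw : HasWeakGrad O w G) :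
    HasWeakGrad Ω (O.indicator fun x => a x * w x)
      fun j => O.indicator fun x => fderiv ℝ a x (stdVec j) * w x + a x * G j x := by
  have hOm := hO.measurableSet
  have ac : AEStronglyMeasurable a (volume.restrict O) :=
    (ha.continuousOn.mono hOΩ).aestronglyMeasurable hOm
  have a'c : ∀ j, AEStronglyMeasurable (fun x => fderiv ℝ a x (stdVec j)) (volume.restrict O) :=
    fun j => ((ha.continuousOn_fderiv_apply hΩ _).mono hOΩ).aestronglyMeasurable hOm
  have bA : ∀ᵐ x ∂volume.restrict O, |a x| ≤ A :=
    (ae_restrict_mem hOm).mono fun x hx => hA x hx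
  have bA' : ∀ j, ∀ᵐ x ∂volume.restrict O, |fderiv ℝ a x (stdVec j)| ≤ A := fun j =>
    (ae_restrict_mem hOm).mono fun x hx => hA' j x hx
  have m1 : MemL2 O fun x => a x * w x := hw.memL2.bdd_mul ac bA
  have m2 : ∀ j, MemL2 O fun x => fderiv ℝ a x (stdVec j) * w x := fun j =>
    hw.memL2.bdd_mul (a'c j) (bA' j)
  have m3 : ∀ j, MemL2 O fun x => a x * G j x := fun j => (hw.memL2_grad j).bdd_mul ac bA
  have mext : ∀ {f : Eucl n → ℝ}, MemL2 O f → MemL2 Ω (O.indicator f) := fun {f} hf => by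
    rw [MemL2, memLp_indicator_iff_restrict hOm, Measure.restrict_restrict_of_subset hOΩ]
    exact hf
  have hint : ∀ f ψ : Eucl n → ℝ, ∫ x in Ω, O.indicator f x * ψ x = ∫ x in O, f x * ψ x :=
    fun f ψ => by
      have : ∀ x, O.indicator f x * ψ x = O.indicator (fun x => f x * ψ x) x := fun x =>
        (Set.indicator_mul_left O f ψ).symm
      simp only [this]
      rw [setIntegral_indicator hOm, inter_eq_right.2 hOΩ]
  refine ⟨mext m1, fun j => mext (MemLp.add (m2 j) (m3 j)), fun j ψ hψ => ?_⟩
  rw [hint, hint]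
  have mχ : AEStronglyMeasurable (fun x => if a x = 0 then (0 : ℝ) else 1)
      (volume.restrict O) := by
    have h1 : Measurable fun s : ℝ => if s = 0 then (0 : ℝ) else 1 :=
      Measurable.ite (measurableSet_singleton 0) measurable_const measurable_const
    exact (h1.comp_aemeasurable ac.aemeasurable).aestronglyMeasurable
  have m4 : MemL2 O fun x => (if a x = 0 then 0 else 1) * (fderiv ℝ a x (stdVec j) * w x) :=
    (m2 j).bdd_mul mχ (A := 1) (Eventually.of_forall fun x => by split_ifs <;> simp)
  -- The indicator is removed: for test functions supported in `O` the ordinary product rule is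
  -- available, and comparing it with the limit identity shows that the derivative of `a` times `w`
  -- vanishes almost everywhere on `a = 0`.
  have hae : (fun x => (if a x = 0 then 0 else 1) * (fderiv ℝ a x (stdVec j) * w x))
      =ᵐ[volume.restrict O] fun x => fderiv ℝ a x (stdVec j) * w x := by
    refine MemL2.ae_eq_of_integral hO m4 (m2 j) fun χ hχ => ?_
    have h1 := hw.integral_mul_eq hΩ hO hOΩ ha ha0 hA j (hA' j) (hχ.mono hOΩ)
    have h2 := hw.hasWeakPartial j _ (hχ.mul_contDiffOn hO (ha.mono hOΩ))
    rw [h2, neg_inj] at h1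
    have h3 : ∫ x in O, w x * fderiv ℝ (fun x => a x * χ x) x (stdVec j) =
        (∫ x in O, fderiv ℝ a x (stdVec j) * w x * χ x) +
          ∫ x in O, a x * w x * fderiv ℝ χ x (stdVec j) := by
      rw [← integral_add ((m2 j).integrable_mul (hχ.memL2 _))
        (m1.integrable_mul ((hχ.fderiv _).memL2 _))]
      refine setIntegral_congr_fun hOm fun x hx => ?_
      have h4 : DifferentiableAt ℝ a x :=
        (ha.differentiableOn (by simp)).differentiableAt (hΩ.mem_nhds (hOΩ hx))
      simp only [fderiv_fun_mul h4 (hχ.differentiable x), add_apply,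
        smul_apply, smul_eq_mul]
      ring
    have h5 : ∫ x in O, w x * ((if a x = 0 then 0 else 1) * fderiv ℝ a x (stdVec j) * χ x +
          a x * fderiv ℝ χ x (stdVec j)) =
        (∫ x in O, (if a x = 0 then 0 else 1) * (fderiv ℝ a x (stdVec j) * w x) * χ x) +
          ∫ x in O, a x * w x * fderiv ℝ χ x (stdVec j) := by
      rw [← integral_add (m4.integrable_mul (hχ.memL2 _))
        (m1.integrable_mul ((hχ.fderiv _).memL2 _))]
      congr 1
      ext x
      ring
    linarith
  have h1 := hw.integral_mul_eq hΩ hO hOΩ ha ha0 hA j (hA' j) hψ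
  simp only [add_mul]
  rw [integral_add ((m2 j).integrable_mul (hψ.memL2 _)) ((m3 j).integrable_mul (hψ.memL2 _))]
  have h2 : ∫ x in O, fderiv ℝ a x (stdVec j) * w x * ψ x =
      ∫ x in O, (if a x = 0 then 0 else 1) * (fderiv ℝ a x (stdVec j) * w x) * ψ x :=
    integral_congr_ae (hae.mono fun x hx => congrArg (fun s => s * ψ x) hx.symm)
  have h3 : ∫ x in O, w x * ((if a x = 0 then 0 else 1) * fderiv ℝ a x (stdVec j) * ψ x +
        a x * fderiv ℝ ψ x (stdVec j)) =
      (∫ x in O, (if a x = 0 then 0 else 1) * (fderiv ℝ a x (stdVec j) * w x) * ψ x) +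
        ∫ x in O, a x * w x * fderiv ℝ ψ x (stdVec j) := by
    rw [← integral_add (m4.integrable_mul (hψ.memL2 _))
      (m1.integrable_mul ((hψ.fderiv _).memL2 _))]
    congr 1
    ext x
    ring
  have h4 : ∫ x in O, a x * G j x * ψ x = ∫ x in O, G j x * (a x * ψ x) := by
    congr 1
    ext x
    ring
  rw [h2, h4, h1, h3]
  ring

end ExtensionByZero

/-! ### Combinatorics of the chain and of the partition of unity -/

namespace StarChain

open Filter Topology

variable {n m : ℕ} {Ω : Set (Eucl n)} (S : StarChain Ω m) {x : Eucl n}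

theorem isOpen_piece (i : Fin (m + 1)) : IsOpen (S.piece i) := (S.starShaped (Sum.inl i)).isOpen

theorem isOpen_overlap (s : Fin m) : IsOpen (overlap S.piece s) :=
  (S.starShaped (Sum.inr s)).isOpen

theorem isOpen (S : StarChain Ω m) : IsOpen Ω := by
  have := S.iUnion_piece
  rw [this]
  exact isOpen_iUnion S.isOpen_piece

theorem piece_subset (i : Fin (m + 1)) : S.piece i ⊆ Ω := by
  conv_rhs => rw [S.iUnion_piece]
  exact subset_iUnion S.piece i

theorem overlap_subset (s : Fin m) : overlap S.piece s ⊆ Ω :=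
  inter_subset_left.trans (S.piece_subset _)

theorem exists_mem_piece (hx : x ∈ Ω) : ∃ i, x ∈ S.piece i := by
  rw [S.iUnion_piece] at hx
  exact mem_iUnion.1 hx

theorem val_le_succ {i i' : Fin (m + 1)} (hi : x ∈ S.piece i) (hi' : x ∈ S.piece i') :
    (i' : ℕ) ≤ i + 1 := by
  by_contra! h
  have := S.disjoint i i' h
  exact (this ▸ (⟨hi, hi'⟩ : x ∈ S.piece i ∩ S.piece i') : x ∈ (∅ : Set (Eucl n)))

theorem eq_or_eq_of_mem_overlap {s : Fin m} (hx : x ∈ overlap S.piece s) {i : Fin (m + 1)}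
    (hi : x ∈ S.piece i) : i = s.castSucc ∨ i = s.succ := by
  have h1 := S.val_le_succ hx.1 hi
  have h2 := S.val_le_succ hi hx.2
  simp only [Fin.ext_iff, Fin.val_castSucc, Fin.val_succ] at *
  omega

theorem overlap_unique {s s' : Fin m} (hx : x ∈ overlap S.piece s)
    (hx' : x ∈ overlap S.piece s') : s = s' := by
  have h1 := S.val_le_succ hx.1 hx'.2
  have h2 := S.val_le_succ hx'.1 hx.2
  simp only [Fin.ext_iff, Fin.val_castSucc, Fin.val_succ] at *
  omega

theorem mem_overlap_of_lt {i i' : Fin (m + 1)} (hi : x ∈ S.piece i) (hi' : x ∈ S.piece i')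
    (h : i < i') : ∃ s : Fin m, i = s.castSucc ∧ i' = s.succ ∧ x ∈ overlap S.piece s := by
  have h1 := S.val_le_succ hi hi'
  have h2 : (i : ℕ) < i' := h
  have h3 := i'.isLt
  obtain ⟨s, rfl⟩ : ∃ s : Fin m, i = s.castSucc := ⟨⟨i, by omega⟩, rfl⟩
  have h4 : i' = s.succ := by
    ext
    simp only [Fin.val_castSucc, Fin.val_succ] at *
    omega
  subst h4
  exact ⟨s, rfl, rfl, hi, hi'⟩

theorem mem_overlap_or_exists_unique (hx : x ∈ Ω) : (∃ s, x ∈ overlap S.piece s) ∨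
    ∃ i, x ∈ S.piece i ∧ (∀ i', x ∈ S.piece i' → i' = i) ∧ ∀ s, x ∉ overlap S.piece s := by
  by_cases h : ∃ s, x ∈ overlap S.piece s
  · exact Or.inl h
  · push Not at h
    obtain ⟨i, hi⟩ := S.exists_mem_piece hx
    refine Or.inr ⟨i, hi, fun i' hi' => ?_, h⟩
    by_contra hne
    rcases lt_or_gt_of_ne hne with h' | h'
    · obtain ⟨s, -, -, hs⟩ := S.mem_overlap_of_lt hi' hi h'
      exact h s hs
    · obtain ⟨s, -, -, hs⟩ := S.mem_overlap_of_lt hi hi' h'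
      exact h s hs

theorem φ_eq_zero (hx : x ∈ Ω) {i : Fin (m + 1)} (hi : x ∉ S.piece i) : S.φ i x = 0 :=
  S.φ_zero i x ⟨hx, hi⟩

theorem sum_indicator_piece_of_overlap {s : Fin m} (hx : x ∈ overlap S.piece s)
    (F : Fin (m + 1) → Eucl n → ℝ) :
    ∑ i, (S.piece i).indicator (F i) x = F s.castSucc x + F s.succ x := by
  rw [Fintype.sum_eq_add s.castSucc s.succ (Fin.castSucc_lt_succ).ne fun i hi =>
    indicator_of_notMem (fun h => ?_) _, indicator_of_mem hx.1, indicator_of_mem hx.2]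
  rcases S.eq_or_eq_of_mem_overlap hx h with h' | h'
  · exact hi.1 h'
  · exact hi.2 h'

theorem sum_indicator_piece_of_unique {i : Fin (m + 1)} (hi : x ∈ S.piece i)
    (h : ∀ i', x ∈ S.piece i' → i' = i) (F : Fin (m + 1) → Eucl n → ℝ) :
    ∑ i, (S.piece i).indicator (F i) x = F i x := by
  rw [Fintype.sum_eq_single i fun i' hi' => indicator_of_notMem (fun h' => hi' (h i' h')) _,
    indicator_of_mem hi]

theorem sum_indicator_overlap {s : Fin m} (hx : x ∈ overlap S.piece s)
    (F : Fin m → Eucl n → ℝ) :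
    ∑ t, (overlap S.piece t).indicator (F t) x = F s x := by
  rw [Fintype.sum_eq_single s fun t ht =>
    indicator_of_notMem (fun h => ht (S.overlap_unique h hx)) _, indicator_of_mem hx]

theorem sum_φ_of_overlap {s : Fin m} (hx : x ∈ overlap S.piece s) :
    S.φ s.castSucc x + S.φ s.succ x = 1 := by
  have hΩ := S.overlap_subset s hx
  rw [← S.φ_sum x hΩ, Fintype.sum_eq_add s.castSucc s.succ (Fin.castSucc_lt_succ).ne
    fun i hi => S.φ_eq_zero hΩ fun h => ?_]
  rcases S.eq_or_eq_of_mem_overlap hx h with h' | h'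
  · exact hi.1 h'
  · exact hi.2 h'

/-- The sum of the functions of the partition of unity up to the `s`-th one. -/
noncomputable def partialSum (s : Fin m) (x : Eucl n) : ℝ :=
  ∑ i ∈ Finset.univ.filter (· ≤ s.castSucc), S.φ i x

theorem contDiffOn_partialSum (s : Fin m) : ContDiffOn ℝ ∞ (S.partialSum s) Ω :=
  ContDiffOn.sum fun i _ => S.φ_smooth i

theorem partialSum_eq {s : Fin m} (hx : x ∈ overlap S.piece s) :
    S.partialSum s x = S.φ s.castSucc x := by
  refine Finset.sum_eq_single_of_mem _ (by simp) fun i hi hne =>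
    S.φ_eq_zero (S.overlap_subset s hx) fun h => ?_
  rcases S.eq_or_eq_of_mem_overlap hx h with rfl | rfl
  · exact hne rfl
  · simp at hi

theorem partialSum_mem (hx : x ∈ Ω) (s : Fin m) : S.partialSum s x ∈ Icc (0 : ℝ) 1 := by
  refine ⟨Finset.sum_nonneg fun i _ => (S.φ_mem i x hx).1, ?_⟩
  rw [← S.φ_sum x hx]
  exact Finset.sum_le_sum_of_subset_of_nonneg (Finset.subset_univ _)
    fun i _ _ => (S.φ_mem i x hx).1

/-- A point that lies in a piece up to the `s`-th and also in a later piece lies in the `s`-th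
overlap. Off this overlap the partial sum therefore contains all nonzero summands or none. -/
theorem partialSum_eq_zero_or_one (hx : x ∈ Ω) {s : Fin m} (hs : x ∉ overlap S.piece s) :
    S.partialSum s x = 0 ∨ S.partialSum s x = 1 := by
  by_cases h : ∃ i ≤ s.castSucc, x ∈ S.piece i
  · right
    obtain ⟨i, hi, hxi⟩ := h
    rw [← S.φ_sum x hx]
    refine Finset.sum_subset (Finset.subset_univ _) fun i' _ hi' =>
      S.φ_eq_zero hx fun hxi' => hs ?_
    simp only [Finset.mem_filter, Finset.mem_univ, true_and, not_le] at hi'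
    obtain ⟨t, h1, h2, h3⟩ := S.mem_overlap_of_lt hxi hxi' (hi.trans_lt hi')
    rw [h1] at hi
    rw [h2] at hi'
    have h4 : s = t := by
      simp only [Fin.ext_iff, Fin.le_def, Fin.lt_def, Fin.val_castSucc, Fin.val_succ] at *
      omega
    rwa [h4]
  · push Not at h
    exact Or.inl (Finset.sum_eq_zero fun i hi => S.φ_eq_zero hx (h i (by simpa using hi)))

theorem fderiv_eq_zero_of_extremal {f : Eucl n → ℝ} (hΩ : IsOpen Ω)
    (hf : ∀ y ∈ Ω, f y ∈ Icc (0 : ℝ) 1) (hx : x ∈ Ω) (h : f x = 0 ∨ f x = 1) :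
    fderiv ℝ f x = 0 := by
  rcases h with h | h
  · refine IsLocalMin.fderiv_eq_zero ?_
    filter_upwards [hΩ.mem_nhds hx] with y hy
    rw [h]
    exact (hf y hy).1
  · refine IsLocalMax.fderiv_eq_zero ?_
    filter_upwards [hΩ.mem_nhds hx] with y hy
    rw [h]
    exact (hf y hy).2

/-- This is the reason for the partial sums: the gradient of a single function of the partition may
live on two overlaps, that of a partial sum on one. Its components are smooth cut-offs in `Ω` that
vanish off the overlap. -/
theorem fderiv_partialSum_eq_zero (hx : x ∈ Ω) {s : Fin m} (hs : x ∉ overlap S.piece s) :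
    fderiv ℝ (S.partialSum s) x = 0 :=
  fderiv_eq_zero_of_extremal S.isOpen (fun _ hy => S.partialSum_mem hy s) hx
    (S.partialSum_eq_zero_or_one hx hs)

theorem fderiv_φ_eq_zero {i : Fin (m + 1)} (hi : x ∈ S.piece i)
    (h : ∀ i', x ∈ S.piece i' → i' = i) : S.φ i x = 1 ∧ fderiv ℝ (S.φ i) x = 0 := by
  have hx := S.piece_subset i hi
  have h1 : S.φ i x = 1 := by
    rw [← S.φ_sum x hx, Fintype.sum_eq_single i fun i' hi' =>
      S.φ_eq_zero hx fun h' => hi' (h i' h')]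
  exact ⟨h1, fderiv_eq_zero_of_extremal S.isOpen (S.φ_mem i) hx (Or.inr h1)⟩

theorem partialSum_eventuallyEq {s : Fin m} (hx : x ∈ overlap S.piece s) :
    S.partialSum s =ᶠ[𝓝 x] S.φ s.castSucc := by
  filter_upwards [(S.isOpen_overlap s).mem_nhds hx] with y hy using S.partialSum_eq hy

theorem fderiv_φ_castSucc {s : Fin m} (hx : x ∈ overlap S.piece s) :
    fderiv ℝ (S.φ s.castSucc) x = fderiv ℝ (S.partialSum s) x :=
  (S.partialSum_eventuallyEq hx).fderiv_eq.symm

/-- The two functions add up to one on the overlap, so bounds of the derivatives of the first are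
enough. This is why `CS` omits the last function of the partition. -/
theorem fderiv_φ_succ {s : Fin m} (hx : x ∈ overlap S.piece s) :
    fderiv ℝ (S.φ s.succ) x = -fderiv ℝ (S.partialSum s) x := by
  have h : S.φ s.succ =ᶠ[𝓝 x] fun y => 1 - S.φ s.castSucc y := by
    filter_upwards [(S.isOpen_overlap s).mem_nhds hx] with y hy
    linarith [S.sum_φ_of_overlap hy]
  rw [h.fderiv_eq, fderiv_const_sub, S.fderiv_φ_castSucc hx]

end StarChain

/-! ### Multiindex derivatives of order one and two -/

section MultiDeriv

variable {n : ℕ}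

theorem two_le_smoothness : minSmoothness ℝ 2 ≤ (∞ : WithTop ℕ∞) := by
  rw [minSmoothness_of_isRCLikeNormedField]
  exact WithTop.coe_le_coe.2 (le_top : (2 : ℕ∞) ≤ ⊤)

theorem iteratedFDeriv_eq_fderiv {N : ℕ} (hN : N = 1) (f : Eucl n → ℝ) (x : Eucl n)
    (w : Fin N → Eucl n) : ∀ e, (∀ q, w q = e) → iteratedFDeriv ℝ N f x w = fderiv ℝ f x e := by
  subst hN
  intro e he
  rw [iteratedFDeriv_one_apply, he]

theorem iteratedFDeriv_eq_fderiv_fderiv {N : ℕ} (hN : N = 2) (f : Eucl n → ℝ) (x : Eucl n)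
    (w : Fin N → Eucl n) : iteratedFDeriv ℝ N f x w =
      fderiv ℝ (fderiv ℝ f) x (w ⟨0, by omega⟩) (w ⟨1, by omega⟩) := by
  subst hN
  exact iteratedFDeriv_two_apply f x w

theorem multiDeriv_single (j : Fin n) (f : Eucl n → ℝ) (x : Eucl n) :
    multiDeriv (Pi.single j 1) f x = fderiv ℝ f x (stdVec j) := by
  refine iteratedFDeriv_eq_fderiv (by simp) f x _ _ fun q => ?_
  congr 1
  generalize finSigmaFinEquiv.symm q = p
  obtain ⟨i, r⟩ := p
  by_contra h
  simp only at h
  exact absurd r.isLt (by simp [Pi.single_eq_of_ne h])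

theorem sum_single_add (i j : Fin n) :
    ∑ q, (Pi.single i 1 + Pi.single j 1 : Fin n → ℕ) q = 2 := by
  simp [Finset.sum_add_distrib]

/-- The two slots carry the indices `i` and `j` in an order that need not be determined, since the
Hessian is symmetric. For `i ≠ j` each index occurs once, so the two slots carry different indices.
-/
theorem multiDeriv_single_add {Ω : Set (Eucl n)} (hΩ : IsOpen Ω) {f : Eucl n → ℝ}
    (hf : ContDiffOn ℝ ∞ f Ω) {x : Eucl n} (hx : x ∈ Ω) (i j : Fin n) :
    multiDeriv (Pi.single i 1 + Pi.single j 1) f x =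
      fderiv ℝ (fderiv ℝ f) x (stdVec i) (stdVec j) := by
  set α : Fin n → ℕ := Pi.single i 1 + Pi.single j 1 with hα
  have hN : ∑ q, α q = 2 := sum_single_add i j
  rw [multiDeriv, iteratedFDeriv_eq_fderiv_fderiv hN]
  set p := (finSigmaFinEquiv (n := α)).symm ⟨0, by rw [hN]; norm_num⟩ with hp
  set p' := (finSigmaFinEquiv (n := α)).symm ⟨1, by rw [hN]; norm_num⟩ with hp'
  have hpp : p ≠ p' := fun h => by
    have := finSigmaFinEquiv.symm.injective h
    simp at this
  have hsymm : fderiv ℝ (fderiv ℝ f) x (stdVec i) (stdVec j) =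
      fderiv ℝ (fderiv ℝ f) x (stdVec j) (stdVec i) :=
    (hf.contDiffAt (hΩ.mem_nhds hx)).isSymmSndFDerivAt two_le_smoothness _ _
  have hmem : ∀ q : (r : Fin n) × Fin (α r), q.1 = i ∨ q.1 = j := fun q => by
    by_contra! h
    exact absurd q.2.isLt (by simp [hα, Pi.single_eq_of_ne h.1, Pi.single_eq_of_ne h.2])
  have hne : i ≠ j → p.1 ≠ p'.1 := fun hij h => by
    have h1 : ∀ r, α r ≤ 1 := fun r => by
      simp only [hα, Pi.add_apply, Pi.single_apply]
      split_ifs with h1 h2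
      · exact absurd (h1.symm.trans h2) hij
      all_goals simp
    refine hpp ?_
    generalize p = p at h
    generalize p' = p' at h
    obtain ⟨r, a⟩ := p
    obtain ⟨r', a'⟩ := p'
    simp only at h
    subst h
    have : a = a' := by
      ext
      have := a.isLt
      have := a'.isLt
      have := h1 r
      omega
    rw [this]
  rcases hmem p with h | h <;> rcases hmem p' with h' | h'
  · have : i = j := by
      by_contra hij
      exact hne hij (h.trans h'.symm)
    rw [h, h', ← this]
  · rw [h, h']
  · rw [h, h', hsymm]
  · have : i = j := by
      by_contra hij
      exact hne hij (h.trans h'.symm)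
    rw [h, h', ← this]

end MultiDeriv

/-! ### Bounds in terms of the constants of the chain -/

namespace StarChain

variable {n m : ℕ} {Ω : Set (Eucl n)} (S : StarChain Ω m) {x : Eucl n}

theorem bddAbove_chain (F : Fin (m + 1) ⊕ Fin m → ℝ) : BddAbove (range F) :=
  (Set.finite_range F).bddAbove

theorem le_CT (c : ℝ) (l : ℕ) (t : Fin (m + 1) ⊕ Fin m) :
    max (starConst c l (chainDom S.piece t) (S.center t) (S.radius t))
      (starConst c (max (l - 1) 1) (chainDom S.piece t) (S.center t) (S.radius t)) ≤
      S.CT c l :=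
  le_ciSup (f := fun t => max (starConst c l (chainDom S.piece t) (S.center t) (S.radius t))
    (starConst c (max (l - 1) 1) (chainDom S.piece t) (S.center t) (S.radius t)))
    (bddAbove_chain _) t

/-- By linearity in `c` every numerical factor can be absorbed in the choice of `c`. -/
theorem CT_mul {s : ℝ} (hs : 0 ≤ s) (c : ℝ) (l : ℕ) : S.CT (s * c) l = s * S.CT c l := by
  have h : ∀ (l : ℕ) (D : Set (Eucl n)) (z : Eucl n) (r : ℝ),
      starConst (s * c) l D z r = s * starConst c l D z r := fun l D z r => by
    simp only [starConst]
    ring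
  simp only [CT, h, ← mul_max_of_nonneg _ _ hs]
  exact (Real.mul_iSup_of_nonneg hs _).symm

theorem le_CT_self (hn : 1 ≤ n) {c : ℝ} (hc : 0 ≤ c) (l : ℕ) : c ≤ S.CT c l :=
  ((S.starShaped (Sum.inl 0)).le_starConst hn hc l).trans
    ((le_max_left _ _).trans (S.le_CT c l (Sum.inl 0)))

theorem diam_chainDom_pos (hn : 1 ≤ n) (t : Fin (m + 1) ⊕ Fin m) :
    0 < Metric.diam (chainDom S.piece t) := (S.starShaped t).diam_pos hn

theorem poincareConst_mul_diam_le (t : Fin (m + 1) ⊕ Fin m) :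
    poincareConst (chainDom S.piece t) * Metric.diam (chainDom S.piece t) ≤ S.CP * S.DT :=
  mul_le_mul (le_ciSup (f := fun t => poincareConst (chainDom S.piece t)) (bddAbove_chain _) t)
    (le_ciSup (f := fun t => Metric.diam (chainDom S.piece t)) (bddAbove_chain _) t)
    Metric.diam_nonneg (Real.iSup_nonneg fun _ => poincareConst_nonneg _)

theorem CP_mul_DT_nonneg : 0 ≤ S.CP * S.DT :=
  mul_nonneg (Real.iSup_nonneg fun _ => poincareConst_nonneg _)
    (Real.iSup_nonneg fun _ => Metric.diam_nonneg)

theorem dT_pos (hn : 1 ≤ n) : 0 < S.dT := by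
  obtain ⟨t, ht⟩ := exists_eq_ciInf_of_finite (f := fun t => Metric.diam (chainDom S.piece t))
  rw [dT, ← ht]
  exact S.diam_chainDom_pos hn t

theorem dT_le (t : Fin (m + 1) ⊕ Fin m) : S.dT ≤ Metric.diam (chainDom S.piece t) :=
  ciInf_le (Set.finite_range _).bddBelow t

/-- The `s`-th overlap is among the neighbours, so the infimum is over a nonempty set and not the
default value zero. -/
theorem dT_le_overlapDiam (s : Fin m) : S.dT ≤ overlapDiam S.piece s.castSucc := by
  refine le_csInf ⟨_, mem_image_of_mem _ (Or.inl rfl : s ∈ _)⟩ ?_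
  rintro _ ⟨j, -, rfl⟩
  exact S.dT_le (Sum.inr j)

theorem bnd_le_CS {α : Fin n → ℕ} (hα : ∑ q, α q ≤ 2) (s : Fin m) :
    S.bnd α s.castSucc ≤ S.CS := by
  -- A finite index set makes the supremum in `CS` a maximum.
  have hfin : Finite {α : Fin n → ℕ // ∑ q, α q ≤ 2} := by
    refine Finite.of_injective (β := Fin n → Fin 3) (fun α q => ⟨α.1 q, ?_⟩) fun α β h => ?_
    · have := Finset.single_le_sum (f := α.1) (fun _ _ => Nat.zero_le _) (Finset.mem_univ q)
      have := α.2
      omega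
    · ext q
      simpa using congrArg Fin.val (congrFun h q)
  exact le_ciSup (f := fun p : {α : Fin n → ℕ // ∑ q, α q ≤ 2} × Fin m => S.bnd p.1.1 p.2.castSucc)
    (Set.finite_range _).bddAbove (⟨α, hα⟩, s)

theorem abs_multiDeriv_le (hn : 1 ≤ n) {α : Fin n → ℕ} (hα : ∑ q, α q ≤ 2) (s : Fin m)
    (hx : x ∈ Ω) : |multiDeriv α (S.φ s.castSucc) x| ≤ S.CS / S.dT ^ (∑ q, α q) := by
  have h1 := S.φ_deriv s.castSucc α x hx
  have hd := S.dT_pos hn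
  have hd' := S.dT_le_overlapDiam s
  -- The constant bounds an absolute value after division by a positive number, so it is
  -- nonnegative.
  have h2 : 0 ≤ S.bnd α s.castSucc := by
    have h3 := (abs_nonneg _).trans h1
    by_contra! h4
    exact absurd h3 (not_le.2 (div_neg_of_neg_of_pos h4 (pow_pos (hd.trans_le hd') _)))
  refine h1.trans ?_
  exact div_le_div₀ (h2.trans (S.bnd_le_CS hα s)) (S.bnd_le_CS hα s) (pow_pos hd _)
    (pow_le_pow_left₀ hd.le hd' _)

theorem abs_fderiv_partialSum_le (hn : 1 ≤ n) {s : Fin m} (hx : x ∈ overlap S.piece s)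
    (j : Fin n) : |fderiv ℝ (S.partialSum s) x (stdVec j)| ≤ S.CS / S.dT := by
  have h := S.abs_multiDeriv_le hn (α := Pi.single j 1) (by simp) s (S.overlap_subset s hx)
  rwa [multiDeriv_single, S.fderiv_φ_castSucc hx, Finset.sum_pi_single', if_pos (Finset.mem_univ _),
    pow_one] at h

theorem fderiv_fderiv_partialSum (hx : x ∈ Ω) (s : Fin m) (j l : Fin n) :
    fderiv ℝ (fun y => fderiv ℝ (S.partialSum s) y (stdVec l)) x (stdVec j) =
      fderiv ℝ (fderiv ℝ (S.partialSum s)) x (stdVec j) (stdVec l) := by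
  have h1 : DifferentiableAt ℝ (fderiv ℝ (S.partialSum s)) x :=
    (((S.contDiffOn_partialSum s).contDiffAt (S.isOpen.mem_nhds hx)).fderiv_right
      (m := ∞) (by simp)).differentiableAt (by simp)
  rw [fderiv_clm_apply h1 (by fun_prop)]
  simp

theorem fderiv_fderiv_partialSum_comm (hx : x ∈ Ω) (s : Fin m) (j l : Fin n) :
    fderiv ℝ (fun y => fderiv ℝ (S.partialSum s) y (stdVec l)) x (stdVec j) =
      fderiv ℝ (fun y => fderiv ℝ (S.partialSum s) y (stdVec j)) x (stdVec l) := by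
  rw [S.fderiv_fderiv_partialSum hx, S.fderiv_fderiv_partialSum hx]
  exact ((S.contDiffOn_partialSum s).contDiffAt (S.isOpen.mem_nhds hx)).isSymmSndFDerivAt
    two_le_smoothness _ _

theorem abs_fderiv_fderiv_partialSum_le (hn : 1 ≤ n) {s : Fin m} (hx : x ∈ overlap S.piece s)
    (j l : Fin n) :
    |fderiv ℝ (fun y => fderiv ℝ (S.partialSum s) y (stdVec l)) x (stdVec j)| ≤
      S.CS / S.dT ^ 2 := by
  have hΩ := S.overlap_subset s hx
  have h := S.abs_multiDeriv_le hn (sum_single_add j l).le s hΩ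
  have h1 : fderiv ℝ (fderiv ℝ (S.φ s.castSucc)) x = fderiv ℝ (fderiv ℝ (S.partialSum s)) x :=
    (S.partialSum_eventuallyEq hx).fderiv.fderiv_eq.symm
  rwa [multiDeriv_single_add S.isOpen (S.φ_smooth _) hΩ, sum_single_add, h1,
    ← S.fderiv_fderiv_partialSum hΩ] at h

/-- Only finiteness matters: the bound makes the extension by zero admissible and enters no
estimate. It is available for the last function and for a chain of one piece, where `overlapDiam` is
zero and the quotient is zero by convention. -/
theorem exists_bound_fderiv_φ (i : Fin (m + 1)) : ∃ A : ℝ, ∀ x ∈ S.piece i, |S.φ i x| ≤ A ∧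
    ∀ j, |fderiv ℝ (S.φ i) x (stdVec j)| ≤ A := by
  set B : Fin n → ℝ := fun j => S.bnd (Pi.single j 1) i / overlapDiam S.piece i
  have hB : ∀ x ∈ Ω, ∀ j, |fderiv ℝ (S.φ i) x (stdVec j)| ≤ B j := fun x hx j => by
    have h := S.φ_deriv i (Pi.single j 1) x hx
    rwa [multiDeriv_single, Finset.sum_pi_single', if_pos (Finset.mem_univ _), pow_one] at h
  refine ⟨1 + ∑ j, |B j|, fun x hx => ⟨?_, fun j => ?_⟩⟩
  · have := S.φ_mem i x (S.piece_subset i hx)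
    rw [abs_of_nonneg this.1]
    have : 0 ≤ ∑ j, |B j| := Finset.sum_nonneg fun j _ => abs_nonneg _
    linarith
  · have h1 := Finset.single_le_sum (f := fun j => |B j|) (fun j _ => abs_nonneg _)
      (Finset.mem_univ j)
    linarith [(hB x (S.piece_subset i hx) j).trans (le_abs_self _)]

end StarChain

/-! ### Subtraction of mean values -/

section Normalization

variable {n : ℕ} {D : Set (Eucl n)} {z : Eucl n} {ρ : ℝ} {f : Eucl n → ℝ} {G : Fin n → Eucl n → ℝ}

theorem HasWeakGrad.sub_const (hD : volume D < ⊤) (hf : HasWeakGrad D f G) (c : ℝ) :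
    HasWeakGrad D (fun x => f x - c) G := by
  simpa using hf.sub (hasWeakGrad_const hD c)

theorem integral_sub_average (hD : volume D < ⊤) (hD0 : 0 < volume.real D) (hf : MemL2 D f) :
    ∫ x in D, (f x - (volume.real D)⁻¹ * ∫ y in D, f y) = 0 := by
  have : IsFiniteMeasure (volume.restrict D) := ⟨by simpa using hD⟩
  rw [integral_sub (MemLp.integrable (by norm_num) hf) (integrable_const _), integral_const,
    measureReal_restrict_apply_univ, smul_eq_mul, mul_inv_cancel_left₀ hD0.ne', sub_self]

theorem StarShapedBall.volume_real_pos (h : StarShapedBall D z ρ) : 0 < volume.real D :=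
  (volume_real_ball_pos z h.radius_pos).trans_le
    (measureReal_mono h.ball_subset h.volume_lt_top.ne)

end Normalization

/-! ### Gluing on the pieces and correction on the overlaps -/

namespace StarChain

variable {n m : ℕ} {Ω : Set (Eucl n)} (S : StarChain Ω m) {x : Eucl n}

/-- Functions on the pieces, glued by the partition of unity. -/
noncomputable def glue (V : Fin (m + 1) → Eucl n → ℝ) (x : Eucl n) : ℝ :=
  ∑ i, (S.piece i).indicator (fun x => S.φ i x * V i x) x

/-- The weak gradient of `glue`. -/
noncomputable def glueGrad (V : Fin (m + 1) → Eucl n → ℝ) (G : Fin (m + 1) → Fin n → Eucl n → ℝ)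
    (j : Fin n) (x : Eucl n) : ℝ :=
  ∑ i, (S.piece i).indicator
    (fun x => fderiv ℝ (S.φ i) x (stdVec j) * V i x + S.φ i x * G i j x) x

/-- Functions on the overlaps, multiplied by a partial derivative of the partition of unity. -/
noncomputable def bridge (l : Fin n) (w : Fin m → Eucl n → ℝ) (x : Eucl n) : ℝ :=
  ∑ s, (overlap S.piece s).indicator
    (fun x => fderiv ℝ (S.partialSum s) x (stdVec l) * w s x) x

/-- The weak gradient of `bridge`. -/
noncomputable def bridgeGrad (l : Fin n) (w : Fin m → Eucl n → ℝ)
    (H : Fin m → Fin n → Eucl n → ℝ) (j : Fin n) (x : Eucl n) : ℝ :=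
  ∑ s, (overlap S.piece s).indicator (fun x =>
    fderiv ℝ (fun y => fderiv ℝ (S.partialSum s) y (stdVec l)) x (stdVec j) * w s x +
      fderiv ℝ (S.partialSum s) x (stdVec l) * H s j x) x

variable {V : Fin (m + 1) → Eucl n → ℝ} {G : Fin (m + 1) → Fin n → Eucl n → ℝ}
  {w : Fin m → Eucl n → ℝ} {H : Fin m → Fin n → Eucl n → ℝ}

theorem hasWeakGrad_glue (h : ∀ i, HasWeakGrad (S.piece i) (V i) (G i)) :
    HasWeakGrad Ω (S.glue V) (S.glueGrad V G) := by
  refine HasWeakGrad.sum Finset.univ fun i _ => ?_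
  obtain ⟨A, hA⟩ := S.exists_bound_fderiv_φ i
  exact (h i).extend_mul S.isOpen (S.isOpen_piece i) (S.piece_subset i) (S.φ_smooth i) (S.φ_zero i)
    (fun x hx => (hA x hx).1) fun j x hx => (hA x hx).2 j

theorem hasWeakGrad_bridge (hn : 1 ≤ n) (l : Fin n)
    (h : ∀ s, HasWeakGrad (overlap S.piece s) (w s) (H s)) :
    HasWeakGrad Ω (S.bridge l w) (S.bridgeGrad l w H) := by
  refine HasWeakGrad.sum Finset.univ fun s _ => ?_
  refine (h s).extend_mul S.isOpen (S.isOpen_overlap s) (S.overlap_subset s)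
    (((S.contDiffOn_partialSum s).fderiv_of_isOpen S.isOpen (m := ∞) (by simp)).clm_apply
      contDiffOn_const) (fun x hx => by simp [S.fderiv_partialSum_eq_zero hx.1 hx.2])
    (A := max (S.CS / S.dT) (S.CS / S.dT ^ 2))
    (fun x hx => (S.abs_fderiv_partialSum_le hn hx l).trans (le_max_left _ _))
    fun j x hx => (S.abs_fderiv_fderiv_partialSum_le hn hx j l).trans (le_max_right _ _)

theorem glueGrad_of_overlap {s : Fin m} (hx : x ∈ overlap S.piece s) (j : Fin n) :
    S.glueGrad V G j x = S.φ s.castSucc x * G s.castSucc j x + S.φ s.succ x * G s.succ j x +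
      fderiv ℝ (S.partialSum s) x (stdVec j) * (V s.castSucc x - V s.succ x) := by
  rw [glueGrad, S.sum_indicator_piece_of_overlap hx, S.fderiv_φ_castSucc hx, S.fderiv_φ_succ hx,
    neg_apply]
  ring

theorem glueGrad_of_unique {i : Fin (m + 1)} (hi : x ∈ S.piece i)
    (h : ∀ i', x ∈ S.piece i' → i' = i) (j : Fin n) : S.glueGrad V G j x = G i j x := by
  obtain ⟨h1, h2⟩ := S.fderiv_φ_eq_zero hi h
  rw [glueGrad, S.sum_indicator_piece_of_unique hi h, h1, h2]
  simp

theorem bridgeGrad_of_overlap {s : Fin m} (hx : x ∈ overlap S.piece s) (l j : Fin n) :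
    S.bridgeGrad l w H j x =
      fderiv ℝ (fun y => fderiv ℝ (S.partialSum s) y (stdVec l)) x (stdVec j) * w s x +
      fderiv ℝ (S.partialSum s) x (stdVec l) * H s j x := by
  rw [bridgeGrad, S.sum_indicator_overlap hx]

theorem bridgeGrad_of_notMem (hx : ∀ s, x ∉ overlap S.piece s) (l j : Fin n) :
    S.bridgeGrad l w H j x = 0 :=
  Finset.sum_eq_zero fun s _ => indicator_of_notMem (hx s) _

/-- Constants can be added such that the differences on the overlaps have mean value zero. -/
theorem exists_integral_sub_eq_zero (h : ∀ i, HasWeakGrad (S.piece i) (V i) (G i)) :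
    ∃ V' : Fin (m + 1) → Eucl n → ℝ, (∀ i, HasWeakGrad (S.piece i) (V' i) (G i)) ∧
      ∀ s : Fin m, ∫ x in overlap S.piece s, (V' s.castSucc x - V' s.succ x) = 0 := by
  set μ : Fin m → ℝ := fun s => (volume.real (overlap S.piece s))⁻¹ *
    ∫ x in overlap S.piece s, (V s.castSucc x - V s.succ x) with hμ
  -- The means are accumulated along the chain, so that consecutive constants differ by exactly the
  -- mean on the overlap between them.
  set c : Fin (m + 1) → ℝ := fun i => ∑ t ∈ Finset.univ.filter (fun t : Fin m => t.castSucc < i), -μ t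
    with hc
  have hcs : ∀ s : Fin m, c s.succ = c s.castSucc - μ s := fun s => by
    have h1 : Finset.univ.filter (fun t : Fin m => t.castSucc < s.succ) =
        insert s (Finset.univ.filter (fun t : Fin m => t.castSucc < s.castSucc)) := by
      ext t
      simp only [Finset.mem_filter, Finset.mem_univ, true_and, Finset.mem_insert, Fin.lt_def,
        Fin.val_castSucc, Fin.val_succ, Fin.ext_iff]
      omega
    simp only [hc]
    rw [h1, Finset.sum_insert (by simp)]
    ring
  have hv : ∀ t, volume (chainDom S.piece t) < ⊤ := fun t => (S.starShaped t).volume_lt_top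
  refine ⟨fun i x => V i x - c i, fun i => (h i).sub_const (hv (Sum.inl i)) _, fun s => ?_⟩
  have hs := S.starShaped (Sum.inr s)
  have h1 := ((h s.castSucc).mono (Ω' := overlap S.piece s) inter_subset_left).sub
    ((h s.succ).mono inter_subset_right)
  rw [← integral_sub_average hs.volume_lt_top hs.volume_real_pos h1.memL2]
  congr 1
  ext x
  change V s.castSucc x - c s.castSucc - (V s.succ x - c s.succ) = V s.castSucc x - V s.succ x - μ s
  rw [hcs]
  ring

theorem setIntegral_indicator_subset {O : Set (Eucl n)} (hO : IsOpen O) (h : O ⊆ Ω)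
    (f : Eucl n → ℝ) : ∫ x in Ω, O.indicator f x = ∫ x in O, f x := by
  rw [setIntegral_indicator hO.measurableSet, inter_eq_right.2 h]

theorem integrable_indicator_subset {O : Set (Eucl n)} (hO : IsOpen O) (h : O ⊆ Ω)
    {f : Eucl n → ℝ} (hf : IntegrableOn f O) :
    Integrable (O.indicator f) (volume.restrict Ω) := by
  rw [integrable_indicator_iff hO.measurableSet, IntegrableOn,
    Measure.restrict_restrict_of_subset h]
  exact hf

theorem integral_le_sum_add_sum {F : Eucl n → ℝ} {A : Fin (m + 1) → Eucl n → ℝ}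
    {B : Fin m → Eucl n → ℝ} (hF : ∀ x, 0 ≤ F x) (hA : ∀ i, IntegrableOn (A i) (S.piece i))
    (hB : ∀ s, IntegrableOn (B s) (overlap S.piece s))
    (h : ∀ x ∈ Ω, F x ≤ ∑ i, (S.piece i).indicator (A i) x +
      ∑ s, (overlap S.piece s).indicator (B s) x) :
    ∫ x in Ω, F x ≤ ∑ i, (∫ x in S.piece i, A i x) + ∑ s, ∫ x in overlap S.piece s, B s x := by
  have iA := fun i => integrable_indicator_subset (S.isOpen_piece i) (S.piece_subset i) (hA i)
  have iB := fun s => integrable_indicator_subset (S.isOpen_overlap s) (S.overlap_subset s) (hB s)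
  simp only [← setIntegral_indicator_subset (S.isOpen_piece _) (S.piece_subset _),
    ← setIntegral_indicator_subset (S.isOpen_overlap _) (S.overlap_subset _)]
  rw [← integral_finsetSum _ fun i _ => iA i, ← integral_finsetSum _ fun i _ => iB i,
    ← integral_add (integrable_finsetSum _ fun i _ => iA i)
      (integrable_finsetSum _ fun i _ => iB i)]
  refine integral_mono_of_nonneg (Filter.Eventually.of_forall hF)
    ((integrable_finsetSum _ fun i _ => iA i).add (integrable_finsetSum _ fun i _ => iB i)) ?_
  filter_upwards [ae_restrict_mem S.isOpen.measurableSet] with x hx using h x hx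

/-- No point lies in more than two pieces. This and the next lemma keep the final constant
independent of the length of the chain. -/
theorem sum_l2NormSq_piece_le {f : Eucl n → ℝ} (hf : MemL2 Ω f) :
    ∑ i, l2NormSq (S.piece i) f ≤ 2 * l2NormSq Ω f := by
  have i0 := hf.integrableOn_sq
  have iA := fun i => integrable_indicator_subset (S.isOpen_piece i) (S.piece_subset i)
    (i0.mono_set (S.piece_subset i))
  simp only [l2NormSq]
  simp only [← setIntegral_indicator_subset (S.isOpen_piece _) (S.piece_subset _)]
  rw [← integral_finsetSum _ fun i _ => iA i, ← integral_const_mul]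
  refine setIntegral_mono_on (integrable_finsetSum _ fun i _ => iA i) (i0.const_mul 2)
    S.isOpen.measurableSet fun x hx => ?_
  have h0 := sq_nonneg (f x)
  rcases S.mem_overlap_or_exists_unique hx with ⟨s, hs⟩ | ⟨i, hi, h', -⟩
  · rw [S.sum_indicator_piece_of_overlap hs]
    linarith
  · rw [S.sum_indicator_piece_of_unique hi h']
    linarith

theorem sum_castSucc_add_succ_le {a : Fin (m + 1) → ℝ} (ha : ∀ i, 0 ≤ a i) :
    ∑ s : Fin m, (a s.castSucc + a s.succ) ≤ 2 * ∑ i, a i := by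
  rw [Finset.sum_add_distrib, two_mul]
  have h1 := Fin.sum_univ_castSucc a
  have h2 := Fin.sum_univ_succ a
  linarith [ha 0, ha (Fin.last m)]

end StarChain

/-! ### Norms of forms and monotonicity of the constants -/

section FormNorms

variable {n k : ℕ} {Ω Ω' : Set (Eucl n)}

theorem l2NormSq_mono {f : Eucl n → ℝ} (hf : MemL2 Ω f) (h : Ω' ⊆ Ω) :
    l2NormSq Ω' f ≤ l2NormSq Ω f :=
  setIntegral_mono_set hf.integrableOn_sq (Filter.Eventually.of_forall fun _ => sq_nonneg _)
    h.eventuallyLE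

theorem l2NormSq_sub_le {f g : Eucl n → ℝ} (hf : MemL2 Ω f) (hg : MemL2 Ω g) :
    l2NormSq Ω (fun x => f x - g x) ≤ 2 * (l2NormSq Ω f + l2NormSq Ω g) := by
  have h := integral_sq_add_le hf.integrableOn_sq (g := fun x => -g x)
    (by simp only [neg_sq]; exact hg.integrableOn_sq)
  simp only [l2NormSq, sub_eq_add_neg, neg_sq] at h ⊢
  linarith

theorem formH1Semi_le (hΩ : IsOpen Ω) {v : Eucl n → Forms n k} {u : Eucl n → Forms n (k + 1)}
    {G : (Fin k → Fin n) → Fin n → Eucl n → ℝ}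
    (h : ∀ I ∈ incrTuples n k, HasWeakGrad Ω (coeff v I) (G I)) {B : ℝ} (hB : 0 ≤ B)
    (hle : ∑ I ∈ incrTuples n k, ∑ j, l2NormSq Ω (G I j) ≤
      B ^ 2 * ∑ J ∈ incrTuples n (k + 1), l2NormSq Ω (coeff u J)) :
    formH1Semi Ω v ≤ B * formL2Norm Ω u := by
  rw [formH1Semi, formL2Norm, Finset.sum_congr rfl fun I hI => (h I hI).h1SemiSq_eq hΩ,
    ← Real.sqrt_sq hB, ← Real.sqrt_mul (sq_nonneg B)]
  exact Real.sqrt_le_sqrt hle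

theorem StarShapedBall.starConst_mono {D : Set (Eucl n)} {z : Eucl n} {ρ : ℝ} (hn : 1 ≤ n)
    (h : StarShapedBall D z ρ) {c c' : ℝ} (hc : c ≤ c') (l : ℕ) :
    starConst c l D z ρ ≤ starConst c' l D z ρ := by
  have h1 := zero_le_one.trans (h.le_starConst hn zero_le_one l)
  have e : ∀ c, starConst c l D z ρ = c * starConst 1 l D z ρ := fun c => by
    simp only [starConst]
    ring
  rw [e c, e c']
  gcongr

end FormNorms

/-! ### Potentials on the pieces and on the overlaps -/

namespace StarChain

variable {n m k : ℕ} {Ω : Set (Eucl n)} (S : StarChain Ω m) {x : Eucl n}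

theorem ae_of_ae_piece {P : Fin (m + 1) → Eucl n → Prop}
    (h : ∀ i, ∀ᵐ x ∂volume.restrict (S.piece i), P i x) :
    ∀ᵐ x ∂volume.restrict Ω, ∀ i, x ∈ S.piece i → P i x := by
  refine ae_restrict_of_ae (ae_all_iff.2 fun i => ?_)
  exact (ae_restrict_iff' (S.isOpen_piece i).measurableSet).1 (h i)

theorem ae_of_ae_overlap {P : Fin m → Eucl n → Prop}
    (h : ∀ s, ∀ᵐ x ∂volume.restrict (overlap S.piece s), P s x) :
    ∀ᵐ x ∂volume.restrict Ω, ∀ s, x ∈ overlap S.piece s → P s x := by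
  refine ae_restrict_of_ae (ae_all_iff.2 fun s => ?_)
  exact (ae_restrict_iff' (S.isOpen_overlap s).measurableSet).1 (h s)

theorem l2NormSq_overlap_le (s : Fin m) {f : Eucl n → ℝ} {G : Fin n → Eucl n → ℝ}
    (hn : 1 ≤ n) (hf : HasWeakGrad (overlap S.piece s) f G)
    (hf0 : ∫ x in overlap S.piece s, f x = 0) :
    l2NormSq (overlap S.piece s) f ≤
      (S.CP * S.DT) ^ 2 * ∑ j, l2NormSq (overlap S.piece s) (G j) := by
  refine ((S.starShaped (Sum.inr s)).l2NormSq_le hn hf hf0).trans ?_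
  refine mul_le_mul_of_nonneg_right (pow_le_pow_left₀
    (mul_nonneg (poincareConst_nonneg _) Metric.diam_nonneg)
    (S.poincareConst_mul_diam_le (Sum.inr s)) 2) (Finset.sum_nonneg fun j _ => l2NormSq_nonneg _)

/-- Potentials on the pieces. The constant `Y` bounds the local constants. -/
structure IsPiecePotential (S : StarChain Ω m) (u : Eucl n → Forms n (k + 1)) (Y : ℝ)
    (V : (Fin k → Fin n) → Fin (m + 1) → Eucl n → ℝ)
    (G : (Fin k → Fin n) → Fin (m + 1) → Fin n → Eucl n → ℝ) : Prop where
  hasWeakGrad : ∀ I i, HasWeakGrad (S.piece i) (V I i) (G I i)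
  ae_eq : ∀ i, ∀ J ∈ incrTuples n (k + 1), coeff u J =ᵐ[volume.restrict (S.piece i)] fun x =>
    ∑ p : Fin (k + 1), (-1 : ℝ) ^ (p : ℕ) * G (fun q => J (p.succAbove q)) i (J p) x
  energy_le : ∀ i, ∑ I ∈ incrTuples n k, ∑ j, l2NormSq (S.piece i) (G I i j) ≤
    Y ^ 2 * ∑ J ∈ incrTuples n (k + 1), l2NormSq (S.piece i) (coeff u J)
  integral_eq_zero : ∀ I s, ∫ x in overlap S.piece s, (V I s.castSucc x - V I s.succ x) = 0

/-- Potentials on the overlaps of the differences of potentials on the pieces. -/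
structure IsOverlapPotential (S : StarChain Ω m) (Y : ℝ)
    (V : (Fin (k + 1) → Fin n) → Fin (m + 1) → Eucl n → ℝ)
    (W : (Fin k → Fin n) → Fin m → Eucl n → ℝ)
    (H : (Fin k → Fin n) → Fin m → Fin n → Eucl n → ℝ) : Prop where
  hasWeakGrad : ∀ K s, HasWeakGrad (overlap S.piece s) (W K s) (H K s)
  ae_eq : ∀ s, ∀ I ∈ incrTuples n (k + 1), (fun x => V I s.castSucc x - V I s.succ x)
    =ᵐ[volume.restrict (overlap S.piece s)] fun x =>
      ∑ q : Fin (k + 1), (-1 : ℝ) ^ (q : ℕ) * H (fun r => I (q.succAbove r)) s (I q) x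
  energy_le : ∀ s, ∑ K ∈ incrTuples n k, ∑ j, l2NormSq (overlap S.piece s) (H K s j) ≤
    Y ^ 2 * ∑ I ∈ incrTuples n (k + 1),
      l2NormSq (overlap S.piece s) fun x => V I s.castSucc x - V I s.succ x
  l2_le : ∀ s, ∑ K ∈ incrTuples n k, l2NormSq (overlap S.piece s) (W K s) ≤
    (S.CP * S.DT) ^ 2 *
      ∑ K ∈ incrTuples n k, ∑ j, l2NormSq (overlap S.piece s) (H K s j)

theorem exists_isPiecePotential (n k : ℕ) (hk : k + 1 ≤ n) :
    ∃ c : ℝ, 0 < c ∧ ∀ (m : ℕ) (Ω : Set (Eucl n)) (S : StarChain Ω m)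
      (u : Eucl n → Forms n (k + 1)) (Y : ℝ),
      (∀ i, starConst c (k + 1) (S.piece i) (S.center (Sum.inl i)) (S.radius (Sum.inl i)) ≤ Y) →
      FormMemL2 Ω u → WeaklyClosed Ω u → ∃ V G, S.IsPiecePotential u Y V G := by
  obtain ⟨c, hc, hloc⟩ := exists_local_potential n k hk
  refine ⟨c, hc, fun m Ω S u Y hY hu hcl => ?_⟩
  have hst := fun i => S.starShaped (Sum.inl i)
  choose V G hG hJ hE using fun i => hloc (S.piece i) _ _ (hst i) u
    (fun J hJ => (hu J hJ).mono (S.piece_subset i)) (hcl.mono (S.piece_subset i))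
  choose V' hV' hV0 using fun I => S.exists_integral_sub_eq_zero fun i => hG i I
  refine ⟨V', fun I i => G i I, hV', hJ, fun i => (hE i).trans ?_, hV0⟩
  refine mul_le_mul_of_nonneg_right (pow_le_pow_left₀ ?_ (hY i) 2)
    (Finset.sum_nonneg fun J _ => l2NormSq_nonneg _)
  exact hc.le.trans ((hst i).le_starConst (by omega) hc.le _)

theorem IsPiecePotential.hasWeakGrad_sub {u : Eucl n → Forms n (k + 1)} {Y : ℝ}
    {V : (Fin k → Fin n) → Fin (m + 1) → Eucl n → ℝ}
    {G : (Fin k → Fin n) → Fin (m + 1) → Fin n → Eucl n → ℝ} {S : StarChain Ω m}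
    (h : S.IsPiecePotential u Y V G) (I : Fin k → Fin n) (s : Fin m) :
    HasWeakGrad (overlap S.piece s) (fun x => V I s.castSucc x - V I s.succ x)
      fun j x => G I s.castSucc j x - G I s.succ j x :=
  ((h.hasWeakGrad I _).mono inter_subset_left).sub ((h.hasWeakGrad I _).mono inter_subset_right)

theorem IsPiecePotential.ae_sub_eq_zero {u : Eucl n → Forms n (k + 1)} {Y : ℝ}
    {V : (Fin k → Fin n) → Fin (m + 1) → Eucl n → ℝ}
    {G : (Fin k → Fin n) → Fin (m + 1) → Fin n → Eucl n → ℝ} {S : StarChain Ω m}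
    (h : S.IsPiecePotential u Y V G) (s : Fin m) {J : Fin (k + 1) → Fin n}
    (hJ : J ∈ incrTuples n (k + 1)) :
    ∀ᵐ x ∂volume.restrict (overlap S.piece s), ∑ p : Fin (k + 1), (-1 : ℝ) ^ (p : ℕ) *
      (G (fun q => J (p.succAbove q)) s.castSucc (J p) x -
        G (fun q => J (p.succAbove q)) s.succ (J p) x) = 0 := by
  have h1 := ae_restrict_of_ae_restrict_of_subset
    (inter_subset_left : overlap S.piece s ⊆ _) (h.ae_eq s.castSucc J hJ)
  have h2 := ae_restrict_of_ae_restrict_of_subset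
    (inter_subset_right : overlap S.piece s ⊆ _) (h.ae_eq s.succ J hJ)
  filter_upwards [h1, h2] with x hx hx'
  simp only [mul_sub, Finset.sum_sub_distrib]
  rw [← hx, ← hx', sub_self]

/-- The differences have mean zero, so the Poincaré inequality on the overlap reduces them to their
gradients, which are controlled by the energies on the two adjacent pieces. -/
theorem IsPiecePotential.l2NormSq_sub_le {u : Eucl n → Forms n (k + 1)} {Y : ℝ}
    {V : (Fin k → Fin n) → Fin (m + 1) → Eucl n → ℝ}
    {G : (Fin k → Fin n) → Fin (m + 1) → Fin n → Eucl n → ℝ} {S : StarChain Ω m} (hn : 1 ≤ n)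
    (h : S.IsPiecePotential u Y V G) (s : Fin m) :
    ∑ I ∈ incrTuples n k,
      l2NormSq (overlap S.piece s) (fun x => V I s.castSucc x - V I s.succ x) ≤
    (S.CP * S.DT) ^ 2 * (2 * Y ^ 2 *
      ((∑ J ∈ incrTuples n (k + 1), l2NormSq (S.piece s.castSucc) (coeff u J)) +
        ∑ J ∈ incrTuples n (k + 1), l2NormSq (S.piece s.succ) (coeff u J))) := by
  have h1 : ∀ I j, l2NormSq (overlap S.piece s) (fun x => G I s.castSucc j x - G I s.succ j x) ≤
      2 * (l2NormSq (S.piece s.castSucc) (G I s.castSucc j) +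
        l2NormSq (S.piece s.succ) (G I s.succ j)) := fun I j => by
    have g1 := (h.hasWeakGrad I s.castSucc).memL2_grad j
    have g2 := (h.hasWeakGrad I s.succ).memL2_grad j
    refine (_root_.l2NormSq_sub_le (g1.mono inter_subset_left) (g2.mono inter_subset_right)).trans ?_
    linarith [l2NormSq_mono g1 (inter_subset_left : overlap S.piece s ⊆ _),
      l2NormSq_mono g2 (inter_subset_right : overlap S.piece s ⊆ _)]
  calc _ ≤ ∑ I ∈ incrTuples n k, (S.CP * S.DT) ^ 2 * ∑ j,
        l2NormSq (overlap S.piece s) (fun x => G I s.castSucc j x - G I s.succ j x) :=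
        Finset.sum_le_sum fun I _ =>
          S.l2NormSq_overlap_le s hn (h.hasWeakGrad_sub I s) (h.integral_eq_zero I s)
    _ ≤ ∑ I ∈ incrTuples n k, (S.CP * S.DT) ^ 2 * ∑ j,
        2 * (l2NormSq (S.piece s.castSucc) (G I s.castSucc j) +
        l2NormSq (S.piece s.succ) (G I s.succ j)) := by
        gcongr with I _ j _
        exact h1 I j
    _ = (S.CP * S.DT) ^ 2 * (2 *
        ((∑ I ∈ incrTuples n k, ∑ j, l2NormSq (S.piece s.castSucc) (G I s.castSucc j)) +
        ∑ I ∈ incrTuples n k, ∑ j, l2NormSq (S.piece s.succ) (G I s.succ j))) := by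
        simp only [← Finset.mul_sum, Finset.sum_add_distrib]
    _ ≤ _ := by
        refine mul_le_mul_of_nonneg_left ?_ (sq_nonneg _)
        linarith [h.energy_le s.castSucc, h.energy_le s.succ]

/-- Two potentials of the same form differ by a closed form, and the local result applies to it one
degree lower; this is the source of the degree ℓ - 1 in `CT`. Subtracting means from the
coefficients leaves the gradients unchanged and permits the Poincaré inequality. -/
theorem exists_isOverlapPotential (n k : ℕ) (hk : k + 1 ≤ n) :
    ∃ c : ℝ, 0 < c ∧ ∀ (m : ℕ) (Ω : Set (Eucl n)) (S : StarChain Ω m)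
      (u : Eucl n → Forms n (k + 2)) (Y : ℝ)
      (V : (Fin (k + 1) → Fin n) → Fin (m + 1) → Eucl n → ℝ)
      (G : (Fin (k + 1) → Fin n) → Fin (m + 1) → Fin n → Eucl n → ℝ) (_ : S.IsPiecePotential u Y V G),
      (∀ s, starConst c (k + 1) (overlap S.piece s) (S.center (Sum.inr s))
        (S.radius (Sum.inr s)) ≤ Y) → ∃ W H, S.IsOverlapPotential Y V W H := by
  obtain ⟨c, hc, hloc⟩ := exists_local_potential n k hk
  refine ⟨c, hc, fun m Ω S u Y V G h hY => ?_⟩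
  have hst : ∀ s, StarShapedBall (overlap S.piece s) _ _ := fun s => S.starShaped (Sum.inr s)
  set δ : Fin m → Eucl n → Forms n (k + 1) := fun s =>
    formOfCoeff fun I x => V I s.castSucc x - V I s.succ x with hδ
  have hδc : ∀ s, ∀ I ∈ incrTuples n (k + 1), coeff (δ s) I =
      fun x => V I s.castSucc x - V I s.succ x := fun s I hI => coeff_formOfCoeff _ hI
  have hδ2 : ∀ s, FormMemL2 (overlap S.piece s) (δ s) := fun s I hI => by
    rw [hδc s I hI]
    exact (h.hasWeakGrad_sub I s).memL2
  have hδcl : ∀ s, WeaklyClosed (overlap S.piece s) (δ s) := fun s => by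
    refine hasWeakExtDeriv_of_ae_eq (fun I hI => by
      rw [hδc s I hI]
      exact h.hasWeakGrad_sub I s) fun J hJ => ?_
    filter_upwards [h.ae_sub_eq_zero s hJ] with x hx
    rw [hx]
    rfl
  choose W H hH hI hE using fun s => hloc _ _ _ (hst s) (δ s) (hδ2 s) (hδcl s)
  refine ⟨fun K s x => W s K x - (volume.real (overlap S.piece s))⁻¹ *
    ∫ y in overlap S.piece s, W s K y, fun K s => H s K,
    fun K s => (hH s K).sub_const (hst s).volume_lt_top _, fun s I hI' => ?_, fun s => ?_,
    fun s => ?_⟩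
  · have := hI s I hI'
    rwa [hδc s I hI'] at this
  · have h1 := hE s
    have h2 : ∀ I ∈ incrTuples n (k + 1), l2NormSq (overlap S.piece s) (coeff (δ s) I) =
        l2NormSq (overlap S.piece s) fun x => V I s.castSucc x - V I s.succ x :=
      fun I hI' => by rw [hδc s I hI']
    rw [Finset.sum_congr rfl h2] at h1
    refine h1.trans (mul_le_mul_of_nonneg_right (pow_le_pow_left₀ ?_ (hY s) 2)
      (Finset.sum_nonneg fun J _ => l2NormSq_nonneg _))
    exact hc.le.trans ((hst s).le_starConst (by omega) hc.le _)
  · rw [Finset.mul_sum]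
    exact Finset.sum_le_sum fun K _ => S.l2NormSq_overlap_le s (by omega)
      ((hH s K).sub_const (hst s).volume_lt_top _)
      (integral_sub_average (hst s).volume_lt_top (hst s).volume_real_pos (hH s K).memL2)

end StarChain

/-! ### The global potential -/

namespace StarChain

variable {n m k : ℕ} {Ω : Set (Eucl n)} (S : StarChain Ω m) {x : Eucl n}

/-- On forms of degree one, the glued potentials are a potential with gradient `u`. -/
theorem IsPiecePotential.exists_potential_one {u : Eucl n → Forms n 1} {Y : ℝ}
    {V : (Fin 0 → Fin n) → Fin (m + 1) → Eucl n → ℝ}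
    {G : (Fin 0 → Fin n) → Fin (m + 1) → Fin n → Eucl n → ℝ} {S : StarChain Ω m} (hn : 1 ≤ n)
    (h : S.IsPiecePotential u Y V G) :
    ∃ g : (Fin 0 → Fin n) → Fin n → Eucl n → ℝ,
      (∀ I ∈ incrTuples n 0, HasWeakGrad Ω (coeff (formOfCoeff fun I => S.glue (V I)) I) (g I)) ∧
      HasWeakExtDeriv Ω (formOfCoeff fun I => S.glue (V I)) u ∧
      ∑ I ∈ incrTuples n 0, ∑ j, l2NormSq Ω (g I j) ≤
        n * ∑ J ∈ incrTuples n 1, l2NormSq Ω (coeff u J) := by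
  have hgrad : ∀ I ∈ incrTuples n 0, HasWeakGrad Ω (coeff (formOfCoeff fun I => S.glue (V I)) I)
      (S.glueGrad (V I) (G I)) := fun I hI => by
    rw [coeff_formOfCoeff _ hI]
    exact S.hasWeakGrad_glue (h.hasWeakGrad I)
  have hmem : ∀ {k : ℕ} (J : Fin k → Fin n), k ≤ 1 → J ∈ incrTuples n k := fun J hk =>
    mem_incrTuples.2 fun a b hab => by
      have h1 : (a : ℕ) < b := hab
      omega
  have hG : ∀ i (j : Fin n) (I : Fin 0 → Fin n),
      coeff u (fun _ => j) =ᵐ[volume.restrict (S.piece i)] G I i j := fun i j I => by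
    filter_upwards [h.ae_eq i (fun _ => j) (hmem _ le_rfl)] with x hx
    simpa [Subsingleton.elim _ I] using hx
  -- Both gradients are equal to `u`, so the difference has zero gradient and zero mean, and the
  -- Poincaré inequality makes it vanish.
  have hδ : ∀ (s : Fin m) (I : Fin 0 → Fin n), ∀ᵐ x ∂volume.restrict (overlap S.piece s),
      V I s.castSucc x - V I s.succ x = 0 := fun s I => by
    have h1 := S.l2NormSq_overlap_le s hn (h.hasWeakGrad_sub I s) (h.integral_eq_zero I s)
    have h2 : ∀ j, l2NormSq (overlap S.piece s)
        (fun x => G I s.castSucc j x - G I s.succ j x) = 0 := fun j => by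
      refine integral_eq_zero_of_ae ?_
      have h3 := ae_restrict_of_ae_restrict_of_subset
        (inter_subset_left : overlap S.piece s ⊆ _) (hG s.castSucc j I)
      have h4 := ae_restrict_of_ae_restrict_of_subset
        (inter_subset_right : overlap S.piece s ⊆ _) (hG s.succ j I)
      filter_upwards [h3, h4] with x hx hx'
      simp [← hx, ← hx']
    simp only [h2, Finset.sum_const_zero, mul_zero] at h1
    have h3 := (integral_eq_zero_iff_of_nonneg (fun x => sq_nonneg _)
      (h.hasWeakGrad_sub I s).memL2.integrableOn_sq).1 (le_antisymm h1 (l2NormSq_nonneg _))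
    filter_upwards [h3] with x hx
    exact pow_eq_zero_iff two_ne_zero |>.1 hx
  have hg : ∀ (I : Fin 0 → Fin n) (j : Fin n),
      S.glueGrad (V I) (G I) j =ᵐ[volume.restrict Ω] coeff u fun _ => j := fun I j => by
    filter_upwards [ae_restrict_mem S.isOpen.measurableSet, S.ae_of_ae_piece fun i => hG i j I,
      S.ae_of_ae_overlap fun s => hδ s I] with x hx h1 h2
    rcases S.mem_overlap_or_exists_unique hx with ⟨s, hs⟩ | ⟨i, hi, h', -⟩
    · rw [S.glueGrad_of_overlap hs, h2 s hs, ← h1 _ hs.1, ← h1 _ hs.2, ← add_mul,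
        S.sum_φ_of_overlap hs]
      ring
    · rw [S.glueGrad_of_unique hi h', h1 i hi]
  refine ⟨fun I => S.glueGrad (V I) (G I), hgrad, hasWeakExtDeriv_of_ae_eq hgrad fun J _ => ?_, ?_⟩
  · filter_upwards [hg (fun q => J q.succ) (J 0)] with x hx
    have hJ : (fun _ => J 0) = J := funext fun q => by rw [Subsingleton.elim (α := Fin 1) q 0]
    rw [hJ] at hx
    simp [hx]
  · have h1 : ∀ I ∈ incrTuples n 0, ∑ j, l2NormSq Ω (S.glueGrad (V I) (G I) j) ≤
        n * ∑ J ∈ incrTuples n 1, l2NormSq Ω (coeff u J) := fun I _ => by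
      have h2 : ∀ j, l2NormSq Ω (S.glueGrad (V I) (G I) j) ≤
          ∑ J ∈ incrTuples n 1, l2NormSq Ω (coeff u J) := fun j => by
        refine le_of_eq_of_le ?_ (l2NormSq_coeff_le u fun _ => j)
        exact integral_congr_ae ((hg I j).mono fun x hx => by simp only [hx])
      refine (Finset.sum_le_sum fun j _ => h2 j).trans_eq ?_
      simp
    refine (Finset.sum_le_sum h1).trans ?_
    rw [Finset.sum_const, nsmul_eq_mul]
    refine mul_le_of_le_one_left (mul_nonneg (Nat.cast_nonneg _)
      (Finset.sum_nonneg fun J _ => l2NormSq_nonneg _)) ?_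
    have : (incrTuples n 0).card ≤ 1 := by
      rw [Finset.card_le_one]
      exact fun a _ b _ => Subsingleton.elim a b
    exact_mod_cast this

section Correction

variable (V : (Fin (k + 1) → Fin n) → Fin (m + 1) → Eucl n → ℝ)
  (G : (Fin (k + 1) → Fin n) → Fin (m + 1) → Fin n → Eucl n → ℝ)
  (W : (Fin k → Fin n) → Fin m → Eucl n → ℝ) (H : (Fin k → Fin n) → Fin m → Fin n → Eucl n → ℝ)

/-- The coefficients of the global potential. -/
noncomputable def potential (I : Fin (k + 1) → Fin n) (x : Eucl n) : ℝ :=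
  S.glue (V I) x + ∑ q : Fin (k + 1), (-1 : ℝ) ^ (q : ℕ) *
    S.bridge (I q) (W fun r => I (q.succAbove r)) x

/-- The weak gradient of the coefficients of the global potential. -/
noncomputable def potentialGrad (I : Fin (k + 1) → Fin n) (j : Fin n) (x : Eucl n) : ℝ :=
  S.glueGrad (V I) (G I) j x + ∑ q : Fin (k + 1), (-1 : ℝ) ^ (q : ℕ) *
    S.bridgeGrad (I q) (W fun r => I (q.succAbove r)) (H fun r => I (q.succAbove r)) j x

variable {V G W H} {u : Eucl n → Forms n (k + 2)} {Y : ℝ} {S}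

theorem hasWeakGrad_potential (hn : 1 ≤ n) (h : S.IsPiecePotential u Y V G)
    (h' : S.IsOverlapPotential Y V W H) (I : Fin (k + 1) → Fin n) :
    HasWeakGrad Ω (S.potential V W I) (S.potentialGrad V G W H I) :=
  (S.hasWeakGrad_glue (h.hasWeakGrad I)).add <| HasWeakGrad.sum Finset.univ fun q _ =>
    (S.hasWeakGrad_bridge hn (I q) (h'.hasWeakGrad fun r => I (q.succAbove r))).const_mul _

theorem potentialGrad_of_unique {i : Fin (m + 1)} (hi : x ∈ S.piece i)
    (hu : ∀ i', x ∈ S.piece i' → i' = i) (hs : ∀ s, x ∉ overlap S.piece s)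
    (I : Fin (k + 1) → Fin n) (j : Fin n) : S.potentialGrad V G W H I j x = G I i j x := by
  simp [potentialGrad, S.glueGrad_of_unique hi hu, S.bridgeGrad_of_notMem hs]

theorem potentialGrad_of_overlap {s : Fin m} (hx : x ∈ overlap S.piece s)
    (I : Fin (k + 1) → Fin n) (j : Fin n) : S.potentialGrad V G W H I j x =
      S.φ s.castSucc x * G I s.castSucc j x + S.φ s.succ x * G I s.succ j x +
      (fderiv ℝ (S.partialSum s) x (stdVec j) * (V I s.castSucc x - V I s.succ x) +
      ∑ q : Fin (k + 1), (-1 : ℝ) ^ (q : ℕ) *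
        (fderiv ℝ (fun y => fderiv ℝ (S.partialSum s) y (stdVec (I q))) x (stdVec j) *
            W (fun r => I (q.succAbove r)) s x +
          fderiv ℝ (S.partialSum s) x (stdVec (I q)) *
            H (fun r => I (q.succAbove r)) s j x)) := by
  simp only [potentialGrad, S.glueGrad_of_overlap hx, S.bridgeGrad_of_overlap hx]
  ring

/-- Where only one piece is present, its function in the partition is one with zero gradient. On an
overlap, gluing adds dΦ ∧ (V_s - V_(s+1)) and the correction adds -dΦ ∧ dW; they cancel since dW is
the difference. Second derivatives of Φ drop out by symmetry. -/
theorem hasWeakExtDeriv_potential (hn : 1 ≤ n) (h : S.IsPiecePotential u Y V G)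
    (h' : S.IsOverlapPotential Y V W H) :
    HasWeakExtDeriv Ω (formOfCoeff (S.potential V W)) u := by
  refine hasWeakExtDeriv_of_ae_eq (G := S.potentialGrad V G W H) (fun I hI => by
    rw [coeff_formOfCoeff _ hI]
    exact hasWeakGrad_potential hn h h' I) fun J hJ => ?_
  have hδ : ∀ᵐ x ∂volume.restrict Ω, ∀ s, x ∈ overlap S.piece s → ∀ p : Fin (k + 2),
      V (fun q => J (p.succAbove q)) s.castSucc x - V (fun q => J (p.succAbove q)) s.succ x =
      ∑ q : Fin (k + 1), (-1 : ℝ) ^ (q : ℕ) *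
        H (fun r => J (p.succAbove (q.succAbove r))) s (J (p.succAbove q)) x :=
    S.ae_of_ae_overlap fun s => ae_all_iff.2 fun p =>
      h'.ae_eq s _ (succAbove_mem_incrTuples hJ p)
  filter_upwards [ae_restrict_mem S.isOpen.measurableSet,
    S.ae_of_ae_piece fun i => h.ae_eq i J hJ, hδ] with x hx h1 h2
  rcases S.mem_overlap_or_exists_unique hx with ⟨s, hs⟩ | ⟨i, hi, hu, hns⟩
  · have e1 := h1 _ hs.1
    have e2 := h1 _ hs.2
    simp only [potentialGrad_of_overlap hs, h2 s hs]
    set D1 : Fin n → ℝ := fun j => fderiv ℝ (S.partialSum s) x (stdVec j) with hD1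
    set D2 : Fin n → Fin n → ℝ := fun l j =>
      fderiv ℝ (fun y => fderiv ℝ (S.partialSum s) y (stdVec l)) x (stdVec j) with hD2
    have hsymm : ∀ l j, D2 l j = D2 j l := fun l j => S.fderiv_fderiv_partialSum_comm hx s j l
    -- Exchanging the two removed indices changes the sign; this is the sign in d(dΦ ∧ W) = -dΦ ∧
    -- dW.
    have c1 := sum_succAbove_comm (fun a b K => D1 a * H K s b x) J
    have c2 := sum_succAbove_comm (fun a b K => D2 a b * W K s x) J
    -- A symmetric Hessian summed against an antisymmetric pattern of signs vanishes, which is d(dΦ)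
    -- = 0.
    have c3 : ∑ p : Fin (k + 2), ∑ q : Fin (k + 1), (-1 : ℝ) ^ ((p : ℕ) + q) *
        (D2 (J (p.succAbove q)) (J p) * W (fun r => J (p.succAbove (q.succAbove r))) s x) = 0 := by
      simp only [hsymm (J (Fin.succAbove _ _)) (J _)] at c2 ⊢
      linarith
    have e3 : coeff u J x = S.φ s.castSucc x * coeff u J x + S.φ s.succ x * coeff u J x := by
      rw [← add_mul, S.sum_φ_of_overlap hs, one_mul]
    rw [e3]
    nth_rewrite 1 [e1]
    rw [e2]
    simp only [mul_add, Finset.sum_add_distrib, Finset.mul_sum, pow_add, mul_assoc] at c1 c3 ⊢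
    have c4 : ∑ p : Fin (k + 2), ∑ q : Fin (k + 1), (-1 : ℝ) ^ (p : ℕ) * (D1 (J p) *
        ((-1 : ℝ) ^ (q : ℕ) * H (fun r => J (p.succAbove (q.succAbove r))) s
          (J (p.succAbove q)) x)) =
        ∑ p : Fin (k + 2), ∑ q : Fin (k + 1), (-1 : ℝ) ^ (p : ℕ) * ((-1 : ℝ) ^ (q : ℕ) *
          (D1 (J p) * H (fun r => J (p.succAbove (q.succAbove r))) s (J (p.succAbove q)) x)) := by
      refine Finset.sum_congr rfl fun p _ => Finset.sum_congr rfl fun q _ => ?_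
      ring
    have c5 : ∀ (a : ℝ) (i : Fin (m + 1)), ∑ p : Fin (k + 2), (-1 : ℝ) ^ (p : ℕ) *
        (a * G (fun q => J (p.succAbove q)) i (J p) x) =
        ∑ p : Fin (k + 2), a * ((-1 : ℝ) ^ (p : ℕ) * G (fun q => J (p.succAbove q)) i (J p) x) :=
      fun a i => Finset.sum_congr rfl fun p _ => mul_left_comm _ _ _
    rw [c4, c1, c3, c5, c5]
    ring
  · rw [h1 i hi]
    simp only [potentialGrad_of_unique hi hu hns]

end Correction

end StarChain

/-! ### Elementary inequalities for the final constant -/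

section Inequalities

theorem sq_convex_add_le {s s' g g' T : ℝ} (hs : 0 ≤ s) (hs' : 0 ≤ s') (h : s + s' = 1) :
    (s * g + s' * g' + T) ^ 2 ≤ 2 * g ^ 2 + 2 * g' ^ 2 + 2 * T ^ 2 := by
  have h1 : (s * g + s' * g') ^ 2 ≤ g ^ 2 + g' ^ 2 := by
    have e : s' = 1 - s := by linarith
    subst e
    nlinarith [mul_nonneg hs hs', sq_nonneg (g - g'), mul_nonneg hs (sq_nonneg g'),
      mul_nonneg hs' (sq_nonneg g), mul_nonneg (mul_nonneg hs hs') (sq_nonneg (g - g'))]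
  nlinarith [sq_nonneg (s * g + s' * g' - T)]

theorem sq_add_sum_le {k : ℕ} (a : ℝ) (b c : Fin (k + 1) → ℝ) :
    (a + ∑ q : Fin (k + 1), (-1 : ℝ) ^ (q : ℕ) * (b q + c q)) ^ 2 ≤
      4 * (k + 1) * (a ^ 2 + ∑ q, (b q ^ 2 + c q ^ 2)) := by
  set s := ∑ q : Fin (k + 1), (-1 : ℝ) ^ (q : ℕ) * (b q + c q)
  set r := ∑ q, (b q ^ 2 + c q ^ 2)
  have h1 : s ^ 2 ≤ (k + 1) * (2 * r) := by
    have h2 := sq_sum_le_card_mul_sum_sq (s := Finset.univ)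
      (f := fun q : Fin (k + 1) => (-1 : ℝ) ^ (q : ℕ) * (b q + c q))
    rw [Finset.card_univ, Fintype.card_fin] at h2
    push_cast at h2
    refine h2.trans (mul_le_mul_of_nonneg_left ?_ (by positivity))
    rw [Finset.mul_sum]
    refine Finset.sum_le_sum fun q _ => ?_
    have h3 : ((-1 : ℝ) ^ (q : ℕ)) ^ 2 = 1 := by rw [← pow_mul, mul_comm, pow_mul]; simp
    rw [mul_pow, h3]
    nlinarith [sq_nonneg (b q - c q)]
  have hr : 0 ≤ r := Finset.sum_nonneg fun q _ => by positivity
  have hk : (0 : ℝ) ≤ k := Nat.cast_nonneg k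
  nlinarith [sq_nonneg (a - s), sq_nonneg a, mul_nonneg hk (sq_nonneg a)]

theorem mul_sq_le_of_abs_le {a b c : ℝ} (h : |a| ≤ b) : (a * c) ^ 2 ≤ b ^ 2 * c ^ 2 := by
  rw [mul_pow, ← sq_abs a]
  gcongr

/-- With X = P/d and t = AYX, the bounds A ≥ 1 and Y ≥ 1 give X² ≤ t², X²Y² ≤ t² and X⁴Y² ≤ t⁴, and
2t² + t⁴ ≤ (t + 1)⁴. The combinatorial factor `M` is absorbed by the square of 2A. -/
theorem chain_constant_le {M A Y P C d U : ℝ} (hA : 1 ≤ A) (hM : M ≤ 4 * A ^ 2) (hY : 1 ≤ Y)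
    (hP : 0 ≤ P) (hd : 0 < d) (hU : 0 ≤ U) :
    M * (Y ^ 2 * U) * (1 + P ^ 2 * ((C / d) ^ 2 + (C / d ^ 2) ^ 2 * (P ^ 2 * Y ^ 2) +
      (C / d) ^ 2 * Y ^ 2)) ≤
      (2 * (A * Y) * √(1 + 32 * C ^ 2 * (A * Y * P / d + 1) ^ 4)) ^ 2 * U := by
  rw [mul_pow, Real.sq_sqrt (by positivity)]
  set X := P / d with hX
  have hX0 : 0 ≤ X := by positivity
  set t := A * Y * P / d with ht
  have ht' : t = A * Y * X := by rw [ht, hX, mul_div_assoc]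
  have h1 : 1 + P ^ 2 * ((C / d) ^ 2 + (C / d ^ 2) ^ 2 * (P ^ 2 * Y ^ 2) + (C / d) ^ 2 * Y ^ 2) =
      1 + C ^ 2 * (X ^ 2 + X ^ 4 * Y ^ 2 + X ^ 2 * Y ^ 2) := by
    rw [hX]
    field_simp
  have hY2 : 1 ≤ Y ^ 2 := one_le_pow₀ hY
  have ht0 : 0 ≤ t := by rw [ht']; positivity
  have h2 : Y * X ≤ t := by
    rw [ht', mul_assoc]
    exact le_mul_of_one_le_left (by positivity) hA
  have h3 : X ^ 2 * Y ^ 2 ≤ t ^ 2 := by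
    rw [← mul_pow, mul_comm]
    exact pow_le_pow_left₀ (by positivity) h2 2
  have h4 : X ^ 4 * Y ^ 4 ≤ t ^ 4 := by
    rw [← mul_pow, mul_comm]
    exact pow_le_pow_left₀ (by positivity) h2 4
  have h5 : X ^ 2 ≤ X ^ 2 * Y ^ 2 := le_mul_of_one_le_right (by positivity) hY2
  have h6 : X ^ 4 * Y ^ 2 ≤ X ^ 4 * Y ^ 4 := by
    have : Y ^ 2 ≤ Y ^ 4 := pow_le_pow_right₀ hY (by norm_num)
    gcongr
  have h7 : 2 * t ^ 2 + t ^ 4 ≤ 32 * (t + 1) ^ 4 := by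
    have : (t + 1) ^ 4 = t ^ 4 + 4 * t ^ 3 + 6 * t ^ 2 + 4 * t + 1 := by ring
    have := pow_nonneg ht0 3
    have := pow_nonneg ht0 4
    have := pow_nonneg ht0 2
    nlinarith
  have h8 : 1 + C ^ 2 * (X ^ 2 + X ^ 4 * Y ^ 2 + X ^ 2 * Y ^ 2) ≤ 1 + 32 * C ^ 2 * (t + 1) ^ 4 := by
    nlinarith [sq_nonneg C]
  rw [h1]
  calc _ ≤ (4 * A ^ 2) * (Y ^ 2 * U) * (1 + 32 * C ^ 2 * (t + 1) ^ 4) := by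
        refine mul_le_mul (mul_le_mul_of_nonneg_right hM (by positivity)) h8 (by positivity)
          (by positivity)
    _ = _ := by ring

end Inequalities

/-! ### The energy of the global potential -/

namespace StarChain

variable {n m k : ℕ} {Ω : Set (Eucl n)} {S : StarChain Ω m} {x : Eucl n}
  {V : (Fin (k + 1) → Fin n) → Fin (m + 1) → Eucl n → ℝ}
  {G : (Fin (k + 1) → Fin n) → Fin (m + 1) → Fin n → Eucl n → ℝ}
  {W : (Fin k → Fin n) → Fin m → Eucl n → ℝ} {H : (Fin k → Fin n) → Fin m → Fin n → Eucl n → ℝ}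
  {u : Eucl n → Forms n (k + 2)} {Y : ℝ}

theorem sq_potentialGrad_le (hn : 1 ≤ n) (hx : x ∈ Ω) (I : Fin (k + 1) → Fin n) (j : Fin n) :
    S.potentialGrad V G W H I j x ^ 2 ≤
      ∑ i, (S.piece i).indicator (fun x => 2 * G I i j x ^ 2) x +
      ∑ s, (overlap S.piece s).indicator (fun x => 8 * (k + 1) *
        ((S.CS / S.dT) ^ 2 * (V I s.castSucc x - V I s.succ x) ^ 2 +
          ∑ q : Fin (k + 1), ((S.CS / S.dT ^ 2) ^ 2 * W (fun r => I (q.succAbove r)) s x ^ 2 +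
            (S.CS / S.dT) ^ 2 * H (fun r => I (q.succAbove r)) s j x ^ 2))) x := by
  rcases S.mem_overlap_or_exists_unique hx with ⟨s, hs⟩ | ⟨i, hi, hu, hns⟩
  · have hφ := S.φ_mem s.castSucc x hx
    have hφ' := S.φ_mem s.succ x hx
    rw [potentialGrad_of_overlap hs, S.sum_indicator_piece_of_overlap hs,
      S.sum_indicator_overlap hs]
    refine (sq_convex_add_le hφ.1 hφ'.1 (S.sum_φ_of_overlap hs)).trans ?_
    have h1 := sq_add_sum_le
      (fderiv ℝ (S.partialSum s) x (stdVec j) * (V I s.castSucc x - V I s.succ x))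
      (fun q => fderiv ℝ (fun y => fderiv ℝ (S.partialSum s) y (stdVec (I q))) x (stdVec j) *
        W (fun r => I (q.succAbove r)) s x)
      (fun q => fderiv ℝ (S.partialSum s) x (stdVec (I q)) * H (fun r => I (q.succAbove r)) s j x)
    refine add_le_add_right ((mul_le_mul_of_nonneg_left h1 zero_le_two).trans ?_) _
    rw [← mul_assoc, ← mul_assoc, show (2 : ℝ) * 4 = 8 by norm_num]
    refine mul_le_mul_of_nonneg_left (add_le_add
      (mul_sq_le_of_abs_le (S.abs_fderiv_partialSum_le hn hs j)) (Finset.sum_le_sum fun q _ =>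
      add_le_add (mul_sq_le_of_abs_le (S.abs_fderiv_fderiv_partialSum_le hn hs j (I q)))
        (mul_sq_le_of_abs_le (S.abs_fderiv_partialSum_le hn hs (I q))))) (by positivity)
  · rw [potentialGrad_of_unique hi hu hns, S.sum_indicator_piece_of_unique hi hu,
      Finset.sum_eq_zero fun s _ => indicator_of_notMem (hns s) _]
    nlinarith [sq_nonneg (G I i j x)]

theorem l2NormSq_potentialGrad_le (hn : 1 ≤ n) (h : S.IsPiecePotential u Y V G)
    (h' : S.IsOverlapPotential Y V W H) (I : Fin (k + 1) → Fin n) (j : Fin n) :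
    l2NormSq Ω (S.potentialGrad V G W H I j) ≤ ∑ i, 2 * l2NormSq (S.piece i) (G I i j) +
      ∑ s, 8 * (k + 1) * ((S.CS / S.dT) ^ 2 *
        l2NormSq (overlap S.piece s) (fun x => V I s.castSucc x - V I s.succ x) +
        ∑ q : Fin (k + 1), ((S.CS / S.dT ^ 2) ^ 2 *
            l2NormSq (overlap S.piece s) (W (fun r => I (q.succAbove r)) s) +
          (S.CS / S.dT) ^ 2 *
            l2NormSq (overlap S.piece s) (H (fun r => I (q.succAbove r)) s j))) := by
  have iG := fun i => ((h.hasWeakGrad I i).memL2_grad j).integrableOn_sq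
  have iV := fun s => (h.hasWeakGrad_sub I s).memL2.integrableOn_sq
  have iW := fun (q : Fin (k + 1)) s =>
    (h'.hasWeakGrad (fun r => I (q.succAbove r)) s).memL2.integrableOn_sq
  have iH := fun (q : Fin (k + 1)) s =>
    ((h'.hasWeakGrad (fun r => I (q.succAbove r)) s).memL2_grad j).integrableOn_sq
  have iWH : ∀ (q : Fin (k + 1)) s, Integrable (fun x =>
      (S.CS / S.dT ^ 2) ^ 2 * W (fun r => I (q.succAbove r)) s x ^ 2 +
      (S.CS / S.dT) ^ 2 * H (fun r => I (q.succAbove r)) s j x ^ 2)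
      (volume.restrict (overlap S.piece s)) := fun q s =>
    ((iW q s).const_mul _).add ((iH q s).const_mul _)
  have iS : ∀ s, Integrable (fun x => ∑ q : Fin (k + 1),
      ((S.CS / S.dT ^ 2) ^ 2 * W (fun r => I (q.succAbove r)) s x ^ 2 +
      (S.CS / S.dT) ^ 2 * H (fun r => I (q.succAbove r)) s j x ^ 2))
      (volume.restrict (overlap S.piece s)) := fun s =>
    integrable_finsetSum _ fun q _ => iWH q s
  refine (S.integral_le_sum_add_sum (fun x => sq_nonneg _) (fun i => (iG i).const_mul 2)
    (fun s => (((iV s).const_mul _).add (iS s)).const_mul _)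
    fun x hx => sq_potentialGrad_le hn hx I j).trans_eq ?_
  congr 1
  · exact Finset.sum_congr rfl fun i _ => integral_const_mul _ _
  · refine Finset.sum_congr rfl fun s _ => ?_
    rw [integral_const_mul, integral_add' ((iV s).const_mul _) (iS s), integral_const_mul,
      integral_finsetSum _ fun q _ => iWH q s]
    congr 3
    ext q
    rw [integral_add ((iW q s).const_mul _) ((iH q s).const_mul _), integral_const_mul,
      integral_const_mul]
    rfl

/-- Removing an entry leaves an increasing tuple, so each summand with `W` or `H` is at most the
corresponding sum over all tuples. The prefactor then only counts tuples, removed entries and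
partial derivatives. -/
theorem sum_overlap_le (h' : S.IsOverlapPotential Y V W H) (s : Fin m) :
    ∑ I ∈ incrTuples n (k + 1), ∑ j, ((S.CS / S.dT) ^ 2 *
        l2NormSq (overlap S.piece s) (fun x => V I s.castSucc x - V I s.succ x) +
        ∑ q : Fin (k + 1), ((S.CS / S.dT ^ 2) ^ 2 *
            l2NormSq (overlap S.piece s) (W (fun r => I (q.succAbove r)) s) +
          (S.CS / S.dT) ^ 2 *
            l2NormSq (overlap S.piece s) (H (fun r => I (q.succAbove r)) s j))) ≤
      (n + (incrTuples n (k + 1)).card * (k + 1) * (n + 1)) *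
        (((S.CS / S.dT) ^ 2 + (S.CS / S.dT ^ 2) ^ 2 * ((S.CP * S.DT) ^ 2 * Y ^ 2) +
          (S.CS / S.dT) ^ 2 * Y ^ 2) * ∑ I ∈ incrTuples n (k + 1),
            l2NormSq (overlap S.piece s) fun x => V I s.castSucc x - V I s.succ x) := by
  set b₁ := (S.CS / S.dT) ^ 2
  set b₂ := (S.CS / S.dT ^ 2) ^ 2
  set P := (S.CP * S.DT) ^ 2
  have hb₁ : 0 ≤ b₁ := sq_nonneg _
  have hb₂ : 0 ≤ b₂ := sq_nonneg _
  have hP : 0 ≤ P := sq_nonneg _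
  have h1 := h'.energy_le s
  have h2 := h'.l2_le s
  set δ := ∑ I ∈ incrTuples n (k + 1),
    l2NormSq (overlap S.piece s) fun x => V I s.castSucc x - V I s.succ x with hδ
  set h₀ := ∑ K ∈ incrTuples n k, ∑ j, l2NormSq (overlap S.piece s) (H K s j) with hh₀
  have hδ0 : 0 ≤ δ := Finset.sum_nonneg fun I _ => l2NormSq_nonneg _
  have hh₀0 : 0 ≤ h₀ := Finset.sum_nonneg fun I _ => Finset.sum_nonneg fun j _ => l2NormSq_nonneg _
  have e1 : ∀ K ∈ incrTuples n k, l2NormSq (overlap S.piece s) (W K s) ≤ P * (Y ^ 2 * δ) :=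
    fun K hK => (Finset.single_le_sum (f := fun K => l2NormSq (overlap S.piece s) (W K s))
      (fun K _ => l2NormSq_nonneg _) hK).trans (h2.trans (mul_le_mul_of_nonneg_left h1 hP))
  have e2 : ∀ K ∈ incrTuples n k, ∑ j, l2NormSq (overlap S.piece s) (H K s j) ≤ Y ^ 2 * δ :=
    fun K hK => (Finset.single_le_sum
      (f := fun K => ∑ j, l2NormSq (overlap S.piece s) (H K s j))
      (fun K _ => Finset.sum_nonneg fun j _ => l2NormSq_nonneg _) hK).trans h1
  have e3 : ∀ K ∈ incrTuples n k, ∑ j : Fin n, (b₂ * l2NormSq (overlap S.piece s) (W K s) +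
      b₁ * l2NormSq (overlap S.piece s) (H K s j)) ≤
      n * (b₂ * (P * (Y ^ 2 * δ))) + b₁ * (Y ^ 2 * δ) := fun K hK => by
    rw [Finset.sum_add_distrib, Finset.sum_const, Finset.card_univ, Fintype.card_fin,
      nsmul_eq_mul, ← Finset.mul_sum]
    exact add_le_add (mul_le_mul_of_nonneg_left (mul_le_mul_of_nonneg_left (e1 K hK) hb₂)
      (Nat.cast_nonneg n)) (mul_le_mul_of_nonneg_left (e2 K hK) hb₁)
  calc _ = n * (b₁ * δ) + ∑ I ∈ incrTuples n (k + 1), ∑ q : Fin (k + 1), ∑ j : Fin n,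
        (b₂ * l2NormSq (overlap S.piece s) (W (fun r => I (q.succAbove r)) s) +
          b₁ * l2NormSq (overlap S.piece s) (H (fun r => I (q.succAbove r)) s j)) := by
        simp only [Finset.sum_add_distrib (s := Finset.univ (α := Fin n)) (f := fun _ => b₁ * _)]
        rw [Finset.sum_add_distrib]
        congr 1
        · simp only [Finset.sum_const, Finset.card_univ, Fintype.card_fin, nsmul_eq_mul, hδ,
            Finset.mul_sum]
        · exact Finset.sum_congr rfl fun I _ => Finset.sum_comm
    _ ≤ n * (b₁ * δ) + ∑ I ∈ incrTuples n (k + 1), ∑ q : Fin (k + 1),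
        (n * (b₂ * (P * (Y ^ 2 * δ))) + b₁ * (Y ^ 2 * δ)) := by
        refine add_le_add_right (Finset.sum_le_sum fun I hI => Finset.sum_le_sum fun q _ => ?_) _
        exact e3 _ (succAbove_mem_incrTuples hI q)
    _ = n * (b₁ * δ) + (incrTuples n (k + 1)).card * (k + 1) *
        (n * (b₂ * (P * (Y ^ 2 * δ))) + b₁ * (Y ^ 2 * δ)) := by
        simp only [Finset.sum_const, nsmul_eq_mul, Finset.card_univ, Fintype.card_fin]
        push_cast
        ring
    _ ≤ _ := by
        set N : ℝ := (incrTuples n (k + 1)).card * (k + 1) with hN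
        have hN0 : 0 ≤ N := by positivity
        set p₁ := b₁ * δ
        set p₂ := b₂ * (P * (Y ^ 2 * δ))
        set p₃ := b₁ * (Y ^ 2 * δ)
        have q₁ : 0 ≤ p₁ := by positivity
        have q₂ : 0 ≤ p₂ := by positivity
        have q₃ : 0 ≤ p₃ := by positivity
        have hn0 : (0 : ℝ) ≤ n := Nat.cast_nonneg n
        have e4 : (b₁ + b₂ * (P * Y ^ 2) + b₁ * Y ^ 2) * δ = p₁ + p₂ + p₃ := by
          simp only [p₁, p₂, p₃]
          ring
        rw [e4]
        have : 0 ≤ n * p₂ + n * p₃ + N * (n + 1) * p₁ + N * p₂ + N * n * p₃ := by positivity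
        linarith

/-- The 4 is the factor 2 of the pointwise estimate times the double covering by pieces. In 64(k+1),
one 8(k+1) comes from the pointwise estimate and the other 8 from the sum over the overlaps of the
squared differences of potentials. -/
theorem sum_l2NormSq_potentialGrad_le (hn : 1 ≤ n) (hu : FormMemL2 Ω u)
    (h : S.IsPiecePotential u Y V G) (h' : S.IsOverlapPotential Y V W H) :
    ∑ I ∈ incrTuples n (k + 1), ∑ j, l2NormSq Ω (S.potentialGrad V G W H I j) ≤
      (4 + 64 * (k + 1) * (n + (incrTuples n (k + 1)).card * (k + 1) * (n + 1))) *
        (Y ^ 2 * ∑ J ∈ incrTuples n (k + 2), l2NormSq Ω (coeff u J)) *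
        (1 + (S.CP * S.DT) ^ 2 * ((S.CS / S.dT) ^ 2 +
          (S.CS / S.dT ^ 2) ^ 2 * ((S.CP * S.DT) ^ 2 * Y ^ 2) + (S.CS / S.dT) ^ 2 * Y ^ 2)) := by
  set L : ℝ := n + (incrTuples n (k + 1)).card * (k + 1) * (n + 1) with hL
  have hL0 : 0 ≤ L := by positivity
  set P := (S.CP * S.DT) ^ 2 with hP
  set β := (S.CS / S.dT) ^ 2 + (S.CS / S.dT ^ 2) ^ 2 * (P * Y ^ 2) + (S.CS / S.dT) ^ 2 * Y ^ 2
    with hβ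
  have hP0 : 0 ≤ P := sq_nonneg _
  have hβ0 : 0 ≤ β := by positivity
  set U := ∑ J ∈ incrTuples n (k + 2), l2NormSq Ω (coeff u J) with hU
  have hU0 : 0 ≤ U := Finset.sum_nonneg fun J _ => l2NormSq_nonneg _
  set Ui : Fin (m + 1) → ℝ := fun i =>
    ∑ J ∈ incrTuples n (k + 2), l2NormSq (S.piece i) (coeff u J) with hUi
  have hUi0 : ∀ i, 0 ≤ Ui i := fun i => Finset.sum_nonneg fun J _ => l2NormSq_nonneg _
  have hUU : ∑ i, Ui i ≤ 2 * U := by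
    simp only [hUi, hU]
    rw [Finset.sum_comm, Finset.mul_sum]
    exact Finset.sum_le_sum fun J hJ => S.sum_l2NormSq_piece_le (hu J hJ)
  have hδ : ∑ s : Fin m, ∑ I ∈ incrTuples n (k + 1),
      l2NormSq (overlap S.piece s) (fun x => V I s.castSucc x - V I s.succ x) ≤
      8 * P * Y ^ 2 * U := by
    calc _ ≤ ∑ s : Fin m, P * (2 * Y ^ 2 * (Ui s.castSucc + Ui s.succ)) :=
          Finset.sum_le_sum fun s _ => h.l2NormSq_sub_le hn s
      _ = P * (2 * Y ^ 2 * ∑ s : Fin m, (Ui s.castSucc + Ui s.succ)) := by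
          simp only [Finset.mul_sum]
      _ ≤ P * (2 * Y ^ 2 * (2 * (2 * U))) := by
          gcongr
          exact (sum_castSucc_add_succ_le hUi0).trans (by linarith)
      _ = _ := by ring
  calc _ ≤ ∑ I ∈ incrTuples n (k + 1), ∑ j, (∑ i, 2 * l2NormSq (S.piece i) (G I i j) +
      ∑ s, 8 * (k + 1) * ((S.CS / S.dT) ^ 2 *
        l2NormSq (overlap S.piece s) (fun x => V I s.castSucc x - V I s.succ x) +
        ∑ q : Fin (k + 1), ((S.CS / S.dT ^ 2) ^ 2 *
            l2NormSq (overlap S.piece s) (W (fun r => I (q.succAbove r)) s) +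
          (S.CS / S.dT) ^ 2 *
            l2NormSq (overlap S.piece s) (H (fun r => I (q.succAbove r)) s j)))) :=
        Finset.sum_le_sum fun I _ => Finset.sum_le_sum fun j _ =>
          l2NormSq_potentialGrad_le hn h h' I j
    _ = 2 * (∑ i, ∑ I ∈ incrTuples n (k + 1), ∑ j, l2NormSq (S.piece i) (G I i j)) +
      8 * (k + 1) * ∑ s, ∑ I ∈ incrTuples n (k + 1), ∑ j, ((S.CS / S.dT) ^ 2 *
        l2NormSq (overlap S.piece s) (fun x => V I s.castSucc x - V I s.succ x) +
        ∑ q : Fin (k + 1), ((S.CS / S.dT ^ 2) ^ 2 *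
            l2NormSq (overlap S.piece s) (W (fun r => I (q.succAbove r)) s) +
          (S.CS / S.dT) ^ 2 *
            l2NormSq (overlap S.piece s) (H (fun r => I (q.succAbove r)) s j))) := by
        simp only [← Finset.mul_sum]
        rw [Finset.sum_congr rfl fun I _ => Finset.sum_add_distrib, Finset.sum_add_distrib]
        simp only [← Finset.mul_sum]
        rw [Finset.sum_comm (s := Finset.univ (α := Fin (m + 1))),
          Finset.sum_comm (s := Finset.univ (α := Fin m))]
        congr 2
        · exact Finset.sum_congr rfl fun I _ => Finset.sum_comm
        · exact Finset.sum_congr rfl fun I _ => Finset.sum_comm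
    _ ≤ 2 * (∑ i, Y ^ 2 * Ui i) + 8 * (k + 1) * ∑ s : Fin m, L * (β * ∑ I ∈ incrTuples n (k + 1),
            l2NormSq (overlap S.piece s) fun x => V I s.castSucc x - V I s.succ x) := by
        refine add_le_add (mul_le_mul_of_nonneg_left (Finset.sum_le_sum fun i _ =>
          h.energy_le i) zero_le_two) (mul_le_mul_of_nonneg_left (Finset.sum_le_sum fun s _ =>
          sum_overlap_le h' s) (by positivity))
    _ ≤ 2 * (Y ^ 2 * (2 * U)) + 8 * (k + 1) * (L * (β * (8 * P * Y ^ 2 * U))) := by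
        simp only [← Finset.mul_sum]
        gcongr
    _ ≤ _ := by
        have e1 : 0 ≤ 64 * ((k : ℝ) + 1) * L * (Y ^ 2 * U) := by positivity
        have e2 : 0 ≤ 4 * (Y ^ 2 * U) * (P * β) := by positivity
        linarith

end StarChain

/-! ### The estimate on the chain -/

theorem mainTheorem3 (n k : ℕ) (hk : k + 1 ≤ n) :
    ∃ c : ℝ, 0 < c ∧
      ∀ (m : ℕ) (Ω : Set (Eucl n)) (S : StarChain Ω m) (u : Eucl n → Forms n (k + 1)),
        FormMemL2 Ω u → WeaklyClosed Ω u →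
          ∃ v : Eucl n → Forms n k,
            FormMemH1 Ω v ∧ HasWeakExtDeriv Ω v u ∧
              formH1Semi Ω v ≤
                2 * S.CT c (k + 1) *
                  (if k = 0 then 1
                    else √(1 + 32 * S.CS ^ 2 *
                      (S.CT c (k + 1) * S.CP * S.DT / S.dT + 1) ^ 4)) *
                  formL2Norm Ω u := by
  have hn : 1 ≤ n := by omega
  cases k with
  | zero =>
    obtain ⟨c₁, hc₁, hpiece⟩ := StarChain.exists_isPiecePotential n 0 hk
    -- The summand `n` ensures that `CT` is at least n ≥ 1, so the crude factor `n` in the energy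
    -- bound is below the square of twice `CT`.
    refine ⟨c₁ + n, by positivity, fun m Ω S u hu hcl => ?_⟩
    obtain ⟨V, G, h⟩ := hpiece m Ω S u (S.CT (c₁ + n) 1) (fun i => by
      refine ((S.starShaped (Sum.inl i)).starConst_mono hn (c' := c₁ + n) ?_ 1).trans
        ((le_max_left _ _).trans (S.le_CT (c₁ + n) 1 (Sum.inl i)))
      exact le_add_of_nonneg_right (Nat.cast_nonneg n)) hu hcl
    obtain ⟨g, hg, hd, hE⟩ := h.exists_potential_one hn
    refine ⟨_, fun I hI => (hg I hI).memH1, hd, ?_⟩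
    have hCT : c₁ + n ≤ S.CT (c₁ + n) (0 + 1) := S.le_CT_self hn (by positivity) _
    have hn' : (1 : ℝ) ≤ n := by exact_mod_cast hn
    rw [if_pos rfl, mul_one]
    refine formH1Semi_le S.isOpen hg (by linarith) (hE.trans ?_)
    refine mul_le_mul_of_nonneg_right ?_ (Finset.sum_nonneg fun J _ => l2NormSq_nonneg _)
    nlinarith
  | succ k =>
    obtain ⟨c₁, hc₁, hpiece⟩ := StarChain.exists_isPiecePotential n (k + 1) hk
    obtain ⟨c₂, hc₂, hover⟩ := StarChain.exists_isOverlapPotential n k (by omega)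
    set M : ℝ := 4 + 64 * (k + 1) * (n + (incrTuples n (k + 1)).card * (k + 1) * (n + 1)) with hM
    have hM4 : 4 ≤ M := le_add_of_nonneg_right (by positivity)
    set c₀ := c₁ + c₂ + 1 with hc₀
    -- `c₀` dominates the local constants of both degrees and makes `Y` at least one. The additional
    -- factor `M` turns `CT` into `M * Y`, which absorbs the combinatorial factor of the energy
    -- bound.
    refine ⟨M * c₀, by positivity, fun m Ω S u hu hcl => ?_⟩
    set Y := S.CT c₀ (k + 2) with hY
    have hY1 : 1 ≤ Y := le_trans (by linarith) (S.le_CT_self hn (by positivity) (k + 2))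
    obtain ⟨V, G, h⟩ := hpiece m Ω S u Y (fun i =>
      ((S.starShaped (Sum.inl i)).starConst_mono hn (by linarith) (k + 2)).trans
        ((le_max_left _ _).trans (S.le_CT c₀ (k + 2) (Sum.inl i)))) hu hcl
    obtain ⟨W, H, h'⟩ := hover m Ω S u Y V G h fun s => by
      have h1 := (le_max_right _ _).trans (S.le_CT c₀ (k + 2) (Sum.inr s))
      rw [show max (k + 2 - 1) 1 = k + 1 by omega] at h1
      exact ((S.starShaped (Sum.inr s)).starConst_mono hn (c' := c₀) (by linarith)
        (k + 1)).trans h1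
    have hgrad : ∀ I ∈ incrTuples n (k + 1),
        HasWeakGrad Ω (coeff (formOfCoeff (S.potential V W)) I) (S.potentialGrad V G W H I) :=
      fun I hI => by
        rw [coeff_formOfCoeff _ hI]
        exact StarChain.hasWeakGrad_potential hn h h' I
    refine ⟨formOfCoeff (S.potential V W), fun I hI => (hgrad I hI).memH1,
      StarChain.hasWeakExtDeriv_potential hn h h', ?_⟩
    rw [if_neg (Nat.succ_ne_zero k), S.CT_mul (by positivity)]
    refine formH1Semi_le S.isOpen hgrad (by positivity)
      ((StarChain.sum_l2NormSq_potentialGrad_le hn hu h h').trans ?_)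
    have := chain_constant_le (C := S.CS) (by linarith : 1 ≤ M) (by nlinarith : M ≤ 4 * M ^ 2) hY1
      S.CP_mul_DT_nonneg (S.dT_pos hn)
      (Finset.sum_nonneg fun J _ => l2NormSq_nonneg (Ω := Ω) (coeff u J) :
        0 ≤ ∑ J ∈ incrTuples n (k + 2), l2NormSq Ω (coeff u J))
    rwa [← mul_assoc (M * Y)] at this
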